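/- Conventions. A model category is a category with all small limits and colimits and three classes of morphisms (weak equivalences, fibrations, cofibrations) satisfying the usual axioms MC1–MC5; factorizations need not be functorial. A category with weak equivalences is a category with a class of morphisms that contains all isomorphisms and has the two-out-of-three property. A functor $H$ from a model category to a category with weak equivalences is *homotopy meaningful on cofibrant objects* if it sends weak equivalences between cofibrant objects to weak equivalences. A *left model approximation* of a category with weak equivalences $\mathcal D$ is a model category $\mathcal M$ with a pair of adjoint functors $l:\mathcal M\rightleftarrows\mathcal D:r$ ($l$ left adjoint) such that $r$ preserves weak equivalences, $l$ is homotopy meaningful on cofibrant objects, and for every $A\in\mathcal D$ and every cofibrant $X\in\mathcal M$ the adjoint $lX\to A$ of a weak equivalence $X\to rA$ is a weak equivalence. It is *good* for a functor $F:\mathcal D\to\mathcal E$ to a category with weak equivalences if $F\circ l$ is homotopy meaningful on cofibrant objects. The *left derived functor* of $H:\mathcal D\to\mathcal E$ is a functor $LH:\mathcal D\to\mathcal E$ that inverts weak equivalences, with a natural transformation $LH\to H$ through which every natural transformation $G\to H$ from a functor $G$ inverting weak equivalences factors uniquely; the *total* left derived functor of $F:\mathcal D\to\mathcal E$ is the left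 derived functor of $\mathcal D\xrightarrow{F}\mathcal E\to Ho(\mathcal E)$, where $\mathcal E\to Ho(\mathcal E)$ is the localization at the weak equivalences. The total left derived functors of $\mathrm{colim}_I$ and of the left Kan extension $f^k$ are called the homotopy colimit and the homotopy left Kan extension. For a simplicial set $K$ let $\mathbf K$ be its simplex category (objects: simplices $\sigma:\Delta[n]\to K$; morphisms: maps over $K$). A functor $F:\mathbf K\to\mathcal M$ is *bounded* if it sends every degeneracy morphism $s_i\sigma\to\sigma$ to an isomorphism; $Fun^b(\mathbf K,\mathcal M)$ is the full subcategory of bounded functors. Let $\mathbf N(I)$ be the simplex category of the nerve of a small category $I$, let $\epsilon:\mathbf N(I)\to I$ send $(i_n\to\dots\to i_0)$ to $i_0$, let $\epsilon^*:Fun(I,\mathcal M)\to Fun^b(\mathbf N(I),\mathcal M)$ be precomposition with $\epsilon$ and $\epsilon^k$ its left adjoint, the restriction of the left Kan extension along $\epsilon$. Theorem. Let $\mathcal C$ be a category with weak equivalences, $l:\mathcal M\rightleftarrows\mathcal C:r$ a left model approximation, and $f:I\to J$ a functor between small categories. Give functor categories $Fun(I,\mathcal C)$, $Fun(J,\mathcal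 C)$ the objectwise weak equivalences, and write $l,r$ also for the functors induced on functor categories. (1) $Fun^b(\mathbf N(I),\mathcal M)$ is a model category in which weak equivalences and fibrations are objectwise, and $\Psi:F\to G$ is a cofibration if and only if for each non-degenerate simplex $\sigma:\Delta[n]\to N(I)$ the morphism $\mathrm{colim}\big(F(\sigma)\leftarrow \mathrm{colim}_{\partial\Delta[n]}F\to \mathrm{colim}_{\partial\Delta[n]}G\big)\to G(\sigma)$ is a cofibration in $\mathcal M$ (the inner colimits are over the simplex category of $\partial\Delta[n]$, of the restrictions along $\partial\Delta[n]\to\Delta[n]\to N(I)$). With this model structure the Bousfield–Kan pair $$l\circ\epsilon^k: Fun^b(\mathbf N(I),\mathcal M)\rightleftarrows Fun(I,\mathcal C):\epsilon^*\circ r$$ is a left model approximation of $Fun(I,\mathcal C)$. (2) If $\mathcal C$ is closed under (small) colimits, this approximation is good for $\mathrm{colim}_I:Fun(I,\mathcal C)\to\mathcal C$ and for the left Kan extension $f^k:Fun(I,\mathcal C)\to Fun(J,\mathcal C)$. (3) If $\mathcal C$ is closed under (small) colimits, the localizations $Ho(\mathcal C)$ and $Ho(Fun(J,\mathcal C))$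 exist (with sets of morphisms), and the homotopy colimit $Fun(I,\mathcal C)\to Ho(\mathcal C)$ and the homotopy left Kan extension $Fun(I,\mathcal C)\to Ho(Fun(J,\mathcal C))$ exist. For every choice of cofibrant replacements $Q$ (of objects, $QX\to X$ an acyclic fibration with $QX$ cofibrant, and of morphisms, compatibly with $QX\to X$, not necessarily functorially) in $Fun^b(\mathbf N(I),\mathcal M)$, they are given by $F\mapsto \mathrm{colim}_I\,(l\epsilon^kQ\epsilon^*rF)$ and $F\mapsto f^k(l\epsilon^kQ\epsilon^*rF)$, which are well-defined functors to the respective localizations, with the natural transformations to $\mathrm{colim}_I$ and $f^k$ induced by the adjoints $l\epsilon^kQ\epsilon^*rF\to F$ of $Q\epsilon^*rF\to\epsilon^*rF$. -/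

import Mathlib

open CategoryTheory Limits HomotopicalAlgebra Opposite Simplicial

universe w vM uM vC uC vD uD vE uE vH uH

noncomputable section

namespace ModelApproximation

/-! ## Simplex categories, bounded diagrams -/

/-- The simplex category of a simplicial set `K`: an object is a simplex `x` of `K` (that is, a
map `Δ[n] ⟶ K`), and a morphism from the `m`-simplex `y` to the `n`-simplex `x` is a map
`θ : ⦋m⦌ ⟶ ⦋n⦌` with `θ^* x = y`. -/
abbrev SimplexCat (K : SSet.{w}) : Type w := K.Elementsᵒᵖ

namespace SimplexCat

variable {K : SSet.{w}}

/-- A simplex as an object of the simplex category. -/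
abbrev mk {n : ℕ} (x : K _⦋n⦌) : SimplexCat K := op (Functor.elementsMk K (op ⦋n⦌) x)

/-- The morphism `θ^* x ⟶ x` given by `θ`. -/
def homMk {m n : ℕ} (x : K _⦋n⦌) (θ : ⦋m⦌ ⟶ ⦋n⦌) : mk (K.map θ.op x) ⟶ mk x :=
  (CategoryOfElements.homMk (Functor.elementsMk K (op ⦋n⦌) x) (Functor.elementsMk K _ _)
    θ.op rfl).op

/-- The degeneracy morphism `s_i x ⟶ x`. -/
def degeneracy {n : ℕ} (x : K _⦋n⦌) (i : Fin (n + 1)) :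
    mk (K.map (SimplexCategory.σ i).op x) ⟶ mk x :=
  homMk x (SimplexCategory.σ i)

/-- The functor induced by a map of simplicial sets. -/
abbrev map {L : SSet.{w}} (g : L ⟶ K) : SimplexCat L ⥤ SimplexCat K :=
  (NatTrans.mapElements g).op

/-- The functor from the simplex category of `∂Δ[n]` to the one of `K` induced by the
composite `∂Δ[n] ⟶ Δ[n] ⟶ K`, where the second map is the one given by `x`. -/
abbrev boundary {n : ℕ} (x : K _⦋n⦌) :
    SimplexCat ((SSet.boundary.{w} n : (Δ[n] : SSet.{w}).Subcomplex) : SSet.{w}) ⥤ SimplexCat K :=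
  map ((SSet.boundary.{w} n).ι ≫ SSet.yonedaEquiv.symm x)

end SimplexCat

/-- A diagram on the simplex category of `K` is bounded if it sends all degeneracy morphisms to
isomorphisms. -/
def IsBounded (K : SSet.{w}) (M : Type uM) [Category.{vM} M] :
    ObjectProperty (SimplexCat K ⥤ M) :=
  fun F ↦ ∀ (n : ℕ) (x : K _⦋n⦌) (i : Fin (n + 1)), IsIso (F.map (SimplexCat.degeneracy x i))

/-- `Fun^b(K, M)`: the full subcategory of bounded diagrams. -/
abbrev BoundedDiagram (K : SSet.{w}) (M : Type uM) [Category.{vM} M] :=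
  (IsBounded K M).FullSubcategory

/-- The natural transformations of bounded diagrams that belong objectwise to `P`. -/
def BoundedDiagram.objectwise {K : SSet.{w}} {M : Type uM} [Category.{vM} M]
    (P : MorphismProperty M) : MorphismProperty (BoundedDiagram K M) :=
  fun _ _ Ψ ↦ ∀ σ : SimplexCat K, P (Ψ.hom.app σ)

/-! ## Cofibrations of bounded diagrams -/

section Cofibrations

variable {K : SSet.{w}} {M : Type uM} [Category.{vM} M]

/-- The canonical cocone with point `F x` on the restriction of `F` to the boundary of `x`: a
simplex of `∂Δ[n]`, which is a non-surjective map `θ : ⦋m⦌ ⟶ ⦋n⦌`, is sent to the morphism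
`F (θ^* x) ⟶ F x` given by `θ`. -/
def boundaryCocone (F : SimplexCat K ⥤ M) {n : ℕ} (x : K _⦋n⦌) :
    Cocone (SimplexCat.boundary x ⋙ F) where
  pt := F.obj (SimplexCat.mk x)
  ι :=
    { app := fun τ ↦ F.map (CategoryOfElements.homMk (Functor.elementsMk K (op ⦋n⦌) x)
        ((SimplexCat.boundary x).obj τ).unop (SSet.stdSimplex.objEquiv τ.unop.2.1).op rfl).op
      naturality := by
        intro τ τ' f
        have h : ((SSet.boundary.{w} n : (Δ[n] : SSet.{w}).Subcomplex) : SSet.{w}).map f.unop.1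
            τ'.unop.2 = τ.unop.2 := f.unop.2
        have h' := congrArg Subtype.val h
        simp only [Functor.const_obj_obj, Functor.const_obj_map, Category.comp_id,
          Functor.comp_map, ← F.map_comp]
        congr 1
        apply Quiver.Hom.unop_inj
        apply Subtype.ext
        apply Quiver.Hom.unop_inj
        change f.unop.1.unop ≫ SSet.stdSimplex.objEquiv τ'.unop.2.1 =
          SSet.stdSimplex.objEquiv τ.unop.2.1
        rw [← h']
        rfl }

variable [HasColimitsOfSize.{w, w} M]

instance (L : SSet.{w}) : HasColimitsOfShape (SimplexCat L) M :=
  have := hasColimitsOfSizeOfUnivLE.{w, w, 0, w} M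
  inferInstance

instance (L : SSet.{w}) {I : Type w} [SmallCategory.{w} I] (ε : SimplexCat L ⥤ I) (i : I) :
    HasColimitsOfShape (CostructuredArrow ε i) M :=
  have := hasColimitsOfSizeOfUnivLE.{w, w, 0, w} M
  inferInstance

/-- The morphism `colim_{∂Δ[n]} F ⟶ F x`. -/
def boundaryToObj (F : SimplexCat K ⥤ M) {n : ℕ} (x : K _⦋n⦌) :
    colimit (SimplexCat.boundary x ⋙ F) ⟶ F.obj (SimplexCat.mk x) :=
  colimit.desc _ (boundaryCocone F x)

/-- The morphism `colim_{∂Δ[n]} F ⟶ colim_{∂Δ[n]} G` induced by `Ψ : F ⟶ G`. -/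
def boundaryMap {F G : SimplexCat K ⥤ M} (Ψ : F ⟶ G) {n : ℕ} (x : K _⦋n⦌) :
    colimit (SimplexCat.boundary x ⋙ F) ⟶ colimit (SimplexCat.boundary x ⋙ G) :=
  colimMap (Functor.whiskerLeft (SimplexCat.boundary x) Ψ)

lemma boundaryToObj_naturality {F G : SimplexCat K ⥤ M} (Ψ : F ⟶ G) {n : ℕ} (x : K _⦋n⦌) :
    boundaryToObj F x ≫ Ψ.app (SimplexCat.mk x) = boundaryMap Ψ x ≫ boundaryToObj G x := by
  apply colimit.hom_ext
  intro τ
  simp [boundaryToObj, boundaryMap, boundaryCocone]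

variable [HasPushouts M]

/-- `M_Ψ(x)`: the pushout of `F x ⟵ colim_{∂Δ[n]} F ⟶ colim_{∂Δ[n]} G`. -/
def relativeLatching {F G : SimplexCat K ⥤ M} (Ψ : F ⟶ G) {n : ℕ} (x : K _⦋n⦌) : M :=
  pushout (boundaryToObj F x) (boundaryMap Ψ x)

/-- The canonical morphism `M_Ψ(x) ⟶ G x`. -/
def relativeLatchingMap {F G : SimplexCat K ⥤ M} (Ψ : F ⟶ G) {n : ℕ} (x : K _⦋n⦌) :
    relativeLatching Ψ x ⟶ G.obj (SimplexCat.mk x) :=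
  pushout.desc (Ψ.app (SimplexCat.mk x)) (boundaryToObj G x) (boundaryToObj_naturality Ψ x)

/-- `Ψ : F ⟶ G` is a cofibration of bounded diagrams if `M_Ψ(x) ⟶ G x` is a cofibration for all
non-degenerate simplices `x`. -/
def BoundedDiagram.latchingCofibrations [CategoryWithCofibrations M] :
    MorphismProperty (BoundedDiagram K M) :=
  fun _ _ Ψ ↦ ∀ (n : ℕ) (x : K _⦋n⦌), x ∈ K.nonDegenerate n →
    cofibrations M (relativeLatchingMap Ψ.hom x)

end Cofibrations

/-! ## Left model approximations and left derived functors -/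

section Approximations

variable {M : Type uM} [Category.{vM} M] {D : Type uD} [Category.{vD} D]
  {E : Type uE} [Category.{vE} E]

/-- `H` sends weak equivalences between cofibrant objects to weak equivalences. -/
def HomotopyMeaningfulOnCofibrant [ModelCategory M] (H : M ⥤ D) (W : MorphismProperty D) : Prop :=
  ∀ ⦃X Y : M⦄ (f : X ⟶ Y), IsCofibrant X → IsCofibrant Y → WeakEquivalence f → W (H.map f)

/-- The adjunction `l ⊣ r` between the model category `M` and `D` is a left model approximation
of the category with weak equivalences `(D, W)`. -/
structure IsLeftModelApproximation [ModelCategory M] (W : MorphismProperty D)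
    {l : M ⥤ D} {r : D ⥤ M} (adj : l ⊣ r) : Prop where
  isomorphisms_le : MorphismProperty.isomorphisms D ≤ W
  twoOutOfThree : W.HasTwoOutOfThreeProperty
  right_map : ∀ ⦃A B : D⦄ (f : A ⟶ B), W f → WeakEquivalence (r.map f)
  left_map : HomotopyMeaningfulOnCofibrant l W
  adjoint_map : ∀ ⦃A : D⦄ ⦃X : M⦄ (f : X ⟶ r.obj A), IsCofibrant X → WeakEquivalence f →
    W ((adj.homEquiv X A).symm f)

/-- `l ⊣ r` is good for `F : D ⥤ E`, where `W` is the class of weak equivalences of `E`. -/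
def IsGoodFor [ModelCategory M] {l : M ⥤ D} {r : D ⥤ M} (_ : l ⊣ r) (F : D ⥤ E)
    (W : MorphismProperty E) : Prop :=
  HomotopyMeaningfulOnCofibrant (l ⋙ F) W

/-- `α : LH ⟶ H` is the left derived functor of `H : D ⥤ E`. (If `H` is a composite `F ⋙ L`
with `L` a localization functor, this is the total left derived functor of `F`.) -/
structure IsLeftDerived (W : MorphismProperty D) {H LH : D ⥤ E} (α : LH ⟶ H) : Prop where
  isInvertedBy : W.IsInvertedBy LH
  existsUnique : ∀ (G : D ⥤ E), W.IsInvertedBy G → ∀ β : G ⟶ H, ∃! γ : G ⟶ LH, γ ≫ α = β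

/-- A choice of cofibrant replacements of objects and of morphisms; it need not be functorial. -/
structure CofibrantReplacement (M : Type uM) [Category.{vM} M] [ModelCategory M] where
  obj : M → M
  π (X : M) : obj X ⟶ X
  isCofibrant (X : M) : IsCofibrant (obj X)
  fibration (X : M) : Fibration (π X)
  weakEquivalence (X : M) : WeakEquivalence (π X)
  map {X Y : M} (f : X ⟶ Y) : obj X ⟶ obj Y
  map_π {X Y : M} (f : X ⟶ Y) : map f ≫ π Y = π X ≫ f

namespace CofibrantReplacement

variable [ModelCategory M] (Q : CofibrantReplacement M) {l : M ⥤ D} {r : D ⥤ M} (adj : l ⊣ r)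

/-- The morphism `l Q r A ⟶ A` adjoint to `Q r A ⟶ r A`. -/
def counit (A : D) : l.obj (Q.obj (r.obj A)) ⟶ A :=
  (adj.homEquiv (Q.obj (r.obj A)) A).symm (Q.π (r.obj A))

lemma counit_naturality {A B : D} (f : A ⟶ B) :
    l.map (Q.map (r.map f)) ≫ Q.counit adj B = Q.counit adj A ≫ f := by
  simp only [counit]
  rw [← adj.homEquiv_naturality_left_symm, Q.map_π, adj.homEquiv_naturality_right_symm]

/-- The assignments `A ↦ Φ (l Q r A)` and `f ↦ Φ (l Q r f)` respect identities and composition. -/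
structure IsFunctorial (l : M ⥤ D) (r : D ⥤ M) (Φ : D ⥤ E) : Prop where
  map_id : ∀ A : D, Φ.map (l.map (Q.map (r.map (𝟙 A)))) = 𝟙 _
  map_comp : ∀ ⦃A B C : D⦄ (f : A ⟶ B) (g : B ⟶ C),
    Φ.map (l.map (Q.map (r.map (f ≫ g)))) =
      Φ.map (l.map (Q.map (r.map f))) ≫ Φ.map (l.map (Q.map (r.map g)))

/-- The functor `A ↦ Φ (l Q r A)`. -/
@[simps]
def functor {Φ : D ⥤ E} (h : Q.IsFunctorial l r Φ) : D ⥤ E where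
  obj A := Φ.obj (l.obj (Q.obj (r.obj A)))
  map f := Φ.map (l.map (Q.map (r.map f)))
  map_id := h.map_id
  map_comp f g := h.map_comp f g

/-- The natural transformation `Φ (l Q r A) ⟶ Φ A` induced by `l Q r A ⟶ A`. -/
@[simps]
def natTrans {Φ : D ⥤ E} (h : Q.IsFunctorial l r Φ) : Q.functor h ⟶ Φ where
  app A := Φ.map (Q.counit adj A)
  naturality A B f := by
    exact (Φ.map_comp _ _).symm.trans
      ((congrArg Φ.map (Q.counit_naturality adj f)).trans (Φ.map_comp _ _))

end CofibrantReplacement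

end Approximations

/-! ## The Bousfield-Kan approximation -/

section BousfieldKan

variable (I : Type w) [SmallCategory.{w} I]

variable {I} in
/-- The chain of composable morphisms underlying a simplex of the nerve. -/
abbrev chain (X : SimplexCat (nerve I)) : ComposableArrows I X.unop.1.unop.len := X.unop.2

variable {I} in
lemma chain_obj_last {X Y : SimplexCat (nerve I)} (f : X ⟶ Y) :
    (chain X).obj (Fin.last _) = (chain Y).obj (f.unop.1.unop.toOrderHom (Fin.last _)) :=
  congrArg (fun x : ComposableArrows I X.unop.1.unop.len ↦ x.obj (Fin.last _)) f.unop.2.symm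

variable {I} in
/-- The morphism from the last object of `X` to the last object of `Y` induced by `f : X ⟶ Y`. -/
def forgetfulMap {X Y : SimplexCat (nerve I)} (f : X ⟶ Y) :
    (chain X).obj (Fin.last _) ⟶ (chain Y).obj (Fin.last _) :=
  eqToHom (chain_obj_last f) ≫
    (chain Y).map (homOfLE (Fin.le_last (f.unop.1.unop.toOrderHom (Fin.last _))))

variable {I} in
lemma forgetfulMap_comp_aux {X Y Z : SimplexCategoryᵒᵖ} (g : Z ⟶ Y) (f : Y ⟶ X)
    (z : (nerve I).obj Z) (y : (nerve I).obj Y) (hg : (nerve I).map g z = y)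
    (x : (nerve I).obj X) (hf : (nerve I).map f y = x)
    (f' : (op ⟨X, x⟩ : SimplexCat (nerve I)) ⟶ op ⟨Y, y⟩) (hf' : f' =
      (CategoryOfElements.homMk (Functor.elementsMk _ Y y) (Functor.elementsMk _ X x) f hf).op)
    (g' : (op ⟨Y, y⟩ : SimplexCat (nerve I)) ⟶ op ⟨Z, z⟩) (hg' : g' =
      (CategoryOfElements.homMk (Functor.elementsMk _ Z z) (Functor.elementsMk _ Y y) g hg).op) :
    forgetfulMap (f' ≫ g') = forgetfulMap f' ≫ forgetfulMap g' := by
  subst hg hf hf' hg'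
  let c : ComposableArrows I Z.unop.len := z
  change 𝟙 _ ≫ c.map _ = (𝟙 _ ≫ c.map _) ≫ 𝟙 _ ≫ c.map _
  rw [Category.id_comp, Category.id_comp, Category.id_comp]
  exact c.map_comp _ _

/-- The forgetful functor `ε` from the simplex category of the nerve of `I` to `I`; it sends a
chain of composable morphisms to its last object, that is, to the target of the composite. -/
def forgetful : SimplexCat (nerve I) ⥤ I where
  obj X := (chain X).obj (Fin.last _)
  map f := forgetfulMap f
  map_id X := (Category.id_comp _).trans ((chain X).map_id _)
  map_comp f g := forgetfulMap_comp_aux g.unop.1 f.unop.1 _ _ g.unop.2 _ f.unop.2 f rfl g rfl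

variable {M : Type uM} [Category.{vM} M]

/-- Precomposition with `ε` gives bounded diagrams. -/
lemma isBounded_forgetful_comp (F : I ⥤ M) : IsBounded (nerve I) M (forgetful I ⋙ F) := by
  intro n x i
  have h : (SimplexCategory.σ i).toOrderHom (Fin.last (n + 1)) = Fin.last n := by
    change Fin.predAbove i (Fin.last (n + 1)) = Fin.last n
    simp
  have : IsIso ((forgetful I).map (SimplexCat.degeneracy x i)) := by
    have : IsIso ((chain (SimplexCat.mk x)).map
        (homOfLE (Fin.le_last ((SimplexCategory.σ i).toOrderHom (Fin.last (n + 1)))))) := by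
      have : IsIso (homOfLE (Fin.le_last ((SimplexCategory.σ i).toOrderHom (Fin.last (n + 1))))) :=
        ⟨homOfLE h.ge, Subsingleton.elim _ _, Subsingleton.elim _ _⟩
      infer_instance
    change IsIso (eqToHom _ ≫ _)
    exact IsIso.comp_isIso' (f := eqToHom (chain_obj_last (SimplexCat.degeneracy x i)))
      inferInstance this
  exact inferInstanceAs (IsIso (F.map ((forgetful I).map (SimplexCat.degeneracy x i))))

/-- `ε^* : Fun(I, M) ⥤ Fun^b(N(I), M)`. -/
def pullbackAlong : (I ⥤ M) ⥤ BoundedDiagram (nerve I) M :=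
  (IsBounded (nerve I) M).lift ((Functor.whiskeringLeft _ _ M).obj (forgetful I))
    (isBounded_forgetful_comp I)

variable [HasColimitsOfSize.{w, w} M]

/-- `ε^k : Fun^b(N(I), M) ⥤ Fun(I, M)`, the restriction of the left Kan extension along `ε`. -/
def leftKan : BoundedDiagram (nerve I) M ⥤ (I ⥤ M) :=
  (IsBounded (nerve I) M).ι ⋙ (forgetful I).lan

/-- `ε^k` is left adjoint to `ε^*`. -/
def leftKanAdjunction : leftKan (M := M) I ⊣ pullbackAlong I :=
  ((forgetful I).lanAdjunction M).restrictFullyFaithful (iC := (IsBounded (nerve I) M).ι)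
    (iD := 𝟭 _) (IsBounded (nerve I) M).fullyFaithfulι (.id _) (Iso.refl _) (Iso.refl _)

variable {C : Type uC} [Category.{vC} C] {l : M ⥤ C} {r : C ⥤ M}

/-- The composite `l ∘ ε^k : Fun^b(N(I), M) ⥤ Fun(I, C)`. -/
abbrev bousfieldKanLeft (l : M ⥤ C) : BoundedDiagram (nerve I) M ⥤ (I ⥤ C) :=
  leftKan I ⋙ (Functor.whiskeringRight I M C).obj l

/-- The composite `ε^* ∘ r : Fun(I, C) ⥤ Fun^b(N(I), M)`. -/
abbrev bousfieldKanRight (r : C ⥤ M) : (I ⥤ C) ⥤ BoundedDiagram (nerve I) M :=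
  (Functor.whiskeringRight I C M).obj r ⋙ pullbackAlong I

/-- The Bousfield-Kan pair of adjoint functors
`l ∘ ε^k : Fun^b(N(I), M) ⇄ Fun(I, C) : ε^* ∘ r`. -/
def bousfieldKan (adj : l ⊣ r) : bousfieldKanLeft I l ⊣ bousfieldKanRight I r :=
  (leftKanAdjunction I).comp (adj.whiskerRight I)

end BousfieldKan

end ModelApproximation

end

open ModelApproximation

/-! For a general model category M the category Fun(I, M) need not be a model category. It is
replaced by bounded diagrams on N(I), whose shape is inductive.

Model structure. Identify parallel morphisms of a simplex category that agree after composition with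
a degeneracy. In the quotient the degeneracies are invertible, and bounded diagrams are exactly the
diagrams on the quotient. By the Eilenberg-Zilber lemma every simplex is in a unique way a
degeneracy of a non-degenerate one, its root, so the quotient is direct up to equivalence, graded by
the dimension of the root. Over a direct category factorizations are built degree by degree
(`exists_factorization`), which gives the projective model structure; it is transported to bounded
diagrams. Its cofibrations are defined by lifting. They are the latching cofibrations
(`latchingCofibrations_eq_llp`): latching cofibrations lift skeleton by skeleton, and conversely the
latching condition at `x` is a lifting problem against a map of product diagrams built from the
morphisms to `x`.

Approximation. The crux is `weakEquivalence_leftKan_desc`: if X is cofibrant and X ⟶ ε^* H is a weak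
equivalence, then so is ε^k X ⟶ H. The value of ε^k X at i is the colimit of X over the comma
category of ε over i. The restriction of X there is still cofibrant, since restriction has a right
adjoint made of products. The comma category contracts to the chain (i) by the zigzag σ ⟶ σ * i ⟵
(i), where σ * i is σ with i appended. Since X is weakly equivalent to ε^* H, it sends the second
arrow to a weak equivalence, and therefore X(i) ⟶ colim is a weak equivalence
(`weakEquivalence_colimitι`). The remaining conditions, and goodness for colimits and Kan
extensions, hold because the functors in question are left Quillen functors followed by l.

Derived functors. For any left model approximation, a functor Φ that inverts l of weak equivalences
between cofibrant objects has the left derived functor A ↦ Φ(l Q r A) (`isLeftDerived`). The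
localization has small morphism sets because r induces a faithful functor to the homotopy category
of the model category (`nonempty_hasLocalization`). -/

noncomputable section

namespace ModelApproximation

/-! ## Isomorphisms in the homotopy category -/

section Saturation

variable {N : Type uM} [Category.{vM} N] [ModelCategory N] {H : Type uH} [Category.{vH} H]
  (L : N ⥤ H) [L.IsLocalization (weakEquivalences N)]

include L in
-- The inverse in the homotopy category is represented by a map `s`, and the covering homotopy
-- property of `p` deforms `s` to a strict section `s'`. Then `p ≫ s'` is homotopic to the identity,
-- hence a weak equivalence, and `p` is a retract of it.
lemma weakEquivalence_of_fibration_of_isIso_map {X Y : N} (p : X ⟶ Y) [Fibration p]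
    [IsCofibrant X] [IsCofibrant Y] [IsFibrant Y] [IsIso (L.map p)] : WeakEquivalence p := by
  have : IsFibrant X := isFibrant_of_fibration p
  obtain ⟨s, hs⟩ := map_surjective_of_isLocalization L Y X (inv (L.map p))
  have h₁ : L.map (s ≫ p) = L.map (𝟙 Y) := by simp [hs]
  rw [← LeftHomotopyRel.iff_map_eq] at h₁
  obtain ⟨P, _, ⟨h⟩⟩ := h₁.exists_good_cylinder
  obtain ⟨s', h', hs'⟩ := h.covering_homotopy p s
  have hs'p : s' ≫ p = 𝟙 Y := by rw [← h'.h₁, Category.assoc, hs', h.h₁]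
  have h₂ : L.map (p ≫ s') = L.map (𝟙 X) := by
    rw [L.map_comp, ← h'.leftHomotopyRel.factorsThroughLocalization.map_eq L, hs,
      IsIso.hom_inv_id, L.map_id]
  rw [← LeftHomotopyRel.iff_map_eq] at h₂
  obtain ⟨P', ⟨h₃⟩⟩ := h₂
  have h₄ : WeakEquivalence (p ≫ s') := h₃.weakEquivalence_iff.2 inferInstance
  rw [weakEquivalence_iff] at h₄ ⊢
  exact MorphismProperty.of_retract
    { i := Arrow.homMk (𝟙 X) s' (by simp)
      r := Arrow.homMk (𝟙 X) p (by simp [hs'p])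
      retract := by ext <;> simp [hs'p] } h₄

lemma isIso_map_of_weakEquivalence {X Y : N} (f : X ⟶ Y) [WeakEquivalence f] :
    IsIso (L.map f) :=
  Localization.inverts L (weakEquivalences N) f (mem_weakEquivalences f)

include L in
-- Reduction to fibrations: composing with a fibrant replacement of `Y` and splitting off a trivial
-- cofibration keeps all objects cofibrant and changes `f` only by weak equivalences.
lemma weakEquivalence_of_isIso_map_of_isCofibrant {X Y : N} (f : X ⟶ Y)
    [IsCofibrant X] [IsCofibrant Y] [IsIso (L.map f)] : WeakEquivalence f := by
  let hY := MorphismProperty.factorizationData (trivialCofibrations N) (fibrations N)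
    (terminal.from Y)
  have : IsFibrant hY.Z := by
    rw [isFibrant_iff_of_isTerminal hY.p terminalIsTerminal]
    infer_instance
  have : IsCofibrant hY.Z := isCofibrant_of_cofibration hY.i
  have := isIso_map_of_weakEquivalence L hY.i
  suffices WeakEquivalence (f ≫ hY.i) from weakEquivalence_of_postcomp f hY.i
  let hX := MorphismProperty.factorizationData (trivialCofibrations N) (fibrations N) (f ≫ hY.i)
  have : IsCofibrant hX.Z := isCofibrant_of_cofibration hX.i
  have := isIso_map_of_weakEquivalence L hX.i
  have : IsIso (L.map hX.p) := by
    have h : L.map hX.i ≫ L.map hX.p = L.map f ≫ L.map hY.i := by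
      rw [← L.map_comp, hX.fac, L.map_comp]
    have : IsIso (L.map hX.i ≫ L.map hX.p) := by rw [h]; infer_instance
    exact IsIso.of_isIso_comp_left (L.map hX.i) _
  have := weakEquivalence_of_fibration_of_isIso_map L hX.p
  rw [← hX.fac]
  infer_instance

end Saturation

/-! ## Left adjoints of functors preserving fibrations and trivial fibrations -/

section Quillen

variable {N : Type uM} [Category.{vM} N] [ModelCategory N] {N' : Type uD} [Category.{vD} N']
  [ModelCategory N'] {G : N ⥤ N'} {R : N' ⥤ N}

lemma cofibration_map_of_adjunction (adj : G ⊣ R)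
    (h : ∀ ⦃X Y : N'⦄ (p : X ⟶ Y), Fibration p → WeakEquivalence p →
      Fibration (R.map p) ∧ WeakEquivalence (R.map p)) {X Y : N} (i : X ⟶ Y) [Cofibration i] :
    Cofibration (G.map i) := by
  rw [cofibration_iff, ← trivialFibrations_llp]
  intro A B p hp
  rw [mem_trivialFibrations_iff] at hp
  rw [adj.hasLiftingProperty_iff]
  have := (h p hp.1 hp.2).1
  have := (h p hp.1 hp.2).2
  infer_instance

lemma isCofibrant_map_of_adjunction (adj : G ⊣ R)
    (h : ∀ ⦃X Y : N'⦄ (p : X ⟶ Y), Fibration p → WeakEquivalence p →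
      Fibration (R.map p) ∧ WeakEquivalence (R.map p)) {X : N} (hX : IsCofibrant X) :
    IsCofibrant (G.obj X) := by
  have := adj.leftAdjoint_preservesColimits
  rw [isCofibrant_iff_of_isInitial (G.map (initial.to X))
    (IsInitial.isInitialObj G _ initialIsInitial)]
  exact cofibration_map_of_adjunction adj h _

lemma trivialCofibration_map_of_adjunction (adj : G ⊣ R)
    (h : ∀ ⦃X Y : N'⦄ (p : X ⟶ Y), Fibration p → Fibration (R.map p))
    {X Y : N} (i : X ⟶ Y) [Cofibration i] [WeakEquivalence i] :
    WeakEquivalence (G.map i) := by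
  have : trivialCofibrations N' (G.map i) := by
    rw [← fibrations_llp]
    intro A B p hp
    rw [adj.hasLiftingProperty_iff]
    have := h p ((fibration_iff _).2 hp)
    infer_instance
  exact (mem_trivialCofibrations_iff _).1 this |>.2

/-- Ken Brown's lemma. -/
lemma weakEquivalence_map_of_adjunction (adj : G ⊣ R)
    (h : ∀ ⦃X Y : N'⦄ (p : X ⟶ Y), Fibration p → Fibration (R.map p))
    ⦃X Y : N⦄ (f : X ⟶ Y) (hX : IsCofibrant X) (hY : IsCofibrant Y) (hf : WeakEquivalence f) :
    WeakEquivalence (G.map f) := by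
  -- Here `f = i ≫ p`, and `p` has a section `s` which is a trivial cofibration, as is `i`.
  obtain ⟨F⟩ : Nonempty (CofibrantBrownFactorization f) := inferInstance
  have h₁ := trivialCofibration_map_of_adjunction adj h F.i
  have h₂ := trivialCofibration_map_of_adjunction adj h F.s
  have h₃ : WeakEquivalence (G.map F.p) :=
    weakEquivalence_of_precomp_of_fac (f := G.map F.s) (fg := 𝟙 _)
      (by rw [← G.map_comp, F.s_p, G.map_id])
  rw [← F.fac, G.map_comp]
  infer_instance

end Quillen

/-! ## Left derived functors from cofibrant replacements -/

section Replacement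

variable {M : Type uM} [Category.{vM} M] [ModelCategory M] {D : Type uD} [Category.{vD} D]
  {E : Type uE} [Category.{vE} E]

/-- A functor inverting the weak equivalences between cofibrant objects takes the same value on
two morphisms from a cofibrant object that become equal after composition with a trivial
fibration. -/
lemma map_eq_of_comp_trivialFibration_eq (G : M ⥤ E)
    (hG : ∀ ⦃X Y : M⦄ (f : X ⟶ Y), IsCofibrant X → IsCofibrant Y → WeakEquivalence f →
      IsIso (G.map f)) {X Y Z : M} [IsCofibrant X] (p : Y ⟶ Z)
    [Fibration p] [WeakEquivalence p] {u v : X ⟶ Y} (h : u ≫ p = v ≫ p) : G.map u = G.map v := by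
  obtain ⟨P, _⟩ := Cylinder.exists_very_good X
  have sq : CommSq (coprod.desc u v) P.i p (P.π ≫ u ≫ p) :=
    ⟨by ext <;> simp [← h, Precylinder.i]⟩
  have h₀ : P.i₀ ≫ sq.lift = u := by
    rw [← P.inl_i, Category.assoc, sq.fac_left, coprod.inl_desc]
  have h₁ : P.i₁ ≫ sq.lift = v := by
    rw [← P.inr_i, Category.assoc, sq.fac_left, coprod.inr_desc]
  have := hG P.π inferInstance inferInstance inferInstance
  -- Both ends of the cylinder are sections of `P.π`, which `G` inverts.
  have h₂ : G.map P.i₀ = G.map P.i₁ := by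
    rw [← cancel_mono (G.map P.π), ← G.map_comp, ← G.map_comp, P.i₀_π, P.i₁_π]
  calc G.map u = G.map P.i₀ ≫ G.map sq.lift := by rw [← G.map_comp, h₀]
    _ = G.map P.i₁ ≫ G.map sq.lift := by rw [h₂]
    _ = G.map v := by rw [← G.map_comp, h₁]

namespace CofibrantReplacement

variable (M) in
lemma nonempty : Nonempty (CofibrantReplacement M) := by
  have h (X : M) : ∃ (Y : M) (_ : IsCofibrant Y) (p : Y ⟶ X), Fibration p ∧ WeakEquivalence p :=
    CofibrantObject.HoCat.exists_resolution X
  choose obj h₁ π h₂ h₃ using h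
  have h (X Y : M) (f : X ⟶ Y) : ∃ (g : obj X ⟶ obj Y), g ≫ π Y = π X ≫ f := by
    have := h₁ X
    have sq : CommSq (initial.to (obj Y)) (initial.to (obj X)) (π Y) (π X ≫ f) := ⟨by simp⟩
    exact ⟨sq.lift, sq.fac_right⟩
  choose map h₄ using h
  exact ⟨{ obj := obj, π := π, isCofibrant := h₁, fibration := h₂, weakEquivalence := h₃
           map := map _ _, map_π := h₄ _ _ }⟩

variable (Q : CofibrantReplacement M) {l : M ⥤ D} {r : D ⥤ M}

lemma weakEquivalence_map {X Y : M} (f : X ⟶ Y) [WeakEquivalence f] :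
    WeakEquivalence (Q.map f) := by
  have := Q.weakEquivalence X
  have := Q.weakEquivalence Y
  exact weakEquivalence_of_postcomp_of_fac (Q.map_π f)

/-- Both sides of each identity come from lifts of the same morphism along the trivial fibration
`Q.π`, so their images under `l ⋙ Φ` agree. -/
lemma isFunctorial (r : D ⥤ M) (Φ : D ⥤ E)
    (hΦ : ∀ ⦃X Y : M⦄ (f : X ⟶ Y), IsCofibrant X → IsCofibrant Y → WeakEquivalence f →
      IsIso (Φ.map (l.map f))) : Q.IsFunctorial l r Φ where
  map_id A := by
    have := Q.isCofibrant (r.obj A)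
    have := Q.fibration (r.obj A)
    have := Q.weakEquivalence (r.obj A)
    have := map_eq_of_comp_trivialFibration_eq (l ⋙ Φ) hΦ (Q.π (r.obj A))
      (u := Q.map (r.map (𝟙 A))) (v := 𝟙 _) (by simp [Q.map_π])
    exact this.trans ((l ⋙ Φ).map_id _)
  map_comp A B C f g := by
    have := Q.isCofibrant (r.obj A)
    have := Q.fibration (r.obj C)
    have := Q.weakEquivalence (r.obj C)
    have := map_eq_of_comp_trivialFibration_eq (l ⋙ Φ) hΦ (Q.π (r.obj C))
      (u := Q.map (r.map (f ≫ g))) (v := Q.map (r.map f) ≫ Q.map (r.map g))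
      (by rw [Category.assoc, Q.map_π, Q.map_π, ← Category.assoc, Q.map_π, Category.assoc,
        r.map_comp])
    exact this.trans ((l ⋙ Φ).map_comp _ _)

variable {W : MorphismProperty D} {adj : l ⊣ r} (hadj : IsLeftModelApproximation W adj)

include hadj in
lemma counit_mem (A : D) : W (Q.counit adj A) :=
  hadj.adjoint_map _ (Q.isCofibrant _) (Q.weakEquivalence _)

include hadj in
lemma isInvertedBy_functor {Φ : D ⥤ E}
    (hΦ : ∀ ⦃X Y : M⦄ (f : X ⟶ Y), IsCofibrant X → IsCofibrant Y → WeakEquivalence f →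
      IsIso (Φ.map (l.map f))) (hQ : Q.IsFunctorial l r Φ) : W.IsInvertedBy (Q.functor hQ) := by
  intro A B f hf
  have := hadj.right_map f hf
  exact hΦ _ (Q.isCofibrant _) (Q.isCofibrant _) (Q.weakEquivalence_map _)

include hadj in
-- For `X = Q r A` the unit `X ⟶ r l X` is a weak equivalence, since followed by `r` of the counit
-- it is `Q.π`. A lift of it to `Q r l X` is a weak equivalence between cofibrant objects, and `l`
-- of this lift is a section of the counit at `l X`.
lemma isIso_map_counit {Φ : D ⥤ E}
    (hΦ : ∀ ⦃X Y : M⦄ (f : X ⟶ Y), IsCofibrant X → IsCofibrant Y → WeakEquivalence f →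
      IsIso (Φ.map (l.map f))) (A : D) :
    IsIso (Φ.map (Q.counit adj (l.obj (Q.obj (r.obj A))))) := by
  let X := Q.obj (r.obj A)
  have := Q.isCofibrant (r.obj A)
  have := Q.weakEquivalence (r.obj A)
  have := Q.weakEquivalence (r.obj (l.obj X))
  have := Q.fibration (r.obj (l.obj X))
  let η : X ⟶ r.obj (l.obj X) := adj.unit.app X
  have : WeakEquivalence η := by
    have := hadj.right_map _ (Q.counit_mem hadj A)
    exact weakEquivalence_of_postcomp_of_fac (g := r.map (Q.counit adj A)) (fg := Q.π (r.obj A))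
      ((adj.homEquiv_unit _ _ _).symm.trans ((adj.homEquiv _ _).apply_symm_apply _))
  have sq : CommSq (initial.to _) (initial.to X) (Q.π (r.obj (l.obj X))) η := ⟨by simp⟩
  have : WeakEquivalence sq.lift := weakEquivalence_of_postcomp_of_fac sq.fac_right
  have h₁ := hΦ sq.lift inferInstance (Q.isCofibrant _) inferInstance
  have h₂ : l.map sq.lift ≫ Q.counit adj (l.obj X) = 𝟙 _ := by
    rw [counit, ← adj.homEquiv_naturality_left_symm, sq.fac_right]
    exact ((adj.homEquiv X _).symm_apply_eq).2 (adj.homEquiv_id X).symm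
  have h₃ : Φ.map (l.map sq.lift) ≫ Φ.map (Q.counit adj (l.obj X)) = 𝟙 _ := by
    rw [← Φ.map_comp, h₂, Φ.map_id]
  have : IsIso (Φ.map (l.map sq.lift) ≫ Φ.map (Q.counit adj (l.obj X))) := by
    rw [h₃]; infer_instance
  exact IsIso.of_isIso_comp_left (Φ.map (l.map sq.lift)) _

include hadj in
-- A functor `G` that inverts `W` inverts the counits, which gives the factorization `γ`. By
-- naturality along the counit, a factorization is determined by its components at the objects `l Q
-- r A`, and there the transformation to `Φ` is invertible by `isIso_map_counit`.
lemma isLeftDerived {Φ : D ⥤ E}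
    (hΦ : ∀ ⦃X Y : M⦄ (f : X ⟶ Y), IsCofibrant X → IsCofibrant Y → WeakEquivalence f →
      IsIso (Φ.map (l.map f))) (hQ : Q.IsFunctorial l r Φ) :
    IsLeftDerived W (Q.natTrans adj hQ) where
  isInvertedBy := Q.isInvertedBy_functor hadj hΦ hQ
  existsUnique G hG β := by
    have hc (A : D) : IsIso (G.map (Q.counit adj A)) := hG _ (Q.counit_mem hadj A)
    obtain ⟨γ, hγ⟩ : ∃ (γ : ∀ (A : D), G.obj A ⟶ Φ.obj (l.obj (Q.obj (r.obj A)))),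
        ∀ A, G.map (Q.counit adj A) ≫ γ A = β.app _ :=
      ⟨fun A ↦ inv (G.map (Q.counit adj A)) ≫ β.app _, fun A ↦ IsIso.hom_inv_id_assoc _ _⟩
    have hγ' (A B : D) (f : A ⟶ B) :
        G.map f ≫ γ B = γ A ≫ Φ.map (l.map (Q.map (r.map f))) := by
      rw [← cancel_epi (G.map (Q.counit adj A)), ← Category.assoc, ← Category.assoc, hγ,
        ← G.map_comp, ← Q.counit_naturality, G.map_comp, Category.assoc, hγ, β.naturality]
    refine ⟨{ app := γ, naturality := hγ' }, ?_, ?_⟩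
    · ext A
      have := hc A
      rw [← cancel_epi (G.map (Q.counit adj A))]
      change _ ≫ γ A ≫ Φ.map (Q.counit adj A) = _
      rw [← Category.assoc, hγ, β.naturality]
    · intro γ' h
      ext A
      have := hc A
      have h₁ := Q.isIso_map_counit hadj hΦ A
      rw [← cancel_epi (G.map (Q.counit adj A)), γ'.naturality]
      change _ = G.map (Q.counit adj A) ≫ γ A
      rw [hγ']
      congr 1
      refine (cancel_mono (Φ.map (Q.counit adj (l.obj (Q.obj (r.obj A)))))).1 ?_
      refine (congr_app h _).trans ?_
      have := hc (l.obj (Q.obj (r.obj A)))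
      rw [← cancel_epi (G.map (Q.counit adj (l.obj (Q.obj (r.obj A))))), ← Category.assoc, hγ,
        β.naturality]

end CofibrantReplacement

/-! ## The size of the localization -/

/-- Up to isomorphism the source is cofibrant and the target fibrant, and then every morphism of the
localization comes from a morphism of `M`. -/
lemma locallySmall_localization {H : Type uH} [Category.{vH} H] (L : M ⥤ H)
    [L.IsLocalization (weakEquivalences M)] : LocallySmall.{vM} H where
  hom_small X Y := by
    have := Localization.essSurj L (weakEquivalences M)
    obtain ⟨X', _, p, _, _⟩ := CofibrantObject.HoCat.exists_resolution (L.objPreimage X)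
    let hY := MorphismProperty.factorizationData (trivialCofibrations M) (fibrations M)
      (terminal.from (L.objPreimage Y))
    have : IsFibrant hY.Z := by
      rw [isFibrant_iff_of_isTerminal hY.p terminalIsTerminal]
      infer_instance
    have := isIso_map_of_weakEquivalence L hY.i
    have := isIso_map_of_weakEquivalence L p
    have : Small.{vM} (L.obj X' ⟶ L.obj hY.Z) :=
      small_of_surjective (map_surjective_of_isLocalization L X' hY.Z)
    exact small_of_injective ((Iso.homCongr (asIso (L.map p) ≪≫ L.objObjPreimageIso X)
      ((asIso (L.map hY.i)).symm ≪≫ L.objObjPreimageIso Y)).symm.injective)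

/-- The localization of a category with weak equivalences that admits a left model approximation
has morphism sets of the size of those of the approximating model category. -/
lemma nonempty_hasLocalization {l : M ⥤ D} {r : D ⥤ M} {W : MorphismProperty D} {adj : l ⊣ r}
    (hadj : IsLeftModelApproximation W adj) :
    Nonempty (MorphismProperty.HasLocalization.{vM} W) := by
  obtain ⟨Q⟩ := CofibrantReplacement.nonempty M
  let L := W.Q
  let L' := (weakEquivalences M).Q
  have hL ⦃X Y : M⦄ (f : X ⟶ Y) (hX : IsCofibrant X) (hY : IsCofibrant Y)
      (hf : WeakEquivalence f) : IsIso (L.map (l.map f)) :=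
    Localization.inverts L W _ (hadj.left_map f hX hY hf)
  have hQ : Q.IsFunctorial (𝟭 M) (𝟭 M) (l ⋙ L) := Q.isFunctorial (l := 𝟭 M) (𝟭 M) (l ⋙ L) hL
  have hinv : (weakEquivalences M).IsInvertedBy (Q.functor hQ) := by
    intro X Y f hf
    rw [← weakEquivalence_iff] at hf
    exact hL _ (Q.isCofibrant _) (Q.isCofibrant _) (Q.weakEquivalence_map f)
  have hr : W.IsInvertedBy (r ⋙ L') := fun A B f hf ↦ by
    have := hadj.right_map f hf
    exact isIso_map_of_weakEquivalence L' (r.map f)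
  -- `R` is induced by `r` and `Γ` by `X ↦ l Q X`. The counits give an isomorphism from `R ⋙ Γ` to
  -- the identity, so `R` is faithful and morphism sets inject into those of the localization of
  -- `M`.
  let R := Localization.lift (r ⋙ L') hr L
  let Γ := Localization.lift (Q.functor hQ) hinv L'
  let e : L ⋙ R ⋙ Γ ≅ r ⋙ Q.functor hQ :=
    Functor.isoWhiskerRight (Localization.fac (r ⋙ L') hr L) Γ ≪≫
      Functor.isoWhiskerLeft r (Localization.fac (Q.functor hQ) hinv L')
  let c : r ⋙ Q.functor hQ ≅ L := NatIso.ofComponents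
    (fun A ↦ @asIso _ _ _ _ (L.map (Q.counit adj A))
      (Localization.inverts L W _ (Q.counit_mem hadj A)))
    (fun f ↦ (L.map_comp _ _).symm.trans
      ((congrArg L.map (Q.counit_naturality adj f)).trans (L.map_comp _ _)))
  let e' : R ⋙ Γ ≅ 𝟭 W.Localization :=
    Localization.liftNatIso L W (L ⋙ R ⋙ Γ) L (R ⋙ Γ) (𝟭 _) (e ≪≫ c)
  have : R.Faithful := Functor.Faithful.of_comp_iso e'
  have := locallySmall_localization L'
  have : LocallySmall.{vM} W.Localization :=
    ⟨fun X Y ↦ small_of_injective (R.map_injective (X := X) (Y := Y))⟩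
  exact ⟨MorphismProperty.hasLocalizationOfLocallySmall' W L⟩

end Replacement

/-! ## The projective model structure over a direct category -/

section Direct

/-- A degree function on the objects of a category that is direct up to equivalence: morphisms
do not lower the degree, and a morphism between objects of the same degree is an isomorphism and
is the only one. -/
structure DirectDegree (D : Type uD) [Category.{vD} D] where
  degree : D → ℕ
  degree_le {x y : D} (f : x ⟶ y) : degree x ≤ degree y
  hom_ext {x y : D} (f g : x ⟶ y) : degree x = degree y → f = g
  isIso {x y : D} (f : x ⟶ y) : degree x = degree y → IsIso f

variable {D : Type w} [Category.{0} D] {M : Type uM} [Category.{vM} M]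

/-! ### Diagrams freely generated by a family of objects -/

section FreeDiagram

variable [HasColimitsOfSize.{w, w} M] {T : Type w} (o : T → D)

variable {o} in
/-- The inclusion of a generator in the coproduct of the generators indexed by `Σ t, o t ⟶ σ`. -/
def sigmaι (X : T → M) {t : T} {σ : D} (g : o t ⟶ σ) : X t ⟶ ∐ fun p : Σ t, o t ⟶ σ ↦ X p.1 :=
  Sigma.ι (fun p : Σ t, o t ⟶ σ ↦ X p.1) ⟨t, g⟩

variable {o} in
@[simp]
lemma sigmaι_desc (X : T → M) {σ : D} {Y : M} (f : ∀ p : Σ t, o t ⟶ σ, X p.1 ⟶ Y) {t : T}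
    (g : o t ⟶ σ) : sigmaι X g ≫ Limits.Sigma.desc f = f ⟨t, g⟩ :=
  colimit.ι_desc _ _

variable {o} in
@[simp]
lemma sigmaι_desc_assoc (X : T → M) {σ : D} {Y : M} (f : ∀ p : Σ t, o t ⟶ σ, X p.1 ⟶ Y) {t : T}
    (g : o t ⟶ σ) {Z : M} (h : Y ⟶ Z) :
    sigmaι X g ≫ Limits.Sigma.desc f ≫ h = f ⟨t, g⟩ ≫ h := by
  rw [← Category.assoc, sigmaι_desc]

variable {o} in
lemma sigma_hom_ext {X : T → M} {σ : D} {Y : M} {u v : (∐ fun p : Σ t, o t ⟶ σ ↦ X p.1) ⟶ Y}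
    (h : ∀ (t : T) (g : o t ⟶ σ), sigmaι X g ≫ u = sigmaι X g ≫ v) : u = v :=
  Sigma.hom_ext _ _ fun p ↦ h p.1 p.2

/-- The diagram freely generated by a family of objects in the places `o t`. -/
def freeDiagram (X : T → M) : D ⥤ M where
  obj σ := ∐ fun p : Σ t, o t ⟶ σ ↦ X p.1
  map g := Sigma.desc fun p ↦ sigmaι X (p.2 ≫ g)
  map_id σ := sigma_hom_ext fun t g ↦ by simp
  map_comp f f' := sigma_hom_ext fun t g ↦ by simp

variable {o}

/-- The inclusion of a generator. -/
def freeDiagramι (X : T → M) {t : T} {σ : D} (g : o t ⟶ σ) : X t ⟶ (freeDiagram o X).obj σ :=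
  sigmaι X g

@[simp]
lemma freeDiagramι_map (X : T → M) {t : T} {σ τ : D} (g : o t ⟶ σ) (f : σ ⟶ τ) :
    freeDiagramι X g ≫ (freeDiagram o X).map f = freeDiagramι X (g ≫ f) :=
  sigmaι_desc _ _ _

@[simp]
lemma freeDiagramι_map_assoc (X : T → M) {t : T} {σ τ : D} (g : o t ⟶ σ) (f : σ ⟶ τ) {Z : M}
    (h : (freeDiagram o X).obj τ ⟶ Z) :
    freeDiagramι X g ≫ (freeDiagram o X).map f ≫ h = freeDiagramι X (g ≫ f) ≫ h := by
  rw [← Category.assoc, freeDiagramι_map]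

/-- The morphism from a free diagram given by morphisms from its generators. -/
def freeDiagramDesc {X : T → M} {G : D ⥤ M} (f : ∀ t, X t ⟶ G.obj (o t)) :
    freeDiagram o X ⟶ G where
  app σ := Sigma.desc fun p ↦ f p.1 ≫ G.map p.2
  naturality σ τ g' := sigma_hom_ext fun t g ↦ by
    refine (freeDiagramι_map_assoc _ _ _ _).trans ?_
    refine (sigmaι_desc _ _ _).trans ?_
    exact (by simp : f t ≫ G.map (g ≫ g') = (f t ≫ G.map g) ≫ G.map g').trans
      (sigmaι_desc_assoc X (fun p ↦ f p.1 ≫ G.map p.2) g _).symm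

@[simp]
lemma freeDiagramι_desc {X : T → M} {G : D ⥤ M} (f : ∀ t, X t ⟶ G.obj (o t)) {t : T} {σ : D}
    (g : o t ⟶ σ) : freeDiagramι X g ≫ (freeDiagramDesc f).app σ = f t ≫ G.map g :=
  sigmaι_desc _ _ _

@[simp]
lemma freeDiagramι_desc_assoc {X : T → M} {G : D ⥤ M} (f : ∀ t, X t ⟶ G.obj (o t)) {t : T}
    {σ : D} (g : o t ⟶ σ) {Z : M} (h : G.obj σ ⟶ Z) :
    freeDiagramι X g ≫ (freeDiagramDesc f).app σ ≫ h = f t ≫ G.map g ≫ h := by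
  rw [← Category.assoc, freeDiagramι_desc, Category.assoc]

lemma freeDiagram_hom_ext {X : T → M} {G : D ⥤ M} {u v : freeDiagram o X ⟶ G}
    (h : ∀ t, freeDiagramι X (𝟙 (o t)) ≫ u.app (o t) = freeDiagramι X (𝟙 (o t)) ≫ v.app (o t)) :
    u = v := by
  ext σ
  refine sigma_hom_ext fun t g ↦ ?_
  change freeDiagramι X g ≫ _ = freeDiagramι X g ≫ _
  have h₁ (u : freeDiagram o X ⟶ G) :
      freeDiagramι X g ≫ u.app σ = (freeDiagramι X (𝟙 (o t)) ≫ u.app (o t)) ≫ G.map g := by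
    rw [Category.assoc, ← u.naturality, freeDiagramι_map_assoc, Category.id_comp]
  rw [h₁, h₁, h]

variable (o) in
/-- The morphism of free diagrams given by morphisms of the generators. -/
def freeDiagramMap {X Y : T → M} (f : ∀ t, X t ⟶ Y t) : freeDiagram o X ⟶ freeDiagram o Y :=
  freeDiagramDesc fun t ↦ f t ≫ freeDiagramι Y (𝟙 _)

@[simp]
lemma freeDiagramι_freeDiagramMap {X Y : T → M} (f : ∀ t, X t ⟶ Y t) {t : T} {σ : D}
    (g : o t ⟶ σ) : freeDiagramι X g ≫ (freeDiagramMap o f).app σ = f t ≫ freeDiagramι Y g := by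
  simp [freeDiagramMap]

@[simp]
lemma freeDiagramι_freeDiagramMap_assoc {X Y : T → M} (f : ∀ t, X t ⟶ Y t) {t : T} {σ : D}
    (g : o t ⟶ σ) {Z : M} (h : (freeDiagram o Y).obj σ ⟶ Z) :
    freeDiagramι X g ≫ (freeDiagramMap o f).app σ ≫ h = f t ≫ freeDiagramι Y g ≫ h := by
  rw [← Category.assoc, freeDiagramι_freeDiagramMap, Category.assoc]

lemma hasLiftingProperty_freeDiagramMap {X Y : T → M} (f : ∀ t, X t ⟶ Y t) {A B : D ⥤ M}
    (p : A ⟶ B) (h : ∀ t, HasLiftingProperty (f t) (p.app (o t))) :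
    HasLiftingProperty (freeDiagramMap o f) p where
  sq_hasLift {u v} sq := by
    have sq' (t : T) : CommSq (freeDiagramι X (𝟙 _) ≫ u.app (o t)) (f t) (p.app (o t))
        (freeDiagramι Y (𝟙 _) ≫ v.app (o t)) := ⟨by
      have := congr_app sq.w (o t)
      dsimp at this
      simp [this]⟩
    exact ⟨⟨{ l := freeDiagramDesc fun t ↦ (sq' t).lift
              fac_left := freeDiagram_hom_ext fun t ↦ by simp
              fac_right := freeDiagram_hom_ext fun t ↦ by simp }⟩⟩

end FreeDiagram

namespace DirectDegree

variable (δ : DirectDegree D)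

/-- The isomorphism classes of objects of degree `n`. -/
abbrev Classes (n : ℕ) : Type w :=
  { t : _root_.Quotient (isIsomorphicSetoid D) // δ.degree t.out = n }

/-- The chosen representatives of isomorphism classes. -/
abbrev rep {n : ℕ} (t : δ.Classes n) : D := t.1.out

lemma isEmpty_hom {n : ℕ} {σ : D} (h : δ.degree σ < n) :
    IsEmpty (Σ t : δ.Classes n, δ.rep t ⟶ σ) :=
  ⟨fun p ↦ absurd ((δ.degree_le p.2).trans_lt h) (by simp [p.1.2])⟩

/-- With `isEmpty_hom`, this computes free diagrams generated in degree `n`: initial below degree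
`n`, and a single copy of one generator in degree `n`. Choosing one representative per isomorphism
class prevents repetitions. -/
lemma nonempty_unique_hom {n : ℕ} {σ : D} (h : δ.degree σ = n) :
    Nonempty (Unique (Σ t : δ.Classes n, δ.rep t ⟶ σ)) := by
  obtain ⟨e⟩ : IsIsomorphic (Quotient.mk (isIsomorphicSetoid D) σ : _root_.Quotient (isIsomorphicSetoid D)).out σ :=
    Quotient.mk_out (s := isIsomorphicSetoid D) σ
  have he : δ.degree (Quotient.mk (isIsomorphicSetoid D) σ : _root_.Quotient (isIsomorphicSetoid D)).out = n := by
    have := δ.degree_le e.hom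
    have := δ.degree_le e.inv
    omega
  refine ⟨⟨⟨⟨⟨_, he⟩, e.hom⟩⟩, ?_⟩⟩
  rintro ⟨⟨t, ht⟩, f⟩
  have hf := δ.isIso f (ht.trans h.symm)
  obtain rfl : t = Quotient.mk (isIsomorphicSetoid D) σ := by
    rw [← Quotient.out_eq t]
    exact Quotient.sound ⟨asIso f⟩
  congr 1
  exact δ.hom_ext _ _ (he.trans h.symm)

/-! ### Factoring a morphism of diagrams in a single degree -/

section Step

variable [HasColimitsOfSize.{w, w} M] [HasPushouts M] {L R : MorphismProperty M}
  [L.HasFactorization R] (n : ℕ) {Z G : D ⥤ M} (φ : Z ⟶ G)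

/-- The chosen factorizations of `φ` in the degree `n`. -/
def fac (t : δ.Classes n) : L.MapFactorizationData R (φ.app (δ.rep t)) :=
  L.factorizationData R _

variable (L R) in
/-- The diagram obtained from `Z` by factoring `φ : Z ⟶ G` in the degree `n`. -/
def step : D ⥤ M :=
  pushout (freeDiagramDesc (o := δ.rep) fun t : δ.Classes n ↦ 𝟙 (Z.obj (δ.rep t)))
    (freeDiagramMap δ.rep fun t ↦ (δ.fac (L := L) (R := R) n φ t).i)

variable (L R) in
/-- The inclusion of `Z` in the diagram obtained by factoring `φ` in the degree `n`. -/
def toStep : Z ⟶ δ.step L R n φ := pushout.inl _ _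

variable (L R) in
/-- The middle terms of the factorizations generate the new part of the diagram obtained by
factoring `φ` in the degree `n`. -/
def freeToStep : freeDiagram δ.rep (fun t ↦ (δ.fac (L := L) (R := R) n φ t).Z) ⟶
    δ.step L R n φ := pushout.inr _ _

variable (L R) in
lemma isPushout_step : IsPushout
    (freeDiagramDesc (o := δ.rep) fun t : δ.Classes n ↦ 𝟙 (Z.obj (δ.rep t)))
    (freeDiagramMap δ.rep fun t ↦ (δ.fac (L := L) (R := R) n φ t).i)
    (δ.toStep L R n φ) (δ.freeToStep L R n φ) :=
  IsPushout.of_hasPushout _ _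

variable (L R) in
lemma isPushout_step_app (σ : D) : IsPushout
    ((freeDiagramDesc (o := δ.rep) fun t : δ.Classes n ↦ 𝟙 (Z.obj (δ.rep t))).app σ)
    ((freeDiagramMap δ.rep fun t ↦ (δ.fac (L := L) (R := R) n φ t).i).app σ)
    ((δ.toStep L R n φ).app σ) ((δ.freeToStep L R n φ).app σ) :=
  (δ.isPushout_step L R n φ).map ((evaluation D M).obj σ)

variable (L R) in
/-- The morphism to `G` from the diagram obtained by factoring `φ : Z ⟶ G` in the degree `n`. -/
def fromStep : δ.step L R n φ ⟶ G :=
  pushout.desc φ (freeDiagramDesc fun t ↦ (δ.fac (L := L) (R := R) n φ t).p)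
    (freeDiagram_hom_ext fun t ↦ by simp)

@[simp]
lemma toStep_fromStep : δ.toStep L R n φ ≫ δ.fromStep L R n φ = φ := pushout.inl_desc _ _ _

@[simp]
lemma freeToStep_fromStep : δ.freeToStep L R n φ ≫ δ.fromStep L R n φ =
    freeDiagramDesc fun t ↦ (δ.fac (L := L) (R := R) n φ t).p := pushout.inr_desc _ _ _

lemma hasLiftingProperty_toStep {A B : D ⥤ M} (p : A ⟶ B) (hp : L.rlp.functorCategory D p) :
    HasLiftingProperty (δ.toStep L R n φ) p := by
  have := hasLiftingProperty_freeDiagramMap (o := δ.rep)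
    (fun t ↦ (δ.fac (L := L) (R := R) n φ t).i) p (fun t ↦ hp _ _ (δ.fac n φ t).hi)
  exact (δ.isPushout_step L R n φ).hasLiftingProperty p

/-- Below degree `n` both free diagrams are initial, so the pushout adds nothing. -/
lemma isIso_toStep_app {σ : D} (h : δ.degree σ < n) : IsIso ((δ.toStep L R n φ).app σ) := by
  have := δ.isEmpty_hom h
  refine (MorphismProperty.isomorphisms M).of_isPushout (δ.isPushout_step_app L R n φ σ) ?_
  have h₂ (X : δ.Classes n → M) : IsInitial ((freeDiagram δ.rep X).obj σ) :=
    IsInitial.ofUniqueHom (fun Y ↦ Sigma.desc fun p ↦ this.elim p)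
      (fun Y f ↦ Sigma.hom_ext _ _ fun p ↦ this.elim p)
  exact isIso_of_isInitial (h₂ _) (h₂ _) _

omit [HasPushouts M] in
lemma isIso_freeDiagramι {σ : D} [u : Unique (Σ t : δ.Classes n, δ.rep t ⟶ σ)]
    (X : δ.Classes n → M) {t : δ.Classes n} (g : δ.rep t ⟶ σ) : IsIso (freeDiagramι X g) := by
  have h (p : Σ t : δ.Classes n, δ.rep t ⟶ σ) : X p.1 = X t := by
    rw [Subsingleton.elim p ⟨t, g⟩]
  refine ⟨Sigma.desc fun p ↦ eqToHom (h p), ?_, sigma_hom_ext fun t' g' ↦ ?_⟩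
  · exact (sigmaι_desc _ _ _).trans (by simp)
  · obtain ⟨rfl, h'⟩ := Sigma.mk.inj
      (Subsingleton.elim (α := Σ t : δ.Classes n, δ.rep t ⟶ σ) ⟨t, g⟩ ⟨t', g'⟩)
    obtain rfl := eq_of_heq h'
    refine (sigmaι_desc_assoc _ _ _ _).trans ?_
    rw [eqToHom_refl, Category.id_comp]
    exact (Category.comp_id _).symm

/-- In degree `n` the map from the free diagram to `Z` is invertible, hence so is its pushout
`freeToStep`. This identifies the new map to `G` with the chosen second factor. -/
lemma fromStep_app_mem [R.RespectsIso] {σ : D} (h : δ.degree σ = n) :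
    R ((δ.fromStep L R n φ).app σ) := by
  obtain ⟨_⟩ := δ.nonempty_unique_hom h
  obtain ⟨t, g⟩ : Σ t : δ.Classes n, δ.rep t ⟶ σ := default
  have hg : IsIso g := δ.isIso g (t.2.trans h.symm)
  have h₁ := δ.isIso_freeDiagramι n (fun t ↦ Z.obj (δ.rep t)) g
  have h₂ : IsIso ((freeDiagramDesc (o := δ.rep)
      fun t : δ.Classes n ↦ 𝟙 (Z.obj (δ.rep t))).app σ) := by
    refine IsIso.of_isIso_fac_left (f := freeDiagramι (fun t ↦ Z.obj (δ.rep t)) g)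
      (h := Z.map g) ?_
    simp
  have h₃ : IsIso ((δ.freeToStep L R n φ).app σ) :=
    (MorphismProperty.isomorphisms M).of_isPushout (δ.isPushout_step_app L R n φ σ).flip h₂
  have h₄ := δ.isIso_freeDiagramι n (fun t ↦ (δ.fac (L := L) (R := R) n φ t).Z) g
  have h₅ : freeDiagramι (fun t ↦ (δ.fac (L := L) (R := R) n φ t).Z) g ≫
      (δ.freeToStep L R n φ).app σ ≫ (δ.fromStep L R n φ).app σ =
        (δ.fac (L := L) (R := R) n φ t).p ≫ G.map g := by
    rw [← NatTrans.comp_app, freeToStep_fromStep, freeDiagramι_desc]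
  have h₆ : R ((δ.fac (L := L) (R := R) n φ t).p ≫ G.map g) :=
    (R.cancel_right_of_respectsIso _ _).2 (δ.fac n φ t).hp
  rwa [← h₅, R.cancel_left_of_respectsIso, R.cancel_left_of_respectsIso] at h₆

lemma fromStep_app_mem_of_lt [R.RespectsIso] {σ : D} (h : δ.degree σ < n) (hφ : R (φ.app σ)) :
    R ((δ.fromStep L R n φ).app σ) := by
  have := δ.isIso_toStep_app (L := L) (R := R) n φ h
  rwa [← R.cancel_left_of_respectsIso ((δ.toStep L R n φ).app σ), ← NatTrans.comp_app,
    toStep_fromStep]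

end Step

/-! ### Factorization in all degrees -/

section Factorization

variable [HasColimitsOfSize.{w, w} M] [HasPushouts M] (L R : MorphismProperty M)
  [L.HasFactorization R] [R.RespectsIso] {Z G : D ⥤ M} (φ : Z ⟶ G)

/-- The diagrams obtained from `φ : Z ⟶ G` by successively factoring in the degrees
`0, …, n - 1`. -/
def tower (n : ℕ) : Σ Z : D ⥤ M, Z ⟶ G :=
  n.rec ⟨Z, φ⟩ fun n t ↦ ⟨δ.step L R n t.2, δ.fromStep L R n t.2⟩

/-- The transition morphisms of the tower. -/
def towerMap (n : ℕ) : (δ.tower L R φ n).1 ⟶ (δ.tower L R φ (n + 1)).1 :=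
  δ.toStep L R n (δ.tower L R φ n).2

omit [R.RespectsIso] in
lemma towerMap_comp (n : ℕ) :
    δ.towerMap L R φ n ≫ (δ.tower L R φ (n + 1)).2 = (δ.tower L R φ n).2 :=
  δ.toStep_fromStep _ _

lemma tower_app_mem {n : ℕ} {σ : D} (h : δ.degree σ < n) : R ((δ.tower L R φ n).2.app σ) := by
  induction n with
  | zero => omega
  | succ n hn =>
    obtain h | h := (Nat.le_of_lt_succ h).lt_or_eq
    · exact δ.fromStep_app_mem_of_lt n _ h (hn h)
    · exact δ.fromStep_app_mem n _ h

/-- A morphism of diagrams factors as a morphism with the left lifting property with respect to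
objectwise right liftings of `L`, followed by a morphism that belongs objectwise to `R`. -/
lemma exists_factorization (δ : DirectDegree D) {Z G : D ⥤ M} (φ : Z ⟶ G) : ∃ (E : D ⥤ M) (i : Z ⟶ E) (p : E ⟶ G),
    (L.rlp.functorCategory D).llp i ∧ R.functorCategory D p ∧ i ≫ p = φ := by
  have : HasColimitsOfShape ℕ M :=
    have := hasColimitsOfSizeOfUnivLE.{w, w, 0, 0} M
    inferInstance
  let F : ℕ ⥤ D ⥤ M := Functor.ofSequence (δ.towerMap L R φ)
  let p : F ⟶ (Functor.const ℕ).obj G := NatTrans.ofSequence (fun n ↦ (δ.tower L R φ n).2) (by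
    intro n
    rw [Functor.ofSequence_map_homOfLE_succ]
    exact (δ.towerMap_comp L R φ n).trans (Category.comp_id _).symm)
  have hF (n : ℕ) : F.map (homOfLE (Nat.le_add_right n 1)) = δ.towerMap L R φ n :=
    Functor.ofSequence_map_homOfLE_succ _ _
  refine ⟨colimit F, colimit.ι F 0, colimit.desc F ⟨G, p⟩, ?_, fun σ ↦ ?_, colimit.ι_desc _ _⟩
  · have h : (L.rlp.functorCategory D).llp.TransfiniteCompositionOfShape ℕ (colimit.ι F 0) :=
      { F := F
        isoBot := Iso.refl _
        incl := (colimit.cocone F).ι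
        isColimit := colimit.isColimit F
        fac := Category.id_comp _
        map_mem n hn := by
          intro A B p hp
          have := hF n
          change F.map (homOfLE (Order.le_succ n)) = _ at this
          rw [this]
          exact δ.hasLiftingProperty_toStep _ _ _ hp }
    exact MorphismProperty.transfiniteCompositionsOfShape_le _ _ _ h.mem
  · let n := δ.degree σ + 1
    have h₁ : (F ⋙ (evaluation D M).obj σ).IsEventuallyConstantFrom n := by
      have h (k : ℕ) (hk : n ≤ k) : IsIso ((F.map (homOfLE hk)).app σ) := by
        induction k, hk using Nat.le_induction with
        | base =>
          rw [Subsingleton.elim (homOfLE _) (𝟙 n), F.map_id]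
          infer_instance
        | succ k hk hk' =>
          have h' : IsIso ((F.map (homOfLE (Nat.le_add_right k 1))).app σ) := by
            rw [hF]
            exact δ.isIso_toStep_app _ _ hk
          rw [Subsingleton.elim (homOfLE _) (homOfLE hk ≫ homOfLE (Nat.le_add_right k 1)),
            F.map_comp, NatTrans.comp_app]
          infer_instance
      exact fun k f ↦ h k (leOfHom f)
    have h₂ := h₁.isIso_ι_of_isColimit
      (isColimitOfPreserves ((evaluation D M).obj σ) (colimit.isColimit F))
    have h₃ : IsIso ((colimit.ι F n).app σ) := h₂
    have h₄ : (colimit.ι F n).app σ ≫ (colimit.desc F ⟨G, p⟩).app σ =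
        (δ.tower L R φ n).2.app σ := by
      rw [← NatTrans.comp_app, colimit.ι_desc]
      rfl
    rw [← R.cancel_left_of_respectsIso ((colimit.ι F n).app σ), h₄]
    exact δ.tower_app_mem L R φ (Nat.lt_succ_self _)

end Factorization

end DirectDegree

lemma hasTwoOutOfThreeProperty_functorCategory {C : Type uC} [Category.{vC} C]
    (W : MorphismProperty C) [W.HasTwoOutOfThreeProperty] (D : Type uD) [Category.{vD} D] :
    (W.functorCategory D).HasTwoOutOfThreeProperty where
  comp_mem _ _ hf hg _ := W.comp_mem _ _ (hf _) (hg _)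
  of_postcomp _ _ hg hfg _ := W.of_postcomp _ _ (hg _) (hfg _)
  of_precomp _ _ hf hfg _ := W.of_precomp _ _ (hf _) (hfg _)

/-! ### Lifting properties and axioms of the projective structure -/

section Projective

lemma piLift_mem (R : MorphismProperty M) {J : Type*} [R.IsStableUnderProductsOfShape J]
    {X Y : J → M} [HasProduct X] [HasProduct Y] (f : ∀ j, X j ⟶ Y j) (hf : ∀ j, R (f j)) :
    R (Pi.lift fun j ↦ Pi.π X j ≫ f j) := by
  have h := MorphismProperty.limMap (W := R) (X := Discrete.functor X) (Y := Discrete.functor Y)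
    (Discrete.natTrans fun j ↦ f j.as) fun j ↦ hf j.as
  convert h using 1
  refine Pi.hom_ext _ _ fun j ↦ (limit.lift_π _ _).trans ?_
  exact (limMap_π (F := Discrete.functor X) (G := Discrete.functor Y)
    (Discrete.natTrans fun j ↦ f j.as) ⟨j⟩).symm

/-- Evaluating a morphism with the left lifting property with respect to objectwise
members of `R` gives a morphism with the left lifting property with respect to `R`, if `R` is
stable under products. -/
lemma app_mem_llp [HasLimitsOfSize.{w, w} M] (R : MorphismProperty M)
    [∀ J : Type, R.IsStableUnderProductsOfShape J] {F G : D ⥤ M} {i : F ⟶ G}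
    (hi : (R.functorCategory D).llp i) (σ : D) : R.llp (i.app σ) := by
  have (J : Type) : HasProductsOfShape J M :=
    have := hasLimitsOfSizeOfUnivLE.{w, w, 0, 0} M
    inferInstance
  intro X Y p hp
  exact ((evaluationAdjunctionLeft M σ).hasLiftingProperty_iff _ _).2
    (hi _ fun τ ↦ piLift_mem R (fun _ ↦ p) (fun _ ↦ hp))

variable [ModelCategory M]

/-- The classes of morphisms of the projective model structure on a category of diagrams. -/
local instance projectiveFibrations : CategoryWithFibrations (D ⥤ M) :=
  ⟨(fibrations M).functorCategory D⟩

local instance projectiveWeakEquivalences : CategoryWithWeakEquivalences (D ⥤ M) :=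
  ⟨(weakEquivalences M).functorCategory D⟩

local instance projectiveCofibrations : CategoryWithCofibrations (D ⥤ M) :=
  ⟨((trivialFibrations M).functorCategory D).llp⟩

lemma projective_trivialFibrations :
    trivialFibrations (D ⥤ M) = (trivialFibrations M).functorCategory D := by
  ext F G p
  exact ⟨fun h σ ↦ ⟨h.1 σ, h.2 σ⟩, fun h ↦ ⟨fun σ ↦ (h σ).1, fun σ ↦ (h σ).2⟩⟩

instance (J : Type*) : (fibrations M).IsStableUnderProductsOfShape J := by
  rw [← trivialCofibrations_rlp]
  infer_instance

instance (J : Type*) : (trivialFibrations M).IsStableUnderProductsOfShape J := by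
  rw [← cofibrations_rlp]
  infer_instance

variable [HasColimitsOfSize.{w, w} M] [HasLimitsOfSize.{w, w} M]

/-- Retract argument: factor `j` as `i ≫ p` with `i` lifting against objectwise fibrations. As `i`
is an objectwise weak equivalence, `p` is an objectwise trivial fibration, so `j` lifts against `p`
and is a retract of `i`. -/
lemma projective_trivialCofibrations (δ : DirectDegree D) :
    trivialCofibrations (D ⥤ M) = ((fibrations M).functorCategory D).llp := by
  apply le_antisymm
  · intro F G j hj
    obtain ⟨E, i, p, hi, hp, rfl⟩ :=
      δ.exists_factorization (trivialCofibrations M) (fibrations M) j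
    rw [trivialCofibrations_rlp] at hi
    have hi' (σ : D) : WeakEquivalence (i.app σ) := by
      have h := app_mem_llp _ hi σ
      rw [fibrations_llp] at h
      exact ⟨h.2⟩
    have hp' : (trivialFibrations M).functorCategory D p := fun σ ↦ by
      refine ⟨hp σ, ?_⟩
      have h : weakEquivalences M (i.app σ ≫ p.app σ) := hj.2 σ
      rw [← weakEquivalence_iff] at h ⊢
      have := hi' σ
      exact weakEquivalence_of_precomp (i.app σ) (p.app σ)
    have := hj.1 _ hp'
    exact MorphismProperty.of_retract
      (RetractArrow.ofLeftLiftingProperty (f := i ≫ p) (i := i) (p := p) rfl) hi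
  · intro F G j hj
    refine ⟨fun X Y p hp ↦ hj p fun σ ↦ (hp σ).1, fun σ ↦ ?_⟩
    have h := app_mem_llp _ hj σ
    rw [fibrations_llp] at h
    exact h.2

/-- The projective model structure on diagrams indexed by a direct category. -/
@[reducible]
def projectiveModelCategory (δ : DirectDegree D) : ModelCategory (D ⥤ M) := by
  have : (weakEquivalences (D ⥤ M)).HasTwoOutOfThreeProperty :=
    hasTwoOutOfThreeProperty_functorCategory _ D
  have : (fibrations (D ⥤ M)).IsStableUnderRetracts :=
    inferInstanceAs ((fibrations M).functorCategory D).IsStableUnderRetracts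
  have : (cofibrations (D ⥤ M)).IsStableUnderRetracts :=
    inferInstanceAs ((trivialFibrations M).functorCategory D).llp.IsStableUnderRetracts
  have : (trivialFibrations (D ⥤ M)).IsStableUnderRetracts := by
    rw [projective_trivialFibrations]
    infer_instance
  have : (trivialCofibrations (D ⥤ M)).IsStableUnderRetracts := by
    rw [projective_trivialCofibrations δ]
    infer_instance
  have : (cofibrations (D ⥤ M)).HasFactorization (trivialFibrations (D ⥤ M)) := ⟨fun φ ↦ by
    obtain ⟨E, i, p, hi, hp, h⟩ :=
      δ.exists_factorization (cofibrations M) (trivialFibrations M) φ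
    rw [cofibrations_rlp] at hi
    rw [← projective_trivialFibrations] at hp
    exact ⟨⟨E, i, p, h, hi, hp⟩⟩⟩
  have : (trivialCofibrations (D ⥤ M)).HasFactorization (fibrations (D ⥤ M)) := ⟨fun φ ↦ by
    obtain ⟨E, i, p, hi, hp, h⟩ :=
      δ.exists_factorization (trivialCofibrations M) (fibrations M) φ
    rw [trivialCofibrations_rlp, ← projective_trivialCofibrations δ] at hi
    exact ⟨⟨E, i, p, h, hi, hp⟩⟩⟩
  have : (cofibrations (D ⥤ M)).IsWeakFactorizationSystem (trivialFibrations (D ⥤ M)) :=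
    .mk' _ _ fun i p hi hp ↦ hi p (by rwa [projective_trivialFibrations] at hp)
  have : (trivialCofibrations (D ⥤ M)).IsWeakFactorizationSystem (fibrations (D ⥤ M)) :=
    .mk' _ _ fun i p hi hp ↦ by
      rw [projective_trivialCofibrations δ] at hi
      exact hi p hp
  exact ModelCategory.mk' (D ⥤ M)

end Projective

end Direct

/-! ## Diagrams that invert degeneracies -/

section Degeneracy

/-- Degeneracies in a category `K` which behaves like a simplex category: the degeneracies are
split epimorphisms, and parallel morphisms between objects of the same dimension become equal
degeneracies after composition with a degeneracy. -/
structure DegeneracyData (K : Type uD) [Category.{vD} K] where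
  degeneracies : MorphismProperty K
  dim : K → ℕ
  dim_le {σ τ : K} (f : σ ⟶ τ) : dim σ ≤ dim τ
  exists_degeneracy {σ τ : K} (f g : σ ⟶ τ) (h : dim σ = dim τ) :
    ∃ (ρ : K) (e : τ ⟶ ρ), degeneracies e ∧ degeneracies (f ≫ e) ∧ f ≫ e = g ≫ e
  exists_section {σ τ : K} (e : σ ⟶ τ) (he : degeneracies e) : ∃ s : τ ⟶ σ, s ≫ e = 𝟙 τ

namespace DegeneracyData

variable {K : Type w} [Category.{0} K] (δ : DegeneracyData K)

/-- Morphisms are related if they become equal after composition with a degeneracy. -/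
def rel : HomRel K := fun _ τ f g ↦ ∃ (ρ : K) (e : τ ⟶ ρ), δ.degeneracies e ∧ f ≫ e = g ≫ e

/-- The quotient of `K` in which degeneracies become isomorphisms. -/
abbrev Quot := CategoryTheory.Quotient δ.rel

/-- The projection to the quotient. -/
abbrev toQuot : K ⥤ δ.Quot := Quotient.functor δ.rel

/-- A section `s` of `e` becomes a two-sided inverse: `e ≫ s` and the identity agree after
composition with `e`. -/
lemma isIso_toQuot_map {σ τ : K} (e : σ ⟶ τ) (he : δ.degeneracies e) :
    IsIso (δ.toQuot.map e) := by
  obtain ⟨s, hs⟩ := δ.exists_section e he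
  refine ⟨δ.toQuot.map s, ?_, ?_⟩
  · rw [← Functor.map_comp, ← CategoryTheory.Functor.map_id]
    exact CategoryTheory.Quotient.sound _ ⟨τ, e, he, by rw [Category.assoc, hs]; simp⟩
  · rw [← Functor.map_comp, hs, CategoryTheory.Functor.map_id]

/-- The quotient is a direct category. -/
def directDegree : DirectDegree δ.Quot where
  degree x := δ.dim x.as
  degree_le {x y} f := by
    obtain ⟨f, rfl⟩ := δ.toQuot.map_surjective (X := x.as) (Y := y.as) f
    exact δ.dim_le f
  hom_ext {x y} f g h := by
    obtain ⟨f, rfl⟩ := δ.toQuot.map_surjective (X := x.as) (Y := y.as) f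
    obtain ⟨g, rfl⟩ := δ.toQuot.map_surjective (X := x.as) (Y := y.as) g
    obtain ⟨ρ, e, he, -, h⟩ := δ.exists_degeneracy f g h
    exact CategoryTheory.Quotient.sound _ ⟨ρ, e, he, h⟩
  isIso {x y} f h := by
    obtain ⟨f, rfl⟩ := δ.toQuot.map_surjective (X := x.as) (Y := y.as) f
    obtain ⟨ρ, e, he, he', -⟩ := δ.exists_degeneracy f f h
    have := δ.isIso_toQuot_map _ he
    have := δ.isIso_toQuot_map _ he'
    exact IsIso.of_isIso_fac_right (δ.toQuot.map_comp f e).symm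

variable {M : Type uM} [Category.{vM} M] {P : ObjectProperty (K ⥤ M)}
  (hP : ∀ F, P F ↔ δ.degeneracies.IsInvertedBy F)

/-- A functor that inverts degeneracies descends to the quotient. -/
def descend (F : K ⥤ M) (hF : δ.degeneracies.IsInvertedBy F) : δ.Quot ⥤ M :=
  CategoryTheory.Quotient.lift _ F fun _ _ f g ⟨_, e, he, h⟩ ↦ by
    have := hF e he
    rw [← cancel_mono (F.map e), ← F.map_comp, ← F.map_comp, h]

include hP in
lemma toQuot_comp_mem (G : δ.Quot ⥤ M) : P (δ.toQuot ⋙ G) :=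
  (hP _).2 fun _ _ e he ↦ by
    have := δ.isIso_toQuot_map e he
    exact inferInstanceAs (IsIso (G.map (δ.toQuot.map e)))

/-- Diagrams on the quotient are diagrams that invert degeneracies. -/
def ofQuot : (δ.Quot ⥤ M) ⥤ P.FullSubcategory :=
  P.lift ((Functor.whiskeringLeft _ _ M).obj δ.toQuot) (δ.toQuot_comp_mem hP)

instance : (δ.ofQuot hP).Full :=
  inferInstanceAs (P.lift _ _).Full

instance : (δ.ofQuot hP).Faithful :=
  inferInstanceAs (P.lift _ _).Faithful

instance : (δ.ofQuot hP).EssSurj where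
  mem_essImage F := ⟨δ.descend F.obj ((hP _).1 F.property),
    ⟨P.isoMk (Iso.refl F.obj)⟩⟩

instance : (δ.ofQuot hP).IsEquivalence where

/-- Diagrams that invert degeneracies are diagrams on the quotient. -/
def equivalence : P.FullSubcategory ≌ (δ.Quot ⥤ M) := (δ.ofQuot hP).asEquivalence.symm

end DegeneracyData

/-- The morphisms in a full subcategory of diagrams that belong objectwise to `R`. -/
def objectwise {K : Type uD} [Category.{vD} K] {M : Type uM} [Category.{vM} M]
    (P : ObjectProperty (K ⥤ M)) (R : MorphismProperty M) : MorphismProperty P.FullSubcategory :=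
  fun _ _ Ψ ↦ ∀ σ : K, R (Ψ.hom.app σ)

section

variable {K : Type uD} [Category.{vD} K] {M : Type uM} [Category.{vM} M]
    (P : ObjectProperty (K ⥤ M))

instance (R : MorphismProperty M) [R.RespectsIso] : (objectwise P R).RespectsIso :=
  .mk _ (fun e _ hf σ ↦ (R.cancel_left_of_respectsIso ((P.ι.mapIso e).hom.app σ) _).2 (hf σ))
    (fun e _ hf σ ↦ (R.cancel_right_of_respectsIso _ ((P.ι.mapIso e).hom.app σ)).2 (hf σ))

variable [ModelCategory M]

/-- The objectwise fibrations. -/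
local instance objectwiseFibrations : CategoryWithFibrations P.FullSubcategory :=
  ⟨objectwise P (fibrations M)⟩

/-- The objectwise weak equivalences. -/
local instance objectwiseWeakEquivalences : CategoryWithWeakEquivalences P.FullSubcategory :=
  ⟨objectwise P (weakEquivalences M)⟩

/-- The morphisms with the left lifting property with respect to objectwise trivial
fibrations. -/
local instance projectiveCofibrations' : CategoryWithCofibrations P.FullSubcategory :=
  ⟨(objectwise P (trivialFibrations M)).llp⟩

end

namespace DegeneracyData

variable {K : Type w} [Category.{0} K] (δ : DegeneracyData K)
  {M : Type uM} [Category.{vM} M] {P : ObjectProperty (K ⥤ M)}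
  (hP : ∀ F, P F ↔ δ.degeneracies.IsInvertedBy F)

lemma objectwise_ofQuot_map_iff (R : MorphismProperty M) {F G : δ.Quot ⥤ M} (Ψ : F ⟶ G) :
    objectwise P R ((δ.ofQuot hP).map Ψ) ↔ R.functorCategory _ Ψ :=
  ⟨fun h σ ↦ h σ.as, fun h σ ↦ h (δ.toQuot.obj σ)⟩

lemma objectwise_eq (R : MorphismProperty M) [R.RespectsIso] :
    objectwise P R = (R.functorCategory _).inverseImage (δ.equivalence hP).functor := by
  ext F G Ψ
  rw [MorphismProperty.inverseImage_iff, ← δ.objectwise_ofQuot_map_iff hP]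
  exact MorphismProperty.arrow_mk_iso_iff _
    (Arrow.isoMk ((δ.equivalence hP).unitIso.app _) ((δ.equivalence hP).unitIso.app _)
      ((δ.equivalence hP).unitIso.hom.naturality Ψ).symm)

lemma objectwise_llp_eq (R : MorphismProperty M) [R.RespectsIso] :
    (objectwise P R).llp =
      (R.functorCategory _).llp.inverseImage (δ.equivalence hP).functor := by
  ext F G Ψ
  constructor
  · intro h A B p hp
    have := h _ ((δ.objectwise_ofQuot_map_iff hP R p).2 hp)
    rw [← (δ.equivalence hP).inverse.hasLiftingProperty_iff_of_isEquivalence]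
    refine (HasLiftingProperty.iff_of_arrow_iso_left ?_ _).1 this
    exact Arrow.isoMk ((δ.equivalence hP).unitIso.app _) ((δ.equivalence hP).unitIso.app _)
      ((δ.equivalence hP).unitIso.hom.naturality Ψ).symm
  · intro h A B p hp
    rw [δ.objectwise_eq hP R] at hp
    rw [← (δ.equivalence hP).functor.hasLiftingProperty_iff_of_isEquivalence]
    exact h _ hp

attribute [local instance] objectwiseFibrations objectwiseWeakEquivalences
  projectiveCofibrations' projectiveFibrations projectiveWeakEquivalences projectiveCofibrations

variable [ModelCategory M] [HasColimitsOfSize.{w, w} M] [HasLimitsOfSize.{w, w} M]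

/-- The projective model structure on diagrams that invert degeneracies. -/
@[reducible]
def modelCategory : ModelCategory P.FullSubcategory :=
  letI := projectiveModelCategory (M := M) δ.directDegree
  ModelCategory.transport (δ.equivalence hP) (δ.objectwise_llp_eq hP _) (δ.objectwise_eq hP _)
    (δ.objectwise_eq hP _)

include δ hP in
omit [ModelCategory M] [HasColimitsOfSize.{w, w} M] in
lemma hasLimitsOfSize : HasLimitsOfSize.{w, w} P.FullSubcategory :=
  Adjunction.has_limits_of_equivalence (δ.equivalence hP).functor

include δ hP in
omit [ModelCategory M] [HasLimitsOfSize.{w, w} M] in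
lemma hasColimitsOfSize : HasColimitsOfSize.{w, w} P.FullSubcategory :=
  Adjunction.has_colimits_of_equivalence (δ.equivalence hP).functor

end DegeneracyData

end Degeneracy

/-! ## Degeneracies of simplex categories -/

namespace SimplexCat

variable {K : SSet.{w}}

/-- The monotone map underlying a morphism of simplices. -/
abbrev under {σ τ : SimplexCat K} (f : σ ⟶ τ) : σ.unop.1.unop ⟶ τ.unop.1.unop := f.unop.1.unop

/-- A morphism of simplices from its underlying monotone map. -/
def mkHom {σ τ : SimplexCat K} (θ : σ.unop.1.unop ⟶ τ.unop.1.unop)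
    (h : K.map θ.op τ.unop.2 = σ.unop.2) : σ ⟶ τ :=
  (CategoryOfElements.homMk τ.unop σ.unop θ.op h).op

@[simp]
lemma under_mkHom {σ τ : SimplexCat K} (θ : σ.unop.1.unop ⟶ τ.unop.1.unop)
    (h : K.map θ.op τ.unop.2 = σ.unop.2) : under (mkHom θ h) = θ := rfl

lemma hom_ext {σ τ : SimplexCat K} {f g : σ ⟶ τ} (h : under f = under g) : f = g :=
  Quiver.Hom.unop_inj (Subtype.ext (Quiver.Hom.unop_inj h))

lemma map_under {σ τ : SimplexCat K} (f : σ ⟶ τ) : K.map (under f).op τ.unop.2 = σ.unop.2 :=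
  f.unop.2

/-- Removes the equation between simplices carried by a morphism: it suffices to treat `θ^* x ⟶ x`.
-/
lemma hom_induction {motive : ∀ {σ τ : SimplexCat K}, (σ ⟶ τ) → Prop}
    (h : ∀ {m n : ℕ} (x : K _⦋n⦌) (θ : ⦋m⦌ ⟶ ⦋n⦌), motive (homMk x θ))
    {σ τ : SimplexCat K} (f : σ ⟶ τ) : motive f := by
  have key (m n : SimplexCategory) (θ : m ⟶ n) (x : K.obj (op n)) (y : K.obj (op m))
      (hθ : K.map θ.op x = y) :
      motive (σ := op ⟨op m, y⟩) (τ := op ⟨op n, x⟩) (Quiver.Hom.op ⟨θ.op, hθ⟩) := by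
    subst hθ
    exact h (m := m.len) (n := n.len) x θ
  exact key _ _ (under f) _ _ (map_under f)

/-- The property of being non-degenerate. -/
def IsNonDegenerate (σ : SimplexCat K) : Prop :=
  σ.unop.2 ∈ K.nonDegenerate σ.unop.1.unop.len

/-- The dimension of a simplex. -/
abbrev len (σ : SimplexCat K) : ℕ := σ.unop.1.unop.len

lemma exists_root (σ : SimplexCat K) :
    ∃ (ρ : SimplexCat K) (e : σ ⟶ ρ), ρ.IsNonDegenerate ∧ Epi (under e) := by
  obtain ⟨m, f, hf, y, hy⟩ := K.exists_nonDegenerate (n := σ.len) σ.unop.2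
  exact ⟨mk y.1, mkHom f hy.symm, y.2, hf⟩

/-- The non-degenerate simplex of which `σ` is a degeneracy. -/
def root (σ : SimplexCat K) : SimplexCat K := σ.exists_root.choose

/-- The degeneracy from a simplex to its root. -/
def toRoot (σ : SimplexCat K) : σ ⟶ σ.root := σ.exists_root.choose_spec.choose

lemma isNonDegenerate_root (σ : SimplexCat K) : σ.root.IsNonDegenerate :=
  σ.exists_root.choose_spec.choose_spec.1

instance (σ : SimplexCat K) : Epi (under σ.toRoot) :=
  σ.exists_root.choose_spec.choose_spec.2

/-- The uniqueness part of the Eilenberg-Zilber lemma, for the non-degenerate simplex and for the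
degeneracy operator onto it. -/
lemma root_unique {σ ρ ρ' : SimplexCat K} (hρ : ρ.IsNonDegenerate) (hρ' : ρ'.IsNonDegenerate)
    (e : σ ⟶ ρ) (e' : σ ⟶ ρ') [Epi (under e)] [Epi (under e')] :
    ∃ h : ρ = ρ', e ≫ eqToHom h = e' := by
  obtain ⟨⟨⟨m⟩, y⟩⟩ := ρ
  obtain ⟨⟨⟨m'⟩, y'⟩⟩ := ρ'
  obtain ⟨m, rfl⟩ : ∃ k : ℕ, m = ⦋k⦌ := ⟨m.len, rfl⟩
  obtain ⟨m', rfl⟩ : ∃ k : ℕ, m' = ⦋k⦌ := ⟨m'.len, rfl⟩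
  obtain rfl := K.unique_nonDegenerate_dim (n := σ.len) σ.unop.2 (under e) ⟨y, hρ⟩
    (map_under e).symm (under e') ⟨y', hρ'⟩ (map_under e').symm
  obtain rfl := congrArg Subtype.val <| K.unique_nonDegenerate_simplex (n := σ.len) σ.unop.2
    (under e) ⟨y, hρ⟩ (map_under e).symm (under e') ⟨y', hρ'⟩ (map_under e').symm
  refine ⟨rfl, ?_⟩
  rw [eqToHom_refl, Category.comp_id]
  exact hom_ext (K.unique_nonDegenerate_map (n := σ.len) σ.unop.2
    (under e) ⟨y, hρ⟩ (map_under e).symm (under e') ⟨y, hρ'⟩ (map_under e').symm)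

/-- The dimension of the root of a simplex. -/
def dim (σ : SimplexCat K) : ℕ := σ.root.len

lemma dim_eq_len {σ ρ : SimplexCat K} (hρ : ρ.IsNonDegenerate) (e : σ ⟶ ρ) [Epi (under e)] :
    σ.dim = ρ.len := by
  obtain ⟨h, -⟩ := root_unique σ.isNonDegenerate_root hρ σ.toRoot e
  rw [dim, h]

lemma isIso_of_isIso_under {σ τ : SimplexCat K} (f : σ ⟶ τ) [IsIso (under f)] : IsIso f := by
  refine ⟨mkHom (inv (under f)) ?_, hom_ext (IsIso.hom_inv_id _), hom_ext (IsIso.inv_hom_id _)⟩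
  rw [← map_under f, ← K.map_comp_apply, ← op_comp, IsIso.inv_hom_id]
  simp

lemma dim_eq_of_isNonDegenerate {ρ : SimplexCat K} (hρ : ρ.IsNonDegenerate) : ρ.dim = ρ.len :=
  have : Epi (under (𝟙 ρ)) := inferInstanceAs (Epi (𝟙 _))
  dim_eq_len hρ (𝟙 ρ)

lemma dim_le_len (σ : SimplexCat K) : σ.dim ≤ σ.len :=
  SimplexCategory.len_le_of_epi (under σ.toRoot)

lemma dim_eq_of_epi {σ τ : SimplexCat K} (e : σ ⟶ τ) [Epi (under e)] : σ.dim = τ.dim :=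
  have : Epi (under (e ≫ τ.toRoot)) := inferInstanceAs (Epi (under e ≫ under τ.toRoot))
  dim_eq_len τ.isNonDegenerate_root (e ≫ τ.toRoot)

lemma exists_fac {σ τ : SimplexCat K} (f : σ ⟶ τ) : ∃ (ρ : SimplexCat K) (e : σ ⟶ ρ) (i : ρ ⟶ τ),
    Epi (under e) ∧ Mono (under i) ∧ e ≫ i = f := by
  let i : image (under f) ⟶ τ.unop.1.unop := image.ι (under f)
  let e : σ.unop.1.unop ⟶ image (under f) := factorThruImage (under f)
  have hei : e ≫ i = under f := image.fac _
  let ρ : SimplexCat K := op ⟨op (image (under f)), K.map i.op τ.unop.2⟩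
  have he : K.map e.op ρ.unop.2 = σ.unop.2 := by
    have h : K.map (e ≫ i).op τ.unop.2 = σ.unop.2 := by rw [hei, map_under]
    exact (K.map_comp_apply i.op e.op τ.unop.2).symm.trans h
  exact ⟨ρ, mkHom (τ := ρ) e he, mkHom (σ := ρ) i rfl, inferInstanceAs (Epi e),
    inferInstanceAs (Mono i), hom_ext hei⟩

/-- The surjection onto the image preserves `dim`, and the image is a proper face of `ρ`. -/
lemma dim_lt_of_not_epi {σ ρ : SimplexCat K} (f : σ ⟶ ρ)
    (hf : ¬ Epi (under f)) : σ.dim < ρ.len := by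
  obtain ⟨τ, e, i, _, _, rfl⟩ := exists_fac f
  rw [dim_eq_of_epi e]
  refine τ.dim_le_len.trans_lt ((SimplexCategory.len_le_of_mono (under i)).lt_of_ne fun h ↦ hf ?_)
  have := (SimplexCategory.isIso_iff_of_mono (under i)).2 h
  exact inferInstanceAs (Epi (under e ≫ under i))

/-- Makes surjectivity depend on dimensions alone. The direct structure of the quotient and the
induction over skeleta both rest on this. -/
lemma epi_iff_dim_eq {σ ρ : SimplexCat K} (hρ : ρ.IsNonDegenerate) (f : σ ⟶ ρ) :
    Epi (under f) ↔ σ.dim = ρ.len :=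
  ⟨fun _ ↦ dim_eq_len hρ f, fun h ↦ by
    by_contra hf
    exact (dim_lt_of_not_epi f hf).ne h⟩

variable (K) in
/-- The degeneracies of the simplex category of a simplicial set. -/
def degeneracyData : DegeneracyData (SimplexCat K) where
  degeneracies _ _ f := Epi (under f)
  dim := dim
  dim_le {σ τ} f := by
    by_cases h : Epi (under (f ≫ τ.toRoot))
    · exact (dim_eq_len τ.isNonDegenerate_root (f ≫ τ.toRoot)).le
    · exact (dim_lt_of_not_epi (f ≫ τ.toRoot) h).le
  -- Followed by the degeneracy to the root of `τ`, both morphisms become surjections onto a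
  -- non-degenerate simplex, and there is only one such surjection.
  exists_degeneracy {σ τ} f g h := by
    have h₁ := (epi_iff_dim_eq τ.isNonDegenerate_root (f ≫ τ.toRoot)).2 h
    have h₂ := (epi_iff_dim_eq τ.isNonDegenerate_root (g ≫ τ.toRoot)).2 h
    refine ⟨_, τ.toRoot, inferInstance, h₁, ?_⟩
    obtain ⟨_, h⟩ := root_unique τ.isNonDegenerate_root τ.isNonDegenerate_root
      (f ≫ τ.toRoot) (g ≫ τ.toRoot)
    simpa using h
  exists_section {σ τ} e (he : Epi (under e)) := by
    have := isSplitEpi_of_epi (under e)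
    refine ⟨mkHom (section_ (under e)) ?_, hom_ext (IsSplitEpi.id (under e))⟩
    rw [← map_under e, ← K.map_comp_apply, ← op_comp, IsSplitEpi.id]
    simp

end SimplexCat

/-- A surjective operator that is not invertible starts with some elementary degeneracy; induction
on the dimension of the source then treats all surjections. -/
lemma isBounded_iff {K : SSet.{w}} {M : Type uM} [Category.{vM} M] (F : SimplexCat K ⥤ M) :
    IsBounded K M F ↔ (SimplexCat.degeneracyData K).degeneracies.IsInvertedBy F := by
  constructor
  · intro h
    -- The `eqToHom` form covers degeneracies whose source is not syntactically a restriction along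
    -- `σ i`, as is the case for `g` below.
    have h₁ {σ τ : SimplexCat K} (f : σ ⟶ τ) :
        ∀ n i (e₁ : σ.unop.1.unop = ⦋n + 1⦌) (e₂ : τ.unop.1.unop = ⦋n⦌),
        SimplexCat.under f = eqToHom e₁ ≫ SimplexCategory.σ i ≫ eqToHom e₂.symm →
          IsIso (F.map f) := by
      induction f using SimplexCat.hom_induction with
      | h x θ =>
        rintro n i e₁ e₂ hf
        obtain rfl := congrArg SimplexCategory.len e₁
        obtain rfl := congrArg SimplexCategory.len e₂
        obtain rfl : θ = SimplexCategory.σ i := hf.trans (by simp)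
        exact h _ x i
    have h₂ (m : ℕ) : ∀ {n : ℕ} (x : K _⦋n⦌) (θ : ⦋m⦌ ⟶ ⦋n⦌) [Epi θ],
        IsIso (F.map (SimplexCat.homMk x θ)) := by
      have h₃ {m n : ℕ} (x : K _⦋n⦌) (θ : ⦋m⦌ ⟶ ⦋n⦌) [Epi θ] (hθ : Mono θ) :
          IsIso (F.map (SimplexCat.homMk x θ)) := by
        have hθ' : IsIso (SimplexCat.under (SimplexCat.homMk x θ)) :=
          (SimplexCategory.isIso_iff_of_mono θ).2
            (le_antisymm (SimplexCategory.len_le_of_mono θ) (SimplexCategory.len_le_of_epi θ))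
        have := SimplexCat.isIso_of_isIso_under (SimplexCat.homMk x θ)
        infer_instance
      induction m with
      | zero =>
        intro n x θ _
        refine h₃ x θ ?_
        rw [SimplexCategory.mono_iff_injective]
        exact Function.injective_of_subsingleton (α := Fin 1) _
      | succ m hm =>
        intro n x θ _
        by_cases hθ : Mono θ
        · exact h₃ x θ hθ
        · rw [SimplexCategory.mono_iff_injective] at hθ
          obtain ⟨i, θ', rfl⟩ := SimplexCategory.eq_σ_comp_of_not_injective θ hθ
          have := epi_of_epi (SimplexCategory.σ i) θ'
          let g : SimplexCat.mk (K.map (SimplexCategory.σ i ≫ θ').op x) ⟶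
              SimplexCat.mk (K.map θ'.op x) :=
            SimplexCat.mkHom (SimplexCategory.σ i) (K.map_comp_apply _ _ _).symm
          have hg : IsIso (F.map g) := h₁ g m i rfl rfl (by simp [g])
          have := hm x θ'
          rw [show SimplexCat.homMk x (SimplexCategory.σ i ≫ θ') = g ≫ SimplexCat.homMk x θ' from
            SimplexCat.hom_ext rfl, F.map_comp]
          infer_instance
    intro σ τ f hf
    induction f using SimplexCat.hom_induction with
    | h x θ =>
      have : Epi θ := hf
      exact h₂ _ x θ
  · intro h n x i
    exact h _ (inferInstanceAs (Epi (SimplexCategory.σ i)))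

/-! ## Colimits over boundaries -/

section Boundary

variable {K : SSet.{w}} {n : ℕ} {x : K _⦋n⦌}

namespace SimplexCat

/-- The simplex of the boundary given by a morphism to `x` that is not surjective. -/
def toBoundary {σ : SimplexCat K} (f : σ ⟶ mk x) (hf : ¬ Epi (under f)) :
    SimplexCat ((SSet.boundary.{w} n : (Δ[n] : SSet.{w}).Subcomplex) : SSet.{w}) :=
  op ⟨σ.unop.1, ⟨SSet.stdSimplex.objEquiv.symm (under f), fun h ↦ hf <| by
    rw [SimplexCategory.epi_iff_surjective]
    exact h⟩⟩

/-- A simplex that has a non-surjective map to `x` is a simplex of the boundary of `x`. -/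
def toBoundaryHom {σ : SimplexCat K} (f : σ ⟶ mk x) (hf : ¬ Epi (under f)) :
    σ ⟶ (boundary x).obj (toBoundary f hf) :=
  mkHom (𝟙 _) ((K.map_id_apply _ _).trans (map_under f))

/-- The morphism to `x` from a simplex of its boundary. -/
def ofBoundary
    (τ : SimplexCat ((SSet.boundary.{w} n : (Δ[n] : SSet.{w}).Subcomplex) : SSet.{w})) :
    (boundary x).obj τ ⟶ mk x :=
  mkHom (SSet.stdSimplex.objEquiv τ.unop.2.1) rfl

lemma not_epi_ofBoundary
    (τ : SimplexCat ((SSet.boundary.{w} n : (Δ[n] : SSet.{w}).Subcomplex) : SSet.{w})) :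
    ¬ Epi (under (ofBoundary (x := x) τ)) := fun h ↦ by
  rw [SimplexCategory.epi_iff_surjective] at h
  exact τ.unop.2.2 h

lemma ofBoundary_naturality
    {τ τ' : SimplexCat ((SSet.boundary.{w} n : (Δ[n] : SSet.{w}).Subcomplex) : SSet.{w})}
    (f : τ ⟶ τ') : (boundary x).map f ≫ ofBoundary τ' = ofBoundary τ := by
  have h := congrArg Subtype.val f.unop.2
  apply hom_ext
  change f.unop.1.unop ≫ SSet.stdSimplex.objEquiv τ'.unop.2.1 =
    SSet.stdSimplex.objEquiv τ.unop.2.1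
  rw [← h]
  rfl

lemma toBoundaryHom_ofBoundary {σ : SimplexCat K} (f : σ ⟶ mk x) (hf : ¬ Epi (under f)) :
    toBoundaryHom f hf ≫ ofBoundary _ = f :=
  hom_ext (Category.id_comp _)

lemma not_epi_comp {σ τ : SimplexCat K} (g : τ ⟶ σ) {f : σ ⟶ mk x} (hf : ¬ Epi (under f)) :
    ¬ Epi (under (g ≫ f)) := fun _ ↦
  hf (epi_of_epi_fac (f := under g) (h := under (g ≫ f)) rfl)

end SimplexCat

open SimplexCat

variable {M : Type uM} [Category.{vM} M] [HasColimitsOfSize.{w, w} M]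

/-- The morphism `F σ ⟶ colim_{∂Δ[n]} F` given by a morphism `σ ⟶ x` that is not surjective. -/
def boundaryι (F : SimplexCat K ⥤ M) {σ : SimplexCat K} (f : σ ⟶ mk x) (hf : ¬ Epi (under f)) :
    F.obj σ ⟶ colimit (SimplexCat.boundary x ⋙ F) :=
  F.map (toBoundaryHom f hf) ≫ colimit.ι (SimplexCat.boundary x ⋙ F) (toBoundary f hf)

lemma map_boundaryι (F : SimplexCat K ⥤ M) {σ τ : SimplexCat K} (g : τ ⟶ σ) (f : σ ⟶ mk x)
    (hf : ¬ Epi (under f)) :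
    F.map g ≫ boundaryι F f hf = boundaryι F (g ≫ f) (not_epi_comp g hf) := by
  let k : toBoundary (g ≫ f) (not_epi_comp g hf) ⟶ toBoundary f hf :=
    mkHom (σ := toBoundary (g ≫ f) (not_epi_comp g hf)) (τ := toBoundary f hf) g.unop.1.unop
      (Subtype.ext rfl)
  rw [boundaryι, boundaryι, ← colimit.w (SimplexCat.boundary x ⋙ F) k, ← Category.assoc,
    ← Category.assoc, Functor.comp_map, ← F.map_comp, ← F.map_comp]
  congr 2

lemma boundaryι_ofBoundary (F : SimplexCat K ⥤ M)
    (τ : SimplexCat ((SSet.boundary.{w} n : (Δ[n] : SSet.{w}).Subcomplex) : SSet.{w})) :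
    boundaryι F (ofBoundary (x := x) τ) (not_epi_ofBoundary τ) =
      colimit.ι (SimplexCat.boundary x ⋙ F) τ := by
  let k : τ ⟶ toBoundary (ofBoundary (x := x) τ) (not_epi_ofBoundary τ) :=
    mkHom (τ := toBoundary (ofBoundary (x := x) τ) (not_epi_ofBoundary τ)) (𝟙 _)
      (Functor.map_id_apply _ _ _)
  rw [boundaryι, ← colimit.w (SimplexCat.boundary x ⋙ F) k]
  rfl

/-- With `boundaryDesc`, a universal property of the colimit over the boundary in terms of
non-surjective morphisms to `x` in the simplex category of `K`, without reference to simplices of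
`∂Δ[n]`. -/
lemma boundary_hom_ext {F : SimplexCat K ⥤ M} {A : M}
    {u v : colimit (SimplexCat.boundary x ⋙ F) ⟶ A}
    (h : ∀ (σ : SimplexCat K) (f : σ ⟶ mk x) (hf : ¬ Epi (under f)),
      boundaryι F f hf ≫ u = boundaryι F f hf ≫ v) : u = v := by
  apply colimit.hom_ext
  intro τ
  rw [← boundaryι_ofBoundary]
  exact h _ _ _

/-- The morphism from `colim_{∂Δ[n]} F` given by a compatible family of morphisms. -/
def boundaryDesc (F : SimplexCat K ⥤ M) {A : M}
    (c : ∀ (σ : SimplexCat K) (f : σ ⟶ mk x) (_ : ¬ Epi (under f)), F.obj σ ⟶ A)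
    (hc : ∀ (σ τ : SimplexCat K) (g : τ ⟶ σ) (f : σ ⟶ mk x) (hf : ¬ Epi (under f)),
      F.map g ≫ c σ f hf = c τ (g ≫ f) (not_epi_comp g hf)) :
    colimit (SimplexCat.boundary x ⋙ F) ⟶ A :=
  colimit.desc (SimplexCat.boundary x ⋙ F)
    { pt := A
      ι :=
        { app τ := c _ (ofBoundary τ) (not_epi_ofBoundary τ)
          naturality τ τ' f := by
            refine (hc _ _ ((boundary x).map f) (ofBoundary τ') (not_epi_ofBoundary τ')).trans ?_
            refine Eq.trans ?_ (Category.comp_id _).symm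
            congr 1
            exact ofBoundary_naturality f } }

lemma boundaryι_boundaryDesc (F : SimplexCat K ⥤ M) {A : M}
    (c : ∀ (σ : SimplexCat K) (f : σ ⟶ mk x) (_ : ¬ Epi (under f)), F.obj σ ⟶ A)
    (hc : ∀ (σ τ : SimplexCat K) (g : τ ⟶ σ) (f : σ ⟶ mk x) (hf : ¬ Epi (under f)),
      F.map g ≫ c σ f hf = c τ (g ≫ f) (not_epi_comp g hf))
    {σ : SimplexCat K} (f : σ ⟶ mk x) (hf : ¬ Epi (under f)) :
    boundaryι F f hf ≫ boundaryDesc F c hc = c σ f hf := by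
  rw [boundaryι, boundaryDesc, Category.assoc, colimit.ι_desc]
  refine (hc _ _ _ _ _).trans ?_
  congr 1
  exact toBoundaryHom_ofBoundary f hf

lemma boundaryι_boundaryToObj (F : SimplexCat K ⥤ M) {σ : SimplexCat K} (f : σ ⟶ mk x)
    (hf : ¬ Epi (under f)) : boundaryι F f hf ≫ boundaryToObj F x = F.map f := by
  refine (Category.assoc _ _ _).trans ?_
  refine (congrArg (F.map (toBoundaryHom f hf) ≫ ·)
    (colimit.ι_desc (F := SimplexCat.boundary x ⋙ F) _ _)).trans ?_
  refine (F.map_comp _ _).symm.trans ?_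
  congr 1
  exact toBoundaryHom_ofBoundary f hf

lemma boundaryι_boundaryMap {F G : SimplexCat K ⥤ M} (Ψ : F ⟶ G) {σ : SimplexCat K}
    (f : σ ⟶ mk x) (hf : ¬ Epi (under f)) :
    boundaryι F f hf ≫ boundaryMap Ψ x = Ψ.app σ ≫ boundaryι G f hf := by
  rw [boundaryι, boundaryι, boundaryMap, Category.assoc, ι_colimMap, ← Ψ.naturality_assoc]
  rfl

end Boundary

/-! ## Cofibrations of bounded diagrams -/

section RelativeLatching

open SimplexCat

variable {K : SSet.{w}} {M : Type uM} [Category.{vM} M] [HasColimitsOfSize.{w, w} M]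
  [HasPushouts M] {F G : SimplexCat K ⥤ M} (Ψ : F ⟶ G) {n : ℕ} (x : K _⦋n⦌)

namespace relativeLatching

/-- The first inclusion in the relative latching object. -/
def inl : F.obj (mk x) ⟶ relativeLatching Ψ x := pushout.inl _ _

/-- The second inclusion in the relative latching object. -/
def inr : colimit (SimplexCat.boundary x ⋙ G) ⟶ relativeLatching Ψ x := pushout.inr _ _

lemma w : boundaryToObj F x ≫ inl Ψ x = boundaryMap Ψ x ≫ inr Ψ x := pushout.condition

lemma inl_map : inl Ψ x ≫ relativeLatchingMap Ψ x = Ψ.app (mk x) := pushout.inl_desc _ _ _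

lemma inr_map : inr Ψ x ≫ relativeLatchingMap Ψ x = boundaryToObj G x := pushout.inr_desc _ _ _

variable {Ψ x}

lemma hom_ext {A : M} {u v : relativeLatching Ψ x ⟶ A} (h₁ : inl Ψ x ≫ u = inl Ψ x ≫ v)
    (h₂ : inr Ψ x ≫ u = inr Ψ x ≫ v) : u = v := pushout.hom_ext h₁ h₂

lemma exists_desc {A : M} (a : F.obj (mk x) ⟶ A) (b : colimit (SimplexCat.boundary x ⋙ G) ⟶ A)
    (h : boundaryToObj F x ≫ a = boundaryMap Ψ x ≫ b) :
    ∃ c : relativeLatching Ψ x ⟶ A, inl Ψ x ≫ c = a ∧ inr Ψ x ≫ c = b :=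
  ⟨pushout.desc a b h, pushout.inl_desc _ _ _, pushout.inr_desc _ _ _⟩

end relativeLatching

end RelativeLatching

/-! ### Construction of lifts by induction over skeleta -/

section Lift

open SimplexCat

variable {K : SSet.{w}} {M : Type uM} [Category.{vM} M]

/-- A lift in a square of diagrams on the simplex category of `K`, defined on the simplices of
dimension less than `N`. -/
structure PartialLift {F G X Y : SimplexCat K ⥤ M} (Ψ : F ⟶ G) (p : X ⟶ Y) (u : F ⟶ X)
    (v : G ⟶ Y) (N : ℕ) where
  app (σ : SimplexCat K) (hσ : σ.dim < N) : G.obj σ ⟶ X.obj σ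
  fac_left (σ : SimplexCat K) (hσ : σ.dim < N) : Ψ.app σ ≫ app σ hσ = u.app σ
  fac_right (σ : SimplexCat K) (hσ : σ.dim < N) : app σ hσ ≫ p.app σ = v.app σ
  naturality {σ τ : SimplexCat K} (f : σ ⟶ τ) (hσ : σ.dim < N) (hτ : τ.dim < N) :
    G.map f ≫ app τ hτ = app σ hσ ≫ X.map f

namespace PartialLift

variable [HasColimitsOfSize.{w, w} M] [HasPushouts M] {F G X Y : SimplexCat K ⥤ M}
  {Ψ : F ⟶ G} {p : X ⟶ Y} {u : F ⟶ X} {v : G ⟶ Y} (sq : u ≫ p = Ψ ≫ v)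
  {N : ℕ} (L : PartialLift Ψ p u v N)

include sq in
-- Simplices with a non-surjective morphism to `x` have dimension less than `N`, so the partial lift
-- glues to a map from the boundary colimit of `G`. Together with `u` at `x` this is a map from the
-- relative latching object, and a lift against `p` extends it.
lemma exists_lift (x : K _⦋N⦌) (hp : HasLiftingProperty (relativeLatchingMap Ψ x) (p.app (SimplexCat.mk x))) :
    ∃ ℓ : G.obj (SimplexCat.mk x) ⟶ X.obj (SimplexCat.mk x), Ψ.app (SimplexCat.mk x) ≫ ℓ = u.app (SimplexCat.mk x) ∧
      ℓ ≫ p.app (SimplexCat.mk x) = v.app (SimplexCat.mk x) ∧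
      ∀ (σ : SimplexCat K) (f : σ ⟶ SimplexCat.mk x) (_ : ¬ Epi (under f)) (hσ : σ.dim < N),
        G.map f ≫ ℓ = L.app σ hσ ≫ X.map f := by
  let c : colimit (SimplexCat.boundary x ⋙ G) ⟶ X.obj (SimplexCat.mk x) :=
    boundaryDesc G (fun σ f hf ↦ L.app σ (dim_lt_of_not_epi f hf) ≫ X.map f)
      (fun σ τ g f hf ↦ by
        rw [X.map_comp, ← Category.assoc, ← Category.assoc,
          L.naturality g (dim_lt_of_not_epi _ (not_epi_comp g hf))])
  have hc {σ : SimplexCat K} (f : σ ⟶ SimplexCat.mk x) (hf : ¬ Epi (under f)) :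
      boundaryι G f hf ≫ c = L.app σ (dim_lt_of_not_epi f hf) ≫ X.map f :=
    boundaryι_boundaryDesc G _ _ f hf
  have h₁ : boundaryToObj F x ≫ u.app (SimplexCat.mk x) = boundaryMap Ψ x ≫ c :=
    boundary_hom_ext fun σ f hf ↦ by
      rw [← Category.assoc, ← Category.assoc, boundaryι_boundaryToObj, boundaryι_boundaryMap,
        Category.assoc, hc, ← Category.assoc, L.fac_left, u.naturality]
  have h₂ : c ≫ p.app (SimplexCat.mk x) = boundaryToObj G x ≫ v.app (SimplexCat.mk x) :=
    boundary_hom_ext fun σ f hf ↦ by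
      rw [← Category.assoc, ← Category.assoc, boundaryι_boundaryToObj, hc, Category.assoc,
        p.naturality, ← Category.assoc, L.fac_right, v.naturality]
  obtain ⟨t, ht₁, ht₂⟩ := relativeLatching.exists_desc _ _ h₁
  have sq' : CommSq t (relativeLatchingMap Ψ x) (p.app (SimplexCat.mk x))
      (v.app (SimplexCat.mk x)) := ⟨by
    apply relativeLatching.hom_ext
    · rw [← Category.assoc, ht₁, ← Category.assoc, relativeLatching.inl_map]
      exact congr_app sq _
    · rw [← Category.assoc, ht₂, ← Category.assoc, relativeLatching.inr_map, h₂]⟩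
  have hl : Ψ.app (SimplexCat.mk x) ≫ sq'.lift = u.app (SimplexCat.mk x) := by
    rw [← ht₁, ← relativeLatching.inl_map, Category.assoc, sq'.fac_left]
  have hr : boundaryToObj G x ≫ sq'.lift = c := by
    rw [← ht₂, ← relativeLatching.inr_map, Category.assoc, sq'.fac_left]
  exact ⟨sq'.lift, hl, sq'.fac_right, fun σ f hf hσ ↦ by
    rw [← boundaryι_boundaryToObj G f hf, Category.assoc, hr, hc]⟩

include sq in
-- The lift is chosen on non-degenerate `N`-simplices. On their degeneracies it is forced, because
-- `X` inverts the degeneracy to the root.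
lemma exists_extension (hX : (degeneracyData K).degeneracies.IsInvertedBy X)
    (hY : (degeneracyData K).degeneracies.IsInvertedBy Y)
    (hp : ∀ x ∈ K.nonDegenerate N,
      HasLiftingProperty (relativeLatchingMap Ψ x) (p.app (SimplexCat.mk x))) :
    ∃ L' : PartialLift Ψ p u v (N + 1), ∀ (σ : SimplexCat K) (hσ : σ.dim < N),
      L'.app σ (hσ.trans (Nat.lt_succ_self N)) = L.app σ hσ := by
  have h (ρ : SimplexCat K) (hρ : ρ.IsNonDegenerate) (hN : ρ.len = N) :
      ∃ ℓ : G.obj ρ ⟶ X.obj ρ, Ψ.app ρ ≫ ℓ = u.app ρ ∧ ℓ ≫ p.app ρ = v.app ρ ∧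
      ∀ (σ : SimplexCat K) (f : σ ⟶ ρ) (_ : ¬ Epi (under f)) (hσ : σ.dim < N),
        G.map f ≫ ℓ = L.app σ hσ ≫ X.map f := by
    subst hN
    exact L.exists_lift sq (N := ρ.len) ρ.unop.2 (hp _ hρ)
  choose ℓ h₁ h₂ h₃ using h
  have hX' (σ : SimplexCat K) : IsIso (X.map σ.toRoot) :=
    hX _ (inferInstanceAs (Epi (under σ.toRoot)))
  have hY' (σ : SimplexCat K) : IsIso (Y.map σ.toRoot) :=
    hY _ (inferInstanceAs (Epi (under σ.toRoot)))
  let new (σ : SimplexCat K) (hσ : σ.root.len = N) : G.obj σ ⟶ X.obj σ :=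
    G.map σ.toRoot ≫ ℓ σ.root σ.isNonDegenerate_root hσ ≫ inv (X.map σ.toRoot)
  have hnew (σ : SimplexCat K) (hσ : σ.root.len = N) :
      new σ hσ ≫ X.map σ.toRoot = G.map σ.toRoot ≫ ℓ σ.root σ.isNonDegenerate_root hσ := by
    simp [new]
  have hnew' {σ ρ : SimplexCat K} (hσ : σ.root.len = N) (e : σ ⟶ ρ) (hρ : ρ.IsNonDegenerate)
      (hN : ρ.len = N) (he : Epi (under e)) :
      new σ hσ ≫ X.map e = G.map e ≫ ℓ ρ hρ hN := by
    obtain ⟨rfl, he⟩ := root_unique σ.isNonDegenerate_root hρ σ.toRoot e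
    rw [eqToHom_refl, Category.comp_id] at he
    rw [← he, hnew]
  have hd (σ : SimplexCat K) (hσ : σ.dim < N + 1) (h : ¬ σ.dim < N) : σ.root.len = N := by
    change σ.dim = N
    omega
  refine ⟨{ app σ hσ := if h : σ.dim < N then L.app σ h else new σ (hd σ hσ h)
            fac_left σ hσ := ?_
            fac_right σ hσ := ?_
            naturality {σ τ} f hσ hτ := ?_ }, fun σ hσ ↦ dif_pos hσ⟩
  · split_ifs with h
    · exact L.fac_left σ h
    · rw [← cancel_mono (X.map σ.toRoot), Category.assoc, hnew, ← u.naturality,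
        ← Ψ.naturality_assoc, h₁]
  · split_ifs with h
    · exact L.fac_right σ h
    · rw [← cancel_mono (Y.map σ.toRoot), Category.assoc, ← p.naturality, ← Category.assoc, hnew,
        Category.assoc, h₂, v.naturality]
  · by_cases h : τ.dim < N
    · have h' : σ.dim < N := ((degeneracyData K).dim_le f).trans_lt h
      rw [dif_pos h, dif_pos h']
      exact L.naturality f _ _
    · rw [dif_neg h, ← cancel_mono (X.map τ.toRoot), Category.assoc, hnew, Category.assoc,
        ← X.map_comp, ← Category.assoc, ← G.map_comp]
      have hτ' := hd τ hτ h
      split_ifs with h'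
      -- If `σ` has smaller dimension, `f ≫ τ.toRoot` is not surjective and compatibility with the
      -- old lift applies; otherwise it is surjective, and `σ` has the same root.
      · refine h₃ _ _ _ _ _ (fun he ↦ ?_) h'
        have := (epi_iff_dim_eq τ.isNonDegenerate_root (f ≫ τ.toRoot)).1 he
        omega
      · refine (hnew' _ _ _ _ ?_).symm
        rw [epi_iff_dim_eq τ.isNonDegenerate_root]
        omega

include sq in
lemma exists_lift_of_relativeLatching (hX : (degeneracyData K).degeneracies.IsInvertedBy X)
    (hY : (degeneracyData K).degeneracies.IsInvertedBy Y)
    (hp : ∀ n, ∀ x ∈ K.nonDegenerate n,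
      HasLiftingProperty (relativeLatchingMap Ψ x) (p.app (SimplexCat.mk x))) :
    ∃ ℓ : G ⟶ X, Ψ ≫ ℓ = u ∧ ℓ ≫ p = v := by
  have h (N : ℕ) (L : PartialLift Ψ p u v N) := L.exists_extension sq hX hY (hp N)
  choose ext hext using h
  let L (N : ℕ) : PartialLift Ψ p u v N :=
    N.rec ⟨fun _ h ↦ absurd h (Nat.not_lt_zero _), fun _ h ↦ absurd h (Nat.not_lt_zero _),
      fun _ h ↦ absurd h (Nat.not_lt_zero _), fun _ h ↦ absurd h (Nat.not_lt_zero _)⟩ ext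
  have hL (σ : SimplexCat K) (N : ℕ) (hN : σ.dim + 1 ≤ N) :
      (L N).app σ hN = (L (σ.dim + 1)).app σ (Nat.lt_succ_self _) := by
    induction N, hN using Nat.le_induction with
    | base => rfl
    | succ N hN h => exact (hext N (L N) σ hN).trans h
  refine ⟨{ app σ := (L (σ.dim + 1)).app σ (Nat.lt_succ_self _)
            naturality σ τ f := ?_ }, ?_, ?_⟩
  · have hf := (degeneracyData K).dim_le f
    rw [← hL σ (τ.dim + 1) (Nat.succ_le_succ hf)]
    exact (L _).naturality f _ _
  · ext σ
    exact (L (σ.dim + 1)).fac_left σ _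
  · ext σ
    exact (L (σ.dim + 1)).fac_right σ _

end PartialLift

end Lift

/-! ### Product diagrams that detect lifting at a single simplex -/

section Corepresentation

variable {M : Type uM} [Category.{vM} M] {A B : M} (p : A ⟶ B)
variable {K : Type uD} [Category.{vD} K]

/-- A morphism to the source or the target of an arrow. -/
def arrowLift' (i : Fin 2) {T : M} (a : i = 0 → (T ⟶ A)) (b : T ⟶ B) :
    T ⟶ (ComposableArrows.mk₁ p).obj i :=
  match i with
  | 0 => a rfl
  | 1 => b

variable (s : K ⥤ Fin 2)

/-- The diagram whose value in `σ` is the source of `p` if `s σ = 0`, and the target of `p`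
otherwise. -/
abbrev arrowDiagram : K ⥤ M := s ⋙ ComposableArrows.mk₁ p

/-- A morphism to the source or the target of `p`, depending on the value of `s`. -/
def arrowLift (σ : K) {T : M} (a : s.obj σ = 0 → (T ⟶ A)) (b : T ⟶ B) :
    T ⟶ (arrowDiagram p s).obj σ :=
  arrowLift' p (s.obj σ) a b

lemma comp_arrowLift (σ : K) {S T : M} (g : S ⟶ T) (a : s.obj σ = 0 → (T ⟶ A)) (b : T ⟶ B) :
    g ≫ arrowLift p s σ a b = arrowLift p s σ (fun h ↦ g ≫ a h) (g ≫ b) := by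
  have h (i : Fin 2) (a : i = 0 → (T ⟶ A)) :
      g ≫ arrowLift' p i a b = arrowLift' p i (fun h ↦ g ≫ a h) (g ≫ b) := by
    match i with
    | 0 => rfl
    | 1 => rfl
  exact h _ a

lemma arrowLift_map {σ τ : K} (φ : σ ⟶ τ) {T : M} (a : s.obj σ = 0 → (T ⟶ A)) (b : T ⟶ B)
    (hab : ∀ h, a h ≫ p = b) (a' : s.obj τ = 0 → (T ⟶ A)) (ha : ∀ h h', a h = a' h') :
    arrowLift p s σ a b ≫ (arrowDiagram p s).map φ = arrowLift p s τ a' b := by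
  have h (i j : Fin 2) (φ : i ⟶ j) (a : i = 0 → (T ⟶ A)) (a' : j = 0 → (T ⟶ A))
      (hab : ∀ h, a h ≫ p = b) (ha : ∀ h h', a h = a' h') :
      arrowLift' p i a b ≫ (ComposableArrows.mk₁ p).map φ = arrowLift' p j a' b := by
    match i, j with
    | 0, 0 =>
      obtain rfl : φ = 𝟙 _ := Subsingleton.elim _ _
      rw [CategoryTheory.Functor.map_id, Category.comp_id]
      exact ha rfl rfl
    | 0, 1 => exact hab rfl
    | 1, 1 =>
      obtain rfl : φ = 𝟙 _ := Subsingleton.elim _ _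
      rw [CategoryTheory.Functor.map_id, Category.comp_id]
      rfl
    | 1, 0 => exact absurd (leOfHom φ) (by simp)
  exact h _ _ (s.map φ) a a' hab ha

lemma left_eq_of_arrowLift_eq {σ : K} {T : M} {a a' : s.obj σ = 0 → (T ⟶ A)} {b b' : T ⟶ B}
    (h : arrowLift p s σ a b = arrowLift p s σ a' b') (hσ : s.obj σ = 0) : a hσ = a' hσ := by
  have h' (i : Fin 2) (a a' : i = 0 → (T ⟶ A)) (h : arrowLift' p i a b = arrowLift' p i a' b')
      (hi : i = 0) : a hi = a' hi := by
    subst hi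
    exact h
  exact h' _ a a' h hσ

lemma right_eq_of_arrowLift_eq {σ : K} {T : M} {a a' : s.obj σ = 0 → (T ⟶ A)} {b b' : T ⟶ B}
    (h : arrowLift p s σ a b = arrowLift p s σ a' b') (hσ : s.obj σ = 1) : b = b' := by
  have h' (i : Fin 2) (a a' : i = 0 → (T ⟶ A)) (h : arrowLift' p i a b = arrowLift' p i a' b')
      (hi : i = 1) : b = b' := by
    subst hi
    exact h
  exact h' _ a a' h hσ

lemma arrowLift_id_mem (R : MorphismProperty M) [R.ContainsIdentities] (hp : R p) (σ : K) :
    R (arrowLift p s σ (fun _ ↦ 𝟙 A) p) := by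
  have h (i : Fin 2) : R (arrowLift' p i (fun _ ↦ 𝟙 A) p) := by
    match i with
    | 0 => exact R.id_mem A
    | 1 => exact hp
  exact h _

variable {D : Type w} [Category.{0} D] [HasLimitsOfSize.{w, w} M]

instance (a b : D) : HasProductsOfShape (a ⟶ b) M :=
  have := hasLimitsOfSizeOfUnivLE.{w, w, 0, 0} M
  inferInstance

variable (P : K ⥤ D) (Q : K ⥤ M) (d : D)

/-- The diagram whose value in `σ` is the product of copies of `Q σ` indexed by the morphisms
`P σ ⟶ d`. -/
def corep : K ⥤ M where
  obj σ := ∏ᶜ fun _ : P.obj σ ⟶ d ↦ Q.obj σ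
  map g := Pi.lift fun f ↦ Pi.π _ (P.map g ≫ f) ≫ Q.map g
  map_id σ := Pi.hom_ext _ _ fun f ↦ by simp
  map_comp g g' := Pi.hom_ext _ _ fun f ↦ by simp

variable {d}

/-- The projections. -/
def corepπ {σ : K} (f : P.obj σ ⟶ d) : (corep P Q d).obj σ ⟶ Q.obj σ :=
  Pi.π (fun _ : P.obj σ ⟶ d ↦ Q.obj σ) f

variable {P Q}

lemma corep_hom_ext {T : M} {σ : K} {u v : T ⟶ (corep P Q d).obj σ}
    (h : ∀ f : P.obj σ ⟶ d, u ≫ corepπ P Q f = v ≫ corepπ P Q f) : u = v :=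
  Pi.hom_ext _ _ h

/-- The morphism to `corep P Q d` given by its components. -/
def corepLift {T : M} {σ : K} (u : (P.obj σ ⟶ d) → (T ⟶ Q.obj σ)) : T ⟶ (corep P Q d).obj σ :=
  Pi.lift u

@[simp]
lemma corepLift_π {T : M} {σ : K} (u : (P.obj σ ⟶ d) → (T ⟶ Q.obj σ)) (f : P.obj σ ⟶ d) :
    corepLift u ≫ corepπ P Q f = u f :=
  limit.lift_π _ _

@[simp]
lemma corepLift_π_assoc {T : M} {σ : K} (u : (P.obj σ ⟶ d) → (T ⟶ Q.obj σ)) (f : P.obj σ ⟶ d)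
    {Z : M} (h : Q.obj σ ⟶ Z) : corepLift u ≫ corepπ P Q f ≫ h = u f ≫ h := by
  rw [← Category.assoc, corepLift_π]

variable (P Q) in
@[simp]
lemma corep_map_π {σ τ : K} (g : σ ⟶ τ) (f : P.obj τ ⟶ d) :
    (corep P Q d).map g ≫ corepπ P Q f = corepπ P Q (P.map g ≫ f) ≫ Q.map g :=
  limit.lift_π _ _

variable (P Q) in
@[simp]
lemma corep_map_π_assoc {σ τ : K} (g : σ ⟶ τ) (f : P.obj τ ⟶ d) {Z : M} (h : Q.obj τ ⟶ Z) :
    (corep P Q d).map g ≫ corepπ P Q f ≫ h = corepπ P Q (P.map g ≫ f) ≫ Q.map g ≫ h := by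
  rw [← Category.assoc, corep_map_π, Category.assoc]

lemma isIso_corep_map {σ τ : K} (g : σ ⟶ τ) [IsIso (P.map g)] [IsIso (Q.map g)] :
    IsIso ((corep P Q d).map g) :=
  ⟨corepLift fun f ↦ corepπ P Q (inv (P.map g) ≫ f) ≫ inv (Q.map g),
    corep_hom_ext fun f ↦ by simp, corep_hom_ext fun f ↦ by simp⟩

lemma corepLift_mem (R : MorphismProperty M) [∀ J : Type, R.IsStableUnderProductsOfShape J]
    {Q' : K ⥤ M} {σ : K} (η : Q.obj σ ⟶ Q'.obj σ) (hη : R η) :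
    R (corepLift (d := d) fun f : P.obj σ ⟶ d ↦ corepπ P Q f ≫ η : _ ⟶ (corep P Q' d).obj σ) :=
  piLift_mem R (fun _ ↦ η) fun _ ↦ hη

end Corepresentation

/-! ### From lifting properties to relative latching maps -/

section Latching

open SimplexCat

variable {K : SSet.{w}} {M : Type uM} [Category.{vM} M] [HasColimitsOfSize.{w, w} M]
  {F G : SimplexCat K ⥤ M} (hG : (degeneracyData K).degeneracies.IsInvertedBy G)
  {n : ℕ} {x : K _⦋n⦌} (hx : x ∈ K.nonDegenerate n)

include hx in
lemma not_epi_of_dim_lt {σ : SimplexCat K} (hσ : σ.dim < n) (f : σ ⟶ mk x) :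
    ¬ Epi (under f) := fun h ↦
  hσ.ne ((epi_iff_dim_eq (ρ := mk x) hx f).1 h)

/-- The morphism `G σ ⟶ colim_{∂Δ[n]} G` only depends on the class of `σ ⟶ x` in the quotient of
the simplex category. -/
def quotBoundaryι {σ : SimplexCat K} (hσ : σ.dim < n)
    (f : (degeneracyData K).toQuot.obj σ ⟶ (degeneracyData K).toQuot.obj (mk x)) :
    G.obj σ ⟶ colimit (SimplexCat.boundary x ⋙ G) :=
  Quot.lift (fun f : σ ⟶ mk x ↦ boundaryι G f (not_epi_of_dim_lt hx hσ f)) (by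
    rintro _ _ ⟨_, _, a, m₁, m₂, b, ρ, e, he, h⟩
    -- If `b` is surjective it factors through `e` by uniqueness of roots, so the two composites are
    -- equal. Otherwise `G m₁ = G m₂` because `G` inverts `e`, and the maps to the colimit factor
    -- through these.
    by_cases hb : Epi (under b)
    · have : Epi (under (e ≫ ρ.toRoot)) :=
        have : Epi (under e) := he
        inferInstanceAs (Epi (under e ≫ under ρ.toRoot))
      obtain ⟨_, rfl⟩ := root_unique (ρ' := mk x) ρ.isNonDegenerate_root hx (e ≫ ρ.toRoot) b
      have : a ≫ m₁ ≫ (e ≫ ρ.toRoot) ≫ eqToHom ‹_› = a ≫ m₂ ≫ (e ≫ ρ.toRoot) ≫ eqToHom ‹_› := by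
        simp only [← Category.assoc]
        rw [Category.assoc a, h, ← Category.assoc a]
      congr 1
    · have := hG e he
      have h' : G.map m₁ = G.map m₂ := by
        rw [← cancel_mono (G.map e), ← G.map_comp, ← G.map_comp, h]
      rw [← map_boundaryι _ _ _ (not_epi_comp _ hb), ← map_boundaryι _ _ _ hb, h',
        map_boundaryι, map_boundaryι]) f

variable (K n) in
/-- The functor that separates the simplices of dimension less than `n` from the others. -/
def dimSplit : SimplexCat K ⥤ Fin 2 where
  obj σ := if σ.dim < n then 0 else 1
  map f := homOfLE (by
    have : _ ≤ _ := (degeneracyData K).dim_le f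
    dsimp [degeneracyData] at this
    split_ifs
    exacts [le_rfl, Fin.zero_le _, absurd (by assumption) (by omega), le_rfl])
  map_id _ := Subsingleton.elim _ _
  map_comp _ _ := Subsingleton.elim _ _

lemma dimSplit_eq_zero_iff (σ : SimplexCat K) : (dimSplit K n).obj σ = 0 ↔ σ.dim < n := by
  change (if σ.dim < n then (0 : Fin 2) else 1) = 0 ↔ _
  split_ifs with h <;> simp [h]

lemma isIso_dimSplit_map {σ τ : SimplexCat K} (e : σ ⟶ τ) [Epi (under e)] :
    IsIso ((dimSplit K n).map e) := by
  have h : (dimSplit K n).obj σ = (dimSplit K n).obj τ := by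
    change (if σ.dim < n then (0 : Fin 2) else 1) = if τ.dim < n then (0 : Fin 2) else 1
    rw [dim_eq_of_epi e]
  exact ⟨homOfLE h.ge, Subsingleton.elim _ _, Subsingleton.elim _ _⟩

variable [HasLimitsOfSize.{w, w} M] [HasPushouts M]

include hx in
-- Take `U σ` to be a product of copies of `A` over the morphisms from `σ` to `x` in the quotient,
-- and `V σ` the same with `B` in place of `A` when `σ` has dimension at least `n`. A square from
-- the relative latching map to `p` yields a square from `Ψ` to `q : U ⟶ V`, and a lift there yields
-- a lift in the original square. Using morphisms of the quotient makes `U` and `V` bounded.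
lemma hasLiftingProperty_relativeLatchingMap {F G : BoundedDiagram K M} {Ψ : F ⟶ G}
    (R : MorphismProperty M) [R.ContainsIdentities]
    [∀ J : Type, R.IsStableUnderProductsOfShape J]
    (hΨ : (objectwise (IsBounded K M) R).llp Ψ) {A B : M} (p : A ⟶ B) (hp : R p) :
    HasLiftingProperty (relativeLatchingMap Ψ.hom x) p where
  sq_hasLift {t b₀} sq := by
    let P : SimplexCat K ⥤ _ := (degeneracyData K).toQuot
    have hP {σ τ : SimplexCat K} (e : σ ⟶ τ) (he : (degeneracyData K).degeneracies e) :
        IsIso (P.map e) := (degeneracyData K).isIso_toQuot_map e he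
    let x₀ := P.obj (mk x)
    let s := dimSplit K n
    let Q : SimplexCat K ⥤ M := (Functor.const _).obj A
    let U : BoundedDiagram K M := ⟨corep P Q x₀, (isBounded_iff _).2 fun σ τ e he ↦ by
      have := hP e he
      have : IsIso (Q.map e) := inferInstanceAs (IsIso (𝟙 A))
      exact isIso_corep_map e⟩
    let V : BoundedDiagram K M := ⟨corep P (arrowDiagram p s) x₀,
      (isBounded_iff _).2 fun σ τ e (he : Epi (under e)) ↦ by
        have := hP e he
        have := isIso_dimSplit_map (n := n) e
        have : IsIso ((arrowDiagram p s).map e) :=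
          inferInstanceAs (IsIso ((ComposableArrows.mk₁ p).map ((dimSplit K n).map e)))
        exact isIso_corep_map e⟩
    let q : U ⟶ V := ObjectProperty.homMk
      { app σ := corepLift fun f ↦ corepπ P Q f ≫ arrowLift p s σ (fun _ ↦ 𝟙 A) p
        naturality σ τ g := corep_hom_ext fun f ↦ by
          have h : Q.map g ≫ arrowLift p s τ (fun _ ↦ 𝟙 A) p =
              arrowLift p s σ (fun _ ↦ 𝟙 A) p ≫ (arrowDiagram p s).map g :=
            (Category.id_comp _).trans (arrowLift_map p s g _ _ (fun _ ↦ Category.id_comp _)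
              (fun _ ↦ 𝟙 A) (fun _ _ ↦ rfl)).symm
          simp only [U, V, Category.assoc, corepLift_π, corep_map_π, corep_map_π_assoc,
            corepLift_π_assoc, h] }
    have hq (σ : SimplexCat K) (f : P.obj σ ⟶ x₀) : q.hom.app σ ≫ corepπ P _ f =
        corepπ P Q f ≫ arrowLift p s σ (fun _ ↦ 𝟙 A) p := corepLift_π _ _
    -- the restrictions of the given morphisms
    obtain ⟨a₀, ha⟩ : ∃ a₀, relativeLatching.inl Ψ.hom x ≫ t = a₀ := ⟨_, rfl⟩
    obtain ⟨c, hc'⟩ : ∃ c, relativeLatching.inr Ψ.hom x ≫ t = c := ⟨_, rfl⟩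
    have ha₀ : boundaryToObj F.obj x ≫ a₀ = boundaryMap Ψ.hom x ≫ c := by
      rw [← ha, ← hc', ← Category.assoc, relativeLatching.w, Category.assoc]
    have hb₀ : a₀ ≫ p = Ψ.hom.app (mk x) ≫ b₀ := by
      rw [← ha, Category.assoc, sq.w, ← Category.assoc, relativeLatching.inl_map]
    have hc : c ≫ p = boundaryToObj G.obj x ≫ b₀ := by
      rw [← hc', Category.assoc, sq.w, ← Category.assoc, relativeLatching.inr_map]
    let φ (H : BoundedDiagram K M) (σ : SimplexCat K) (f : P.obj σ ⟶ x₀) :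
        H.obj.obj σ ⟶ H.obj.obj (mk x) :=
      ((degeneracyData K).descend H.obj ((isBounded_iff _).1 H.property)).map f
    have hφ (H : BoundedDiagram K M) {σ : SimplexCat K} (f : σ ⟶ mk x) :
      φ H σ (P.map f) = H.obj.map f := rfl
    have hφ' (H : BoundedDiagram K M) {σ τ : SimplexCat K} (g : σ ⟶ τ) (f : P.obj τ ⟶ x₀) :
        φ H σ (P.map g ≫ f) = H.obj.map g ≫ φ H τ f :=
      ((degeneracyData K).descend H.obj ((isBounded_iff _).1 H.property)).map_comp (P.map g) f
    let α (σ : SimplexCat K) (f : P.obj σ ⟶ x₀) (h : s.obj σ = 0) : G.obj.obj σ ⟶ A :=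
      quotBoundaryι ((isBounded_iff _).1 G.property) hx ((dimSplit_eq_zero_iff σ).1 h) f ≫ c
    have hα (σ : SimplexCat K) (f : σ ⟶ mk x) (h : s.obj σ = 0) :
        α σ (P.map f) h =
          boundaryι G.obj f (not_epi_of_dim_lt hx ((dimSplit_eq_zero_iff σ).1 h) f) ≫ c := rfl
    let u : F ⟶ U := ObjectProperty.homMk
      { app σ := corepLift fun f ↦ φ F σ f ≫ a₀
        naturality σ τ g := corep_hom_ext fun f ↦ by
          simp only [U, Category.assoc, corepLift_π, corep_map_π, corepLift_π_assoc, hφ']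
          exact congrArg _ (congrArg _ (Category.comp_id _).symm) }
    have hu (σ : SimplexCat K) (f : P.obj σ ⟶ x₀) : u.hom.app σ ≫ corepπ P Q f = φ F σ f ≫ a₀ :=
      corepLift_π _ _
    let v : G ⟶ V := ObjectProperty.homMk
      { app σ := corepLift fun f ↦ arrowLift p s σ (α σ f) (φ G σ f ≫ b₀)
        naturality σ τ g := corep_hom_ext fun f ↦ by
          obtain ⟨f, rfl⟩ := (degeneracyData K).toQuot.map_surjective f
          change (_ ≫ _) ≫ corepπ P _ (P.map f) = (_ ≫ _) ≫ corepπ P _ (P.map f)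
          simp only [V, Category.assoc, corepLift_π, corep_map_π, corepLift_π_assoc, hφ,
            comp_arrowLift, ← P.map_comp, G.obj.map_comp]
          refine (arrowLift_map p s g _ _ (fun h ↦ ?_) _ (fun h h' ↦ ?_)).symm
          · rw [hα _ _ h, Category.assoc, hc, ← Category.assoc, boundaryι_boundaryToObj,
              G.obj.map_comp, Category.assoc]
          · rw [hα _ _ h, hα _ _ h', ← Category.assoc, map_boundaryι] }
    have hv (σ : SimplexCat K) (f : P.obj σ ⟶ x₀) : v.hom.app σ ≫ corepπ P _ f =
        arrowLift p s σ (α σ f) (φ G σ f ≫ b₀) := corepLift_π _ _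
    have sq' : CommSq u Ψ q v := ⟨by
      ext σ
      refine corep_hom_ext fun f ↦ ?_
      obtain ⟨f, rfl⟩ := (degeneracyData K).toQuot.map_surjective f
      change (u.hom.app σ ≫ q.hom.app σ) ≫ corepπ P _ (P.map f) =
        (Ψ.hom.app σ ≫ v.hom.app σ) ≫ corepπ P _ (P.map f)
      rw [Category.assoc, Category.assoc, hq, hv, ← Category.assoc, hu, hφ, hφ, comp_arrowLift,
        comp_arrowLift]
      congr 1
      · ext h
        have hf := not_epi_of_dim_lt hx ((dimSplit_eq_zero_iff σ).1 h) f
        have h' : Ψ.hom.app σ ≫ boundaryι G.obj f hf ≫ c = F.obj.map f ≫ a₀ := by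
          rw [← Category.assoc, ← boundaryι_boundaryMap, Category.assoc, ← ha₀,
            ← Category.assoc, boundaryι_boundaryToObj]
        exact (Category.comp_id _).trans h'.symm
      · rw [Category.assoc, hb₀, ← Category.assoc, Ψ.hom.naturality, Category.assoc]⟩
    have := hΨ q fun σ ↦ corepLift_mem R _ (arrowLift_id_mem p s R hp σ)
    let ℓ := sq'.lift
    -- As in the Yoneda lemma, the component at the identity of `x` determines the whole lift
    -- (`hℓ`).
    let d : G.obj.obj (mk x) ⟶ A := ℓ.hom.app (mk x) ≫ corepπ P Q (𝟙 x₀)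
    have hl : Ψ.hom ≫ ℓ.hom = u.hom := congrArg InducedCategory.Hom.hom sq'.fac_left
    have hr : ℓ.hom ≫ q.hom = v.hom := congrArg InducedCategory.Hom.hom sq'.fac_right
    have hℓ (σ : SimplexCat K) (f : σ ⟶ mk x) :
        G.obj.map f ≫ d = ℓ.hom.app σ ≫ corepπ P Q (P.map f) := by
      have h : U.obj.map f ≫ corepπ P Q (𝟙 x₀) = corepπ P Q (P.map f) :=
        (corep_map_π P Q f (𝟙 x₀)).trans (by rw [Category.comp_id]; exact Category.comp_id _)
      rw [← h, ← Category.assoc, ℓ.hom.naturality, Category.assoc]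
    have hℓ' (σ : SimplexCat K) (f : σ ⟶ mk x) :
        arrowLift p s σ (fun _ ↦ G.obj.map f ≫ d) (G.obj.map f ≫ d ≫ p) =
          arrowLift p s σ (α σ (P.map f)) (G.obj.map f ≫ b₀) := by
      have h := hv σ (P.map f)
      rw [← hr, NatTrans.comp_app, Category.assoc, hq, ← Category.assoc, ← hℓ,
        comp_arrowLift, hφ] at h
      rw [← h]
      congr 1
      · ext
        exact (Category.comp_id _).symm
      · exact (Category.assoc _ _ _).symm
    have h₁ : Ψ.hom.app (mk x) ≫ d = a₀ := by
      have h := hu (mk x) (P.map (𝟙 _))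
      rw [hφ, F.obj.map_id, Category.id_comp, P.map_id, ← hl, NatTrans.comp_app,
        Category.assoc] at h
      exact h
    have h₂ : boundaryToObj G.obj x ≫ d = c := boundary_hom_ext fun σ f hf ↦ by
      rw [← Category.assoc, boundaryι_boundaryToObj]
      have hσ : σ.dim < n := dim_lt_of_not_epi f hf
      exact left_eq_of_arrowLift_eq p s (hℓ' σ f) ((dimSplit_eq_zero_iff σ).2 hσ)
    have h₃ : d ≫ p = b₀ := by
      -- As `x` is non-degenerate its dimension is exactly `n`, so `V` has factors `B` there.
      have h := right_eq_of_arrowLift_eq p s (hℓ' (mk x) (𝟙 _)) (by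
        have : ¬ s.obj (mk x) = 0 := fun h ↦ ((dimSplit_eq_zero_iff (mk x)).1 h).ne
          (dim_eq_of_isNonDegenerate (ρ := mk x) hx)
        omega)
      simpa using h
    refine ⟨⟨{ l := d
               fac_left := relativeLatching.hom_ext ?_ ?_
               fac_right := h₃ }⟩⟩
    · rw [← Category.assoc, relativeLatching.inl_map, h₁, ha]
    · rw [← Category.assoc, relativeLatching.inr_map, h₂, hc']

end Latching

/-! ## The model structure on bounded diagrams -/

section BoundedModelCategory

attribute [local instance] objectwiseFibrations objectwiseWeakEquivalences
  projectiveCofibrations'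

variable {K : SSet.{w}} {M : Type uM} [Category.{vM} M] [ModelCategory M]
  [HasColimitsOfSize.{w, w} M] [HasLimitsOfSize.{w, w} M]

/-- The cofibrations of bounded diagrams have the left lifting property with respect to
objectwise trivial fibrations, and are characterized by it. -/
lemma latchingCofibrations_eq_llp :
    BoundedDiagram.latchingCofibrations =
      (objectwise (IsBounded K M) (trivialFibrations M)).llp := by
  ext F G Ψ
  constructor
  · intro h X Y p hp
    refine ⟨fun {u v} sq ↦ ?_⟩
    obtain ⟨ℓ, h₁, h₂⟩ := PartialLift.exists_lift_of_relativeLatching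
      (Ψ := Ψ.hom) (p := p.hom) (u := u.hom) (v := v.hom) (congrArg InducedCategory.Hom.hom sq.w)
      ((isBounded_iff _).1 X.property) ((isBounded_iff _).1 Y.property)
      fun n x hx ↦ by
        have := h n x hx
        rw [← trivialFibrations_llp] at this
        exact this _ (hp _)
    exact ⟨⟨⟨ObjectProperty.homMk ℓ, InducedCategory.hom_ext h₁, InducedCategory.hom_ext h₂⟩⟩⟩
  · intro h n x hx
    rw [← trivialFibrations_llp]
    intro A B p hp
    exact hasLiftingProperty_relativeLatchingMap hx (trivialFibrations M) h p hp

/-- The projective model structure on bounded diagrams. -/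
abbrev boundedModelCategory (K : SSet.{w}) (M : Type uM) [Category.{vM} M] [ModelCategory M]
    [HasColimitsOfSize.{w, w} M] [HasLimitsOfSize.{w, w} M] :
    ModelCategory (BoundedDiagram K M) :=
  (SimplexCat.degeneracyData K).modelCategory isBounded_iff

lemma boundedModelCategory_spec :
    letI := boundedModelCategory K M
    weakEquivalences (BoundedDiagram K M) = BoundedDiagram.objectwise (weakEquivalences M) ∧
      fibrations (BoundedDiagram K M) = BoundedDiagram.objectwise (fibrations M) ∧
      cofibrations (BoundedDiagram K M) = BoundedDiagram.latchingCofibrations :=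
  ⟨rfl, rfl, latchingCofibrations_eq_llp.symm⟩

end BoundedModelCategory

/-! ## Contractions -/

section Contraction

/-- Weak equivalences are saturated. -/
lemma weakEquivalence_of_isIso_map {M : Type uM} [Category.{vM} M] [ModelCategory M]
    {H : Type uH} [Category.{vH} H] (L : M ⥤ H) [L.IsLocalization (weakEquivalences M)]
    {X Y : M} (f : X ⟶ Y) [IsIso (L.map f)] : WeakEquivalence f := by
  obtain ⟨Q⟩ := CofibrantReplacement.nonempty M
  have h (Z : M) : IsIso (L.map (Q.π Z)) :=
    Localization.inverts L (weakEquivalences M) _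
      ((weakEquivalence_iff _).1 (Q.weakEquivalence Z))
  have hX := h X
  have hY := h Y
  have : IsIso (L.map (Q.map f)) :=
    IsIso.of_isIso_fac_right (h := L.map (Q.π X) ≫ L.map f)
      (by rw [← L.map_comp, ← L.map_comp, Q.map_π])
  have := Q.isCofibrant X
  have := Q.isCofibrant Y
  have := weakEquivalence_of_isIso_map_of_isCofibrant L (Q.map f)
  have := Q.weakEquivalence X
  have := Q.weakEquivalence Y
  exact weakEquivalence_of_precomp_of_fac (Q.map_π f).symm

/-- A natural transformation from a functor preserving weak equivalences to a left Quillen functor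
is a weak equivalence at a cofibrant object with a contraction. -/
lemma weakEquivalence_app_of_contraction {N : Type uD} [Category.{vD} N] [ModelCategory N]
    {M : Type uM} [Category.{vM} M] [ModelCategory M]
    {H : Type uH} [Category.{vH} H] (L : M ⥤ H) [L.IsLocalization (weakEquivalences M)]
    {ev c : N ⥤ M} (ι : ev ⟶ c)
    (hev : ∀ ⦃X Y : N⦄ (f : X ⟶ Y), WeakEquivalence f → WeakEquivalence (ev.map f))
    (hc : ∀ ⦃X Y : N⦄ (f : X ⟶ Y), IsCofibrant X → IsCofibrant Y → WeakEquivalence f →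
      WeakEquivalence (c.map f))
    {F S T : N} (hF : IsCofibrant F) (η : F ⟶ T) (μ : S ⟶ T) (hμ : WeakEquivalence μ)
    (d : c.obj S ⟶ ev.obj F) [IsIso (ι.app S ≫ d)]
    (h : L.map (ev.map μ) = L.map (ι.app S ≫ d) ≫ L.map (ev.map η))
    (ν : c.obj T ⟶ c.obj F) (hην : c.map η ≫ ν = 𝟙 _) (hμν : c.map μ ≫ ν = d ≫ ι.app F) :
    WeakEquivalence (ι.app F) := by
  obtain ⟨Q⟩ := CofibrantReplacement.nonempty N
  have hL {X Y : M} (f : X ⟶ Y) (hf : WeakEquivalence f) : IsIso (L.map f) :=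
    Localization.inverts L (weakEquivalences M) _ ((weakEquivalence_iff f).1 hf)
  have hπ (A : N) : IsIso (L.map (ev.map (Q.π A))) := hL _ (hev _ (Q.weakEquivalence A))
  have hQμ : IsIso (L.map (c.map (Q.map μ))) :=
    hL _ (hc _ (Q.isCofibrant _) (Q.isCofibrant _) (Q.weakEquivalence_map μ))
  have hα : IsIso (L.map (c.map (Q.π F))) :=
    hL _ (hc _ (Q.isCofibrant _) hF (Q.weakEquivalence F))
  have hevμ : IsIso (L.map (ev.map μ)) := hL _ (hev _ hμ)
  -- `s A` is the comparison with the left derived functor of `c`. It is needed because `S` and `T`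
  -- are not assumed cofibrant, so that `c.map μ` need not be a weak equivalence.
  obtain ⟨s, hs⟩ : ∃ s : ∀ A, L.obj (ev.obj A) ⟶ L.obj (c.obj (Q.obj A)),
      ∀ A, s A = inv (L.map (ev.map (Q.π A))) ≫ L.map (ι.app (Q.obj A)) := ⟨_, fun _ ↦ rfl⟩
  have sα (A : N) : s A ≫ L.map (c.map (Q.π A)) = L.map (ι.app A) := by
    rw [hs, Category.assoc, ← L.map_comp, ← ι.naturality, L.map_comp, IsIso.inv_hom_id_assoc]
  have s_nat {A B : N} (f : A ⟶ B) :
      L.map (ev.map f) ≫ s B = s A ≫ L.map (c.map (Q.map f)) := by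
    rw [← cancel_epi (L.map (ev.map (Q.π A))), hs, hs, Category.assoc, IsIso.hom_inv_id_assoc,
      ← L.map_comp, ← ι.naturality, ← L.map_comp_assoc, ← ev.map_comp, ← Q.map_π, ev.map_comp,
      L.map_comp, Category.assoc, IsIso.hom_inv_id_assoc, L.map_comp]
  have α_nat {A B : N} (f : A ⟶ B) :
      L.map (c.map (Q.map f)) ≫ L.map (c.map (Q.π B)) =
        L.map (c.map (Q.π A)) ≫ L.map (c.map f) := by
    simp only [← L.map_comp, ← c.map_comp, Q.map_π]
  -- The candidate inverse: along `η` to `T`, back along the weak equivalence `μ` to `S`, then by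
  -- `d`.
  obtain ⟨e, he⟩ : ∃ e, e = L.map (c.map (Q.map η)) ≫ inv (L.map (c.map (Q.map μ))) ≫
    L.map (c.map (Q.π S)) ≫ L.map d := ⟨_, rfl⟩
  have h₁ : s F ≫ e = 𝟙 _ := by
    have h₂ : s T ≫ inv (L.map (c.map (Q.map μ))) = inv (L.map (ev.map μ)) ≫ s S := by
      rw [IsIso.comp_inv_eq, Category.assoc, ← s_nat, IsIso.inv_hom_id_assoc]
    rw [he, ← Category.assoc, ← s_nat, Category.assoc, reassoc_of% h₂, reassoc_of% (sα S),
      ← L.map_comp, ← cancel_epi (L.map (ι.app S ≫ d)), ← reassoc_of% h, IsIso.hom_inv_id_assoc,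
      Category.comp_id]
  have h₂ : e ≫ L.map (ι.app F) = L.map (c.map (Q.π F)) := by
    rw [he]
    simp only [Category.assoc]
    rw [← L.map_comp, ← hμν, L.map_comp, ← reassoc_of% (α_nat μ), IsIso.inv_hom_id_assoc,
      reassoc_of% (α_nat η), ← L.map_comp, hην, L.map_id, Category.comp_id]
  have : IsIso (L.map (ι.app F)) := by
    refine ⟨inv (L.map (c.map (Q.π F))) ≫ e, ?_, ?_⟩
    · rw [← sα, Category.assoc, IsIso.hom_inv_id_assoc, h₁]
    · rw [Category.assoc, h₂, IsIso.inv_hom_id]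
  exact weakEquivalence_of_isIso_map L _

attribute [local instance] objectwiseFibrations objectwiseWeakEquivalences
  projectiveCofibrations'

namespace DegeneracyData

variable {E : Type w} [Category.{0} E] (δ : DegeneracyData E)
  {M : Type uM} [Category.{vM} M] {P : ObjectProperty (E ⥤ M)}
  (hP : ∀ F, P F ↔ δ.degeneracies.IsInvertedBy F)

include hP in
lemma const_mem (X : M) : P ((Functor.const E).obj X) :=
  (hP _).2 fun _ _ _ _ ↦ inferInstanceAs (IsIso (𝟙 X))

variable [HasColimitsOfShape E M]

/-- The colimit functor on a category of bounded diagrams is left adjoint to the constant diagram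
functor. -/
def colimAdjunction : P.ι ⋙ colim ⊣ P.lift (Functor.const E) (δ.const_mem hP) :=
  (colimConstAdj (J := E) (C := M)).restrictFullyFaithful (iC := P.ι)
    (iD := 𝟭 _) P.fullyFaithfulι (.id _) (Iso.refl _) (Iso.refl _)

variable [ModelCategory M] [HasColimitsOfSize.{w, w} M] [HasLimitsOfSize.{w, w} M]

/-- The inclusion of `G t` in the colimit of a cofibrant bounded diagram `G` is a weak equivalence
if the index category can be contracted to `t` by a zigzag that `G` maps to weak equivalences. -/
lemma weakEquivalence_colimitι {H : Type uH} [Category.{vH} H] (L : M ⥤ H)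
    [L.IsLocalization (weakEquivalences M)]
    (G : P.FullSubcategory)
    (hG : letI := δ.modelCategory (M := M) hP; IsCofibrant G) (T : E ⥤ E)
    (hT : ∀ ⦃σ τ : E⦄ (e : σ ⟶ τ), δ.degeneracies e → δ.degeneracies (T.map e))
    (t : E) (a : 𝟭 E ⟶ T) (b : (Functor.const E).obj t ⟶ T)
    (hb : ∀ x, WeakEquivalence (G.obj.map (b.app x)))
    (hab : L.map (G.obj.map (a.app t)) = L.map (G.obj.map (b.app t))) :
    WeakEquivalence (colimit.ι G.obj t) := by
  let := δ.modelCategory (M := M) hP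
  let ev : P.FullSubcategory ⥤ M := P.ι ⋙ (evaluation E M).obj t
  let c : P.FullSubcategory ⥤ M := P.ι ⋙ colim
  let ι : ev ⟶ c :=
    { app F := colimit.ι F.obj t
      naturality F F' f := (ι_colimMap f.hom t).symm }
  -- The contraction gives a zigzag `G ⟶ TG ⟵ SG` with `SG` constant. The colimits return to `G` by
  -- `colimit.pre` and by collapsing the constant diagram.
  let TG : P.FullSubcategory := ⟨T ⋙ G.obj, (hP _).2 fun _ _ e he ↦
    (hP _).1 G.property _ (hT e he)⟩
  let SG : P.FullSubcategory := ⟨(Functor.const E).obj (G.obj.obj t), δ.const_mem hP _⟩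
  let η : G ⟶ TG := ObjectProperty.homMk (Functor.whiskerRight a G.obj)
  let μ : SG ⟶ TG := ObjectProperty.homMk
    { app x := G.obj.map (b.app x)
      naturality x y f := by
        have := b.naturality f
        change 𝟙 _ ≫ _ = _ ≫ G.obj.map (T.map f)
        rw [← G.obj.map_comp, ← this]
        simp }
  let d : colimit ((Functor.const E).obj (G.obj.obj t)) ⟶ G.obj.obj t :=
    colimit.desc _ (Cocone.mk _ (𝟙 _))
  have hd (x : E) : colimit.ι _ x ≫ d = 𝟙 _ := colimit.ι_desc _ _
  have : IsIso (ι.app SG ≫ d) := by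
    change IsIso (colimit.ι _ t ≫ d)
    rw [hd]
    infer_instance
  refine weakEquivalence_app_of_contraction L ι (fun X Y f hf ↦ ?_) ?_ hG η μ ?_ d ?_
    (colimit.pre G.obj T) ?_ ?_
  · exact (weakEquivalence_iff _).2 ((weakEquivalence_iff f).1 hf t)
  · exact weakEquivalence_map_of_adjunction (δ.colimAdjunction hP) fun X Y p hp ↦
      (fibration_iff _).2 fun _ ↦ (fibration_iff _).1 hp
  · exact (weakEquivalence_iff μ).2 fun x ↦ (weakEquivalence_iff _).1 (hb x)
  · refine hab.symm.trans ?_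
    have h : ι.app SG ≫ d = 𝟙 _ := hd t
    rw [h]
    exact ((congrArg (· ≫ _) (L.map_id _)).trans (Category.id_comp _)).symm
  · refine colimit.hom_ext fun x ↦ ?_
    have h : colimit.ι G.obj x ≫ colimMap (Functor.whiskerRight a G.obj) ≫ colimit.pre G.obj T =
        colimit.ι G.obj x ≫ 𝟙 _ := by
      rw [ι_colimMap_assoc, colimit.ι_pre]
      simp
    exact h
  · refine colimit.hom_ext fun x ↦ ?_
    have h : colimit.ι SG.obj x ≫ colimMap μ.hom ≫ colimit.pre G.obj T =
        colimit.ι SG.obj x ≫ d ≫ colimit.ι G.obj t := by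
      rw [ι_colimMap_assoc, reassoc_of% (hd x)]
      exact (congrArg (_ ≫ ·) (colimit.ι_pre _ _ _)).trans (colimit.w G.obj (b.app x))
    exact h

end DegeneracyData

end Contraction

/-! ## Restriction along comma categories -/

lemma isCofibrant_iff_exists_lift {N : Type uD} [Category.{vD} N] [ModelCategory N] (X : N) :
    IsCofibrant X ↔ ∀ ⦃A B : N⦄ (p : A ⟶ B), trivialFibrations N p → ∀ v : X ⟶ B,
      ∃ ℓ : X ⟶ A, ℓ ≫ p = v := by
  rw [isCofibrant_iff, cofibration_iff, ← trivialFibrations_llp]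
  constructor
  · intro h A B p hp v
    have := h p hp
    have sq : CommSq (initial.to A) (initial.to X) p v := ⟨by simp⟩
    exact ⟨sq.lift, sq.fac_right⟩
  · intro h A B p hp
    refine ⟨fun {u v} sq ↦ ?_⟩
    obtain ⟨ℓ, hℓ⟩ := h p hp v
    exact ⟨⟨⟨ℓ, by ext, hℓ⟩⟩⟩

section Comma

variable {K : Type w} [Category.{0} K] {I : Type w} [SmallCategory.{w} I] (ε : K ⥤ I) (i : I)

namespace DegeneracyData

variable {ε} in
/-- The degeneracies in a comma category. -/
def comma (δ : DegeneracyData K) (hε : δ.degeneracies.IsInvertedBy ε) (i : I) :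
    DegeneracyData (CostructuredArrow ε i) where
  degeneracies := δ.degeneracies.inverseImage (CostructuredArrow.proj ε i)
  dim X := δ.dim X.left
  dim_le f := δ.dim_le f.left
  exists_degeneracy {X Y} f g h := by
    obtain ⟨ρ, e, he, he', h⟩ := δ.exists_degeneracy f.left g.left h
    have := hε e he
    exact ⟨.mk (inv (ε.map e) ≫ Y.hom), CostructuredArrow.homMk e (by simp), he, he',
      CostructuredArrow.hom_ext _ _ h⟩
  exists_section {X Y} e he := by
    obtain ⟨s, hs⟩ := δ.exists_section e.left he
    refine ⟨CostructuredArrow.homMk s ?_, CostructuredArrow.hom_ext _ _ hs⟩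
    rw [← CostructuredArrow.w e, ← Category.assoc, ← ε.map_comp, hs, ε.map_id, Category.id_comp]

end DegeneracyData

variable {ε i} {M : Type uM} [Category.{vM} M]

/-- The morphism `(σ, ε f ≫ u) ⟶ (τ, u)` given by `f : σ ⟶ τ`. -/
abbrev commaHom {σ τ : K} (f : σ ⟶ τ) (u : ε.obj τ ⟶ i) :
    CostructuredArrow.mk (ε.map f ≫ u) ⟶ CostructuredArrow.mk u :=
  CostructuredArrow.homMk f rfl

lemma comp_map_costructuredArrow {G : CostructuredArrow ε i ⥤ M} {σ : K}
    {T : M} {Y : CostructuredArrow ε i} (π : ∀ u : ε.obj σ ⟶ i, T ⟶ G.obj (.mk u))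
    {u u' : ε.obj σ ⟶ i} (h : u = u')
    (g : CostructuredArrow.mk u ⟶ Y) (g' : CostructuredArrow.mk u' ⟶ Y) (hg : g.left = g'.left) :
    π u ≫ G.map g = π u' ≫ G.map g' := by
  subst h
  rw [CostructuredArrow.hom_ext _ _ hg]

variable [HasLimitsOfSize.{w, w} M]

instance hasProductsOfShape_hom (X Y : I) : HasProductsOfShape (X ⟶ Y) M :=
  inferInstanceAs (HasLimitsOfShape (Discrete (X ⟶ Y)) M)

variable (G : CostructuredArrow ε i ⥤ M)

/-- The right Kan extension along the projection from a comma category. -/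
def commaPi : K ⥤ M where
  obj σ := ∏ᶜ fun u : ε.obj σ ⟶ i ↦ G.obj (.mk u)
  map {σ τ} f := Pi.lift fun u ↦ Pi.π _ (ε.map f ≫ u) ≫ G.map (commaHom f u)
  map_id σ := by
    refine Pi.hom_ext _ _ fun u ↦ (Pi.lift_π _ _).trans ?_
    refine (comp_map_costructuredArrow (fun u ↦ Pi.π (fun u ↦ G.obj (.mk u)) u)
      (u := ε.map (𝟙 σ) ≫ u) (u' := u) (by simp) (commaHom (𝟙 σ) u) (𝟙 _) rfl).trans ?_
    simp
  map_comp {σ τ ρ} f g := by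
    refine Pi.hom_ext _ _ fun u ↦ (Pi.lift_π _ _).trans ?_
    rw [Category.assoc, Pi.lift_π, Pi.lift_π_assoc, Category.assoc, ← G.map_comp]
    exact comp_map_costructuredArrow (fun u ↦ Pi.π (fun u ↦ G.obj (.mk u)) u) (by simp) _ _ rfl

variable {G}

/-- The projections. -/
def commaPiπ {σ : K} (u : ε.obj σ ⟶ i) : (commaPi G).obj σ ⟶ G.obj (.mk u) :=
  Pi.π (fun u : ε.obj σ ⟶ i ↦ G.obj (.mk u)) u

lemma commaPi_hom_ext {T : M} {σ : K} {u v : T ⟶ (commaPi G).obj σ}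
    (h : ∀ f : ε.obj σ ⟶ i, u ≫ commaPiπ f = v ≫ commaPiπ f) : u = v :=
  Pi.hom_ext _ _ h

/-- The morphism to `(commaPi G).obj σ` given by its components. -/
def commaPiLift {T : M} {σ : K} (v : ∀ u : ε.obj σ ⟶ i, T ⟶ G.obj (.mk u)) :
    T ⟶ (commaPi G).obj σ := Pi.lift v

@[simp]
lemma commaPiLift_π {T : M} {σ : K} (v : ∀ u : ε.obj σ ⟶ i, T ⟶ G.obj (.mk u))
    (u : ε.obj σ ⟶ i) : commaPiLift v ≫ commaPiπ u = v u := Pi.lift_π _ _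

@[simp]
lemma commaPiLift_π_assoc {T : M} {σ : K} (v : ∀ u : ε.obj σ ⟶ i, T ⟶ G.obj (.mk u))
    (u : ε.obj σ ⟶ i) {Z : M} (h : G.obj (.mk u) ⟶ Z) :
    commaPiLift v ≫ commaPiπ u ≫ h = v u ≫ h := Pi.lift_π_assoc _ _ _

@[simp]
lemma commaPi_map_π {σ τ : K} (f : σ ⟶ τ) (u : ε.obj τ ⟶ i) :
    (commaPi G).map f ≫ commaPiπ u =
      commaPiπ (ε.map f ≫ u) ≫ G.map (commaHom f u) :=
  Pi.lift_π _ _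

/-- The transpose of a natural transformation `F ∘ proj ⟶ G`. -/
def toCommaPi {F : K ⥤ M} (v : ∀ {σ : K} (u : ε.obj σ ⟶ i), F.obj σ ⟶ G.obj (.mk u))
    (hv : ∀ {σ τ : K} (f : σ ⟶ τ) (u : ε.obj τ ⟶ i),
      F.map f ≫ v u = v (ε.map f ≫ u) ≫ G.map (commaHom f u)) :
    F ⟶ commaPi G where
  app σ := commaPiLift fun u ↦ v u
  naturality σ τ f := commaPi_hom_ext fun u ↦ by simp [hv]

lemma naturality_commaPiπ {F : K ⥤ M} (w : F ⟶ commaPi G) {σ τ : K} (f : σ ⟶ τ)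
    (u : ε.obj τ ⟶ i) (u' : ε.obj σ ⟶ i) (hu : ε.map f ≫ u = u')
    (g : CostructuredArrow.mk u' ⟶ CostructuredArrow.mk u) (hg : g.left = f) :
    F.map f ≫ w.app τ ≫ commaPiπ u = (w.app σ ≫ commaPiπ u') ≫ G.map g := by
  rw [w.naturality_assoc, commaPi_map_π, Category.assoc]
  congr 1
  exact comp_map_costructuredArrow commaPiπ hu _ _ hg.symm

/-- The transpose of a natural transformation `F ⟶ commaPi G`. -/
def ofCommaPi {F : K ⥤ M} (w : F ⟶ commaPi G) : CostructuredArrow.proj ε i ⋙ F ⟶ G where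
  app X := w.app X.left ≫ commaPiπ X.hom
  naturality X Y f := naturality_commaPiπ w f.left Y.hom X.hom (CostructuredArrow.w f) f rfl

/-- As `ε.map f` is invertible, composing with it permutes the factors; on factors the map is `G` of
the morphisms over `f`. -/
lemma isIso_commaPi_map {σ τ : K} (f : σ ⟶ τ) [IsIso (ε.map f)]
    (h : ∀ {X Y : CostructuredArrow ε i} (g : X ⟶ Y) (h₁ : X.left = σ) (h₂ : Y.left = τ),
      g.left = eqToHom h₁ ≫ f ≫ eqToHom h₂.symm → IsIso (G.map g)) :
    IsIso ((commaPi G).map f) := by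
  obtain ⟨g, hg⟩ : ∃ g : ∀ u : ε.obj σ ⟶ i,
      CostructuredArrow.mk u ⟶ CostructuredArrow.mk (inv (ε.map f) ≫ u), ∀ u, (g u).left = f :=
    ⟨fun u ↦ CostructuredArrow.homMk f (by simp), fun _ ↦ rfl⟩
  have hg' (u : ε.obj σ ⟶ i) : IsIso (G.map (g u)) := h (g u) rfl rfl (by simp [hg])
  have h₁ : (commaPi G).map f ≫
      (commaPiLift fun u ↦ commaPiπ (inv (ε.map f) ≫ u) ≫ inv (G.map (g u))) = 𝟙 _ := by
    refine commaPi_hom_ext fun u ↦ ?_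
    rw [Category.assoc, commaPiLift_π, Category.id_comp, ← Category.assoc, IsIso.comp_inv_eq,
      commaPi_map_π]
    exact comp_map_costructuredArrow commaPiπ (by simp) _ _ (hg u).symm
  have : Mono ((commaPi G).map f) := mono_of_mono_fac h₁
  -- Since the candidate inverse is mono, the second identity follows from `h₁`, without comparing
  -- transported components.
  have : Mono (commaPiLift fun u ↦ commaPiπ (inv (ε.map f) ≫ u) ≫ inv (G.map (g u)) :
      (commaPi G).obj τ ⟶ (commaPi G).obj σ) := by
    refine ⟨fun {Z} a b hab ↦ commaPi_hom_ext fun u ↦ ?_⟩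
    obtain ⟨u, rfl⟩ : ∃ u', u = inv (ε.map f) ≫ u' := ⟨ε.map f ≫ u, by simp⟩
    have h₂ := hab =≫ commaPiπ u
    rwa [Category.assoc, Category.assoc, commaPiLift_π, ← Category.assoc, ← Category.assoc,
      cancel_mono] at h₂
  refine ⟨_, h₁, ?_⟩
  refine (cancel_mono (commaPiLift fun u ↦ commaPiπ (inv (ε.map f) ≫ u) ≫
    inv (G.map (g u)))).1 ?_
  rw [Category.assoc, h₁, Category.comp_id, Category.id_comp]

/-- The map induced by a morphism of diagrams. -/
def commaPiMap {G' : CostructuredArrow ε i ⥤ M} (p : G ⟶ G') : commaPi G ⟶ commaPi G' where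
  app σ := commaPiLift fun u ↦ commaPiπ u ≫ p.app (.mk u)
  naturality σ τ f := commaPi_hom_ext fun u ↦ by
    simp only [Category.assoc, commaPiLift_π, commaPi_map_π, commaPiLift_π_assoc]
    rw [← Category.assoc, commaPi_map_π, Category.assoc, p.naturality]

lemma commaPiMap_app_π {G' : CostructuredArrow ε i ⥤ M} (p : G ⟶ G') {σ : K}
    (u : ε.obj σ ⟶ i) : (commaPiMap p).app σ ≫ commaPiπ u = commaPiπ u ≫ p.app (.mk u) :=
  commaPiLift_π _ _

lemma commaPiMap_app_mem {G' : CostructuredArrow ε i ⥤ M} (p : G ⟶ G') (R : MorphismProperty M)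
    [∀ J : Type w, R.IsStableUnderProductsOfShape J] (hp : R.functorCategory _ p) (σ : K) :
    R ((commaPiMap p).app σ) :=
  piLift_mem R (fun u ↦ p.app (.mk u)) fun _ ↦ hp _

namespace DegeneracyData

attribute [local instance] objectwiseFibrations objectwiseWeakEquivalences
  projectiveCofibrations'

variable (δ : DegeneracyData K) (hε : δ.degeneracies.IsInvertedBy ε) (i)
  {P : ObjectProperty (K ⥤ M)} (hP : ∀ F, P F ↔ δ.degeneracies.IsInvertedBy F)

variable (M) in
/-- The bounded diagrams on a comma category. -/
abbrev commaBounded : ObjectProperty (CostructuredArrow ε i ⥤ M) :=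
  fun F ↦ (δ.comma hε i).degeneracies.IsInvertedBy F

include hP in
lemma commaPi_mem (hG : δ.commaBounded i M hε G) : P (commaPi G) := by
  refine (hP _).2 fun σ τ f hf ↦ ?_
  have := hε f hf
  refine isIso_commaPi_map f fun {X Y} g h₁ h₂ h ↦ hG g ?_
  change δ.degeneracies g.left
  subst h₁ h₂
  simpa [h] using hf

variable [ModelCategory M] [HasColimitsOfSize.{w, w} M]

/-- Restriction to the comma category has the right adjoint `commaPi`, which preserves boundedness
and, consisting of products, objectwise trivial fibrations. Hence lifts transpose. -/
lemma isCofibrant_comma (F : P.FullSubcategory)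
    (hF : letI := δ.modelCategory (M := M) hP; IsCofibrant F) :
    letI := (δ.comma hε i).modelCategory (M := M) (P := δ.commaBounded i M hε) fun _ ↦ Iff.rfl
    IsCofibrant (⟨CostructuredArrow.proj ε i ⋙ F.obj,
      fun _ _ _ he ↦ (hP _).1 F.property _ he⟩ : (δ.commaBounded i M hε).FullSubcategory) := by
  let := δ.modelCategory (M := M) hP
  let := (δ.comma hε i).modelCategory (M := M) (P := δ.commaBounded i M hε) fun _ ↦ Iff.rfl
  rw [isCofibrant_iff_exists_lift] at hF ⊢
  intro A B p hp v
  have hp' : (trivialFibrations M).functorCategory _ p.hom := fun X ↦ ⟨hp.1 X, hp.2 X⟩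
  let p' : (⟨commaPi A.obj, δ.commaPi_mem i hε hP A.property⟩ : P.FullSubcategory) ⟶
      ⟨commaPi B.obj, δ.commaPi_mem i hε hP B.property⟩ :=
    ObjectProperty.homMk (commaPiMap p.hom)
  have h := commaPiMap_app_mem p.hom _ hp'
  obtain ⟨ℓ, hℓ⟩ := hF p' ⟨fun σ ↦ (h σ).1, fun σ ↦ (h σ).2⟩
    (ObjectProperty.homMk (toCommaPi (fun u ↦ v.hom.app (.mk u))
      fun f u ↦ v.hom.naturality (commaHom f u)))
  refine ⟨ObjectProperty.homMk (ofCommaPi ℓ.hom), ?_⟩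
  ext X
  have h₂ := congrArg (fun f ↦ f.hom.app X.left ≫ commaPiπ X.hom) hℓ
  have h₃ : (ℓ.hom.app X.left ≫ (commaPiMap p.hom).app X.left) ≫ commaPiπ X.hom =
    v.hom.app X := h₂.trans (commaPiLift_π _ _)
  rw [Category.assoc, commaPiMap_app_π] at h₃
  exact (Category.assoc _ _ _).trans h₃

end DegeneracyData

end Comma

/-! ## Left Kan extensions of cofibrant bounded diagrams -/

section KanExtension

attribute [local instance] objectwiseFibrations objectwiseWeakEquivalences
  projectiveCofibrations'

variable {K : Type w} [Category.{0} K] {I : Type w} [SmallCategory.{w} I]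

/-- A contraction of the comma category of `ε` over `i` to one of its objects, by a zigzag of
natural transformations. -/
structure CommaContraction (δ : DegeneracyData K) (ε : K ⥤ I) (i : I) where
  functor : CostructuredArrow ε i ⥤ CostructuredArrow ε i
  map_degeneracy {X Y : CostructuredArrow ε i} (e : X ⟶ Y) (he : δ.degeneracies e.left) :
    δ.degeneracies (functor.map e).left
  base : CostructuredArrow ε i
  unit : 𝟭 _ ⟶ functor
  baseMap : (Functor.const _).obj base ⟶ functor
  isIso_hom (X : CostructuredArrow ε i) : IsIso (functor.obj X).hom
  isIso_base : IsIso base.hom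

variable {δ : DegeneracyData K} {ε : K ⥤ I} (hε : δ.degeneracies.IsInvertedBy ε)
  {M : Type uM} [Category.{vM} M] [ModelCategory M] [HasColimitsOfSize.{w, w} M]
  [HasLimitsOfSize.{w, w} M]
  {P : ObjectProperty (K ⥤ M)} (hP : ∀ F, P F ↔ δ.degeneracies.IsInvertedBy F)

include hε hP in
lemma CommaContraction.weakEquivalence_app {i : I} (κ : CommaContraction δ ε i)
    (F : P.FullSubcategory) (hF : letI := δ.modelCategory (M := M) hP; IsCofibrant F)
    {A H : I ⥤ M} (α : F.obj ⟶ ε ⋙ A)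
    (hA : (Functor.LeftExtension.mk A α).IsPointwiseLeftKanExtensionAt i) (β : A ⟶ H)
    (hβ : ∀ σ, WeakEquivalence (α.app σ ≫ β.app (ε.obj σ))) : WeakEquivalence (β.app i) := by
  have : HasColimitsOfShape (CostructuredArrow ε i) M :=
    have := hasColimitsOfSizeOfUnivLE.{w, w, 0, w} M
    inferInstance
  let L := (weakEquivalences M).Q
  have hL {X Y : M} (f : X ⟶ Y) (hf : WeakEquivalence f) : IsIso (L.map f) :=
    Localization.inverts L (weakEquivalences M) _ ((weakEquivalence_iff f).1 hf)
  have hθ {σ τ : K} (f : σ ⟶ τ) : F.obj.map f ≫ α.app τ ≫ β.app (ε.obj τ) =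
      (α.app σ ≫ β.app (ε.obj σ)) ≫ H.map (ε.map f) := by
    rw [α.naturality_assoc, Functor.comp_map, β.naturality, Category.assoc]
  have comp {X Y Z : M} {f : X ⟶ Y} {g : Y ⟶ Z} (hf : WeakEquivalence f)
      (hg : WeakEquivalence g) : WeakEquivalence (f ≫ g) := inferInstance
  have postcomp {X Y Z : M} {f : X ⟶ Y} {g : Y ⟶ Z} {fg : X ⟶ Z} (hg : WeakEquivalence g)
      (hfg : WeakEquivalence fg) (fac : f ≫ g = fg) : WeakEquivalence f :=
    weakEquivalence_of_postcomp_of_fac fac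
  have hI {X Y : M} (e : X ≅ Y) : WeakEquivalence e.hom := inferInstance
  have hH {x y : I} (f : x ⟶ y) [IsIso f] : WeakEquivalence (H.map f) := inferInstance
  have := κ.isIso_hom
  have := κ.isIso_base
  have h := (δ.comma hε i).weakEquivalence_colimitι (fun _ ↦ Iff.rfl) L _
    (δ.isCofibrant_comma i hε hP F hF) κ.functor (fun X Y e he ↦ κ.map_degeneracy e he) κ.base
    κ.unit κ.baseMap (fun X ↦ ?_) ?_
  -- By `h`, the value of `F` at the base is weakly equivalent to `A i`. It is also weakly
  -- equivalent to `H i`, so two out of three applies to `β.app i`.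
  · have h₁ : α.app κ.base.left ≫ A.map κ.base.hom =
        colimit.ι (CostructuredArrow.proj ε i ⋙ F.obj) κ.base ≫
          ((colimit.isColimit _).coconePointUniqueUpToIso hA).hom :=
      (IsColimit.comp_coconePointUniqueUpToIso_hom (colimit.isColimit _) hA κ.base).symm
    have h₂ : WeakEquivalence (α.app κ.base.left ≫ A.map κ.base.hom) := by
      rw [h₁]
      exact comp h (hI _)
    have h₃ : (α.app κ.base.left ≫ A.map κ.base.hom) ≫ β.app i =
        (α.app κ.base.left ≫ β.app (ε.obj κ.base.left)) ≫ H.map κ.base.hom := by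
      rw [Category.assoc, Category.assoc]
      exact congrArg (_ ≫ ·) (β.naturality κ.base.hom)
    have h₄ : WeakEquivalence ((α.app κ.base.left ≫ β.app (ε.obj κ.base.left)) ≫
        H.map κ.base.hom) := by
      exact comp (hβ _) (hH _)
    exact weakEquivalence_of_precomp_of_fac h₃
  -- `F` is weakly equivalent to `ε ⋙ H`, and `ε` sends `baseMap` to isomorphisms.
  · have h₁ : IsIso (ε.map (κ.baseMap.app X).left) :=
      by
      have := CostructuredArrow.w (κ.baseMap.app X)
      exact IsIso.of_isIso_fac_right (hh := κ.isIso_base) this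
    have h₂ := hH (ε.map (κ.baseMap.app X).left)
    have h₃ := hβ κ.base.left
    have h₄ := hβ (κ.functor.obj X).left
    have h₅ : WeakEquivalence ((α.app κ.base.left ≫ β.app (ε.obj κ.base.left)) ≫
      H.map (ε.map (κ.baseMap.app X).left)) := comp h₃ h₂
    exact postcomp h₄ h₅ (hθ (κ.baseMap.app X).left)
  -- The two morphisms have the same image under `ε`, both being morphisms over `i` to an object
  -- with invertible structure map; so `F` identifies them in the homotopy category.
  · have h₁ : ε.map (κ.unit.app κ.base).left = ε.map (κ.baseMap.app κ.base).left := by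
      rw [← cancel_mono (κ.functor.obj κ.base).hom]
      exact (CostructuredArrow.w (κ.unit.app κ.base)).trans
        (CostructuredArrow.w (κ.baseMap.app κ.base)).symm
    have h₂ := hL _ (hβ (κ.functor.obj κ.base).left)
    have h₃ := (hθ (κ.unit.app κ.base).left).trans ((congrArg (fun f ↦ _ ≫ H.map f) h₁).trans
      (hθ (κ.baseMap.app κ.base).left).symm)
    have h₄ := congrArg L.map h₃
    exact (cancel_mono (L.map (α.app (κ.functor.obj κ.base).left ≫ β.app _))).1
      ((L.map_comp _ _).symm.trans (h₄.trans (L.map_comp _ _)))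

end KanExtension

/-! ## Appending an object to a chain of morphisms -/

section Append

instance isThin_withTerminal {A : Type*} [Preorder A] : Quiver.IsThin (WithTerminal A) :=
  fun X Y ↦ ⟨fun f g ↦ by
    cases X with
    | of x =>
      cases Y with
      | of y => exact Subsingleton.elim (α := (x ⟶ y)) f g
      | star => exact Subsingleton.elim (α := PUnit) f g
    | star =>
      cases Y with
      | of y => exact (WithTerminal.false_of_from_star f).elim
      | star => exact Subsingleton.elim (α := PUnit) f g⟩

/-- An object of `Fin (n + 2)` as an object of `Fin (n + 1)` or a terminal object. -/
def splitLastObj (n : ℕ) (j : Fin (n + 2)) : WithTerminal (Fin (n + 1)) :=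
  if h : j.val < n + 1 then .of ⟨j, h⟩ else .star

lemma splitLastObj_of_lt {n : ℕ} {j : Fin (n + 2)} (h : j.val < n + 1) :
    splitLastObj n j = .of ⟨j, h⟩ := dif_pos h

lemma splitLastObj_of_not_lt {n : ℕ} {j : Fin (n + 2)} (h : ¬ j.val < n + 1) :
    splitLastObj n j = .star := dif_neg h

/-- `Fin (n + 2)` as `Fin (n + 1)` with a terminal object. -/
def splitLast (n : ℕ) : Fin (n + 2) ⥤ WithTerminal (Fin (n + 1)) where
  obj := splitLastObj n
  map {j k} f := Classical.choice (by
    by_cases hk : k.val < n + 1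
    · have hj : j.val < n + 1 := (show j.val ≤ k.val from leOfHom f).trans_lt hk
      rw [splitLastObj_of_lt hk, splitLastObj_of_lt hj]
      exact ⟨WithTerminal.incl.map (homOfLE (leOfHom f))⟩
    · rw [splitLastObj_of_not_lt hk]
      exact ⟨WithTerminal.starTerminal.from _⟩)
  map_id _ := Subsingleton.elim _ _
  map_comp _ _ := Subsingleton.elim _ _

lemma splitLast_obj_of_lt {n : ℕ} {j : Fin (n + 2)} (h : j.val < n + 1) :
    (splitLast n).obj j = .of ⟨j, h⟩ := dif_pos h

lemma splitLast_obj_of_not_lt {n : ℕ} {j : Fin (n + 2)} (h : ¬ j.val < n + 1) :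
    (splitLast n).obj j = .star := dif_neg h

/-- The monotone map `θ * 1`. -/
def succHom {m n : ℕ} (θ : Fin (m + 1) →o Fin (n + 1)) : Fin (m + 2) →o Fin (n + 2) where
  toFun j := if h : j.val < m + 1 then (θ ⟨j, h⟩).castSucc else Fin.last _
  monotone' j k hjk := by
    dsimp only
    by_cases hk : k.val < m + 1
    · have hj : j.val < m + 1 := lt_of_le_of_lt hjk hk
      rw [dif_pos hk, dif_pos hj]
      exact θ.monotone hjk
    · rw [dif_neg hk]
      exact Fin.le_last _

lemma succHom_of_lt {m n : ℕ} (θ : Fin (m + 1) →o Fin (n + 1)) {j : Fin (m + 2)}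
    (h : j.val < m + 1) : succHom θ j = (θ ⟨j, h⟩).castSucc := dif_pos h

lemma succHom_of_not_lt {m n : ℕ} (θ : Fin (m + 1) →o Fin (n + 1)) {j : Fin (m + 2)}
    (h : ¬ j.val < m + 1) : succHom θ j = Fin.last _ := dif_neg h

lemma succHom_castSucc {m n : ℕ} (θ : Fin (m + 1) →o Fin (n + 1)) (j : Fin (m + 1)) :
    succHom θ j.castSucc = (θ j).castSucc := dif_pos j.is_lt

lemma succHom_last {m n : ℕ} (θ : Fin (m + 1) →o Fin (n + 1)) :
    succHom θ (Fin.last _) = Fin.last _ := dif_neg (lt_irrefl _)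

lemma splitLast_comp_map {m n : ℕ} (θ : Fin (m + 1) →o Fin (n + 1)) :
    splitLast m ⋙ WithTerminal.map θ.monotone.functor =
      (succHom θ).monotone.functor ⋙ splitLast n := by
  refine CategoryTheory.Functor.ext (fun j ↦ ?_) fun _ _ _ ↦ Subsingleton.elim _ _
  change (WithTerminal.map θ.monotone.functor).obj ((splitLast m).obj j) =
    (splitLast n).obj (succHom θ j)
  by_cases hj : j.val < m + 1
  · rw [splitLast_obj_of_lt hj, succHom_of_lt θ hj]
    exact (splitLast_obj_of_lt (j := (θ ⟨j, hj⟩).castSucc) (θ ⟨j, hj⟩).is_lt).symm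
  · rw [splitLast_obj_of_not_lt hj, succHom_of_not_lt θ hj,
      splitLast_obj_of_not_lt (lt_irrefl _)]
    rfl

variable {I : Type w} [SmallCategory.{w} I] {i : I}

/-- The chain `c` of morphisms with an object `i` that receives a morphism from the last object
of `c`. -/
def terminalExtension {n : ℕ} (c : ComposableArrows I n) (u : c.obj (Fin.last n) ⟶ i) :
    WithTerminal (Fin (n + 1)) ⥤ I :=
  WithTerminal.lift c (fun j ↦ c.map (homOfLE (Fin.le_last j)) ≫ u) fun j k f ↦ by
    rw [← c.map_comp_assoc]
    rfl

/-- The chain `c` of morphisms with one more morphism `u`. -/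
def append {n : ℕ} (c : ComposableArrows I n) (u : c.obj (Fin.last n) ⟶ i) :
    ComposableArrows I (n + 1) :=
  splitLast n ⋙ terminalExtension c u

/-- The condition `hu` is exactly the commutativity over `i` of a morphism in the comma category, so
this makes appending functorial. -/
lemma append_comp {m n : ℕ} (θ : Fin (m + 1) →o Fin (n + 1)) (c : ComposableArrows I n)
    (u : c.obj (Fin.last n) ⟶ i) (c' : ComposableArrows I m) (u' : c'.obj (Fin.last m) ⟶ i)
    (hc : θ.monotone.functor ⋙ c = c')
    (hu : u' = eqToHom (by rw [← hc]; rfl) ≫ c.map (homOfLE (Fin.le_last (θ (Fin.last m)))) ≫ u) :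
    (succHom θ).monotone.functor ⋙ append c u = append c' u' := by
  subst hc
  have h : WithTerminal.map θ.monotone.functor ⋙ terminalExtension c u =
      terminalExtension (θ.monotone.functor ⋙ c) u' := by
    subst hu
    refine CategoryTheory.Functor.ext (fun x ↦ by cases x <;> rfl) fun x y f ↦ ?_
    cases x with
    | of x =>
      cases y with
      | of y => exact ((Category.id_comp _).trans (Category.comp_id _)).symm
      | star =>
        refine Eq.trans ?_ ((Category.id_comp _).trans (Category.comp_id _)).symm
        change c.map _ ≫ u = c.map _ ≫ 𝟙 _ ≫ c.map _ ≫ u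
        rw [Category.id_comp]
        exact (congrArg (· ≫ u) (c.map_comp
          (homOfLE (θ.monotone (Fin.le_last x)) : θ x ⟶ θ (Fin.last m))
          (homOfLE (Fin.le_last _)))).trans (Category.assoc _ _ _)
    | star =>
      cases y with
      | of y => exact (WithTerminal.false_of_from_star f).elim
      | star => exact ((Category.id_comp _).trans (Category.comp_id _)).symm
  rw [append, append, ← h, ← CategoryTheory.Functor.assoc, ← splitLast_comp_map]
  rfl

lemma append_obj_last {n : ℕ} (c : ComposableArrows I n) (u : c.obj (Fin.last n) ⟶ i) :
    (append c u).obj (Fin.last _) = i :=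
  congrArg (terminalExtension c u).obj (splitLast_obj_of_not_lt (lt_irrefl _))

/-- The inclusion of `Fin (n + 1)` in `Fin (n + 2)`. -/
def castSuccHom (n : ℕ) : Fin (n + 1) →o Fin (n + 2) := Fin.castSuccOrderEmb.toOrderHom

lemma castSuccHom_comp_append {n : ℕ} (c : ComposableArrows I n) (u : c.obj (Fin.last n) ⟶ i) :
    (castSuccHom n).monotone.functor ⋙ append c u = c := by
  have h : (castSuccHom n).monotone.functor ⋙ splitLast n = WithTerminal.incl :=
    CategoryTheory.Functor.ext (fun j ↦ splitLast_obj_of_lt (j := j.castSucc) j.is_lt)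
      fun _ _ _ ↦ Subsingleton.elim _ _
  rw [append, ← CategoryTheory.Functor.assoc, h]
  rfl

lemma append_map_castSucc {n : ℕ} (c : ComposableArrows I n) (u : c.obj (Fin.last n) ⟶ i)
    (h : c.obj (Fin.last n) = (append c u).obj (Fin.last n).castSucc)
    (f : (Fin.last n).castSucc ⟶ Fin.last (n + 1)) :
    eqToHom h ≫ (append c u).map f ≫ eqToHom (append_obj_last c u) = u := by
  have key (p q : WithTerminal (Fin (n + 1))) (hp : p = .of (Fin.last n)) (hq : q = .star)
      (g : p ⟶ q) (h : c.obj (Fin.last n) = (terminalExtension c u).obj p)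
      (h' : (terminalExtension c u).obj q = i) :
      eqToHom h ≫ (terminalExtension c u).map g ≫ eqToHom h' = u := by
    subst hp hq
    change 𝟙 _ ≫ (c.map (𝟙 _) ≫ u) ≫ 𝟙 _ = u
    simp
  exact key _ _ (splitLast_obj_of_lt (Nat.lt_succ_self n))
    (splitLast_obj_of_not_lt (lt_irrefl _)) _ _ _

lemma comp_eqToHom_of_eq {n : ℕ} (c : ComposableArrows I n) {j k : Fin (n + 1)} (h : j = k)
    (f : j ⟶ k) : c.map f = eqToHom (congrArg c.obj h) := by
  subst h
  exact c.map_id _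

end Append

/-! ## The contraction of the comma categories of the nerve -/

section NerveContraction

variable {I : Type w} [SmallCategory.{w} I] {i : I}

open SimplexCat

/-- The simplex `σ` of the nerve extended by the morphism `u` from its last object. -/
def appendSimplex (X : CostructuredArrow (forgetful I) i) : SimplexCat (nerve I) :=
  op ⟨op ⦋X.left.len + 1⦌, append (chain X.left) X.hom⟩

lemma forgetful_appendSimplex (X : CostructuredArrow (forgetful I) i) :
    (forgetful I).obj (appendSimplex X) = i :=
  append_obj_last (chain X.left) X.hom

/-- The extended simplex as an object over `i`. -/
def appendObj (X : CostructuredArrow (forgetful I) i) : CostructuredArrow (forgetful I) i :=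
  .mk (Y := appendSimplex X) (eqToHom (forgetful_appendSimplex X))

lemma forgetful_map {X Y : SimplexCat (nerve I)} (f : X ⟶ Y) :
    (forgetful I).map f = eqToHom (chain_obj_last f) ≫
      (chain Y).map (homOfLE (Fin.le_last (f.unop.1.unop.toOrderHom (Fin.last _)))) := rfl

lemma monotone_comp_chain {X Y : SimplexCat (nerve I)} (f : X ⟶ Y) :
    (under f).toOrderHom.monotone.functor ⋙ chain Y = chain X := map_under f

/-- An operator that preserves the last vertex induces an identity of last objects, up to transport.
The maps between extended simplices, and those from the base to them, have this form. -/
lemma forgetful_map_comp_eqToHom {X Y : SimplexCat (nerve I)} (f : X ⟶ Y)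
    (hf : (under f).toOrderHom (Fin.last _) = Fin.last _) {j : I}
    (hY : (forgetful I).obj Y = j) (hX : (forgetful I).obj X = j) :
    (forgetful I).map f ≫ eqToHom hY = eqToHom hX := by
  rw [forgetful_map, comp_eqToHom_of_eq _ hf]
  erw [eqToHom_trans, eqToHom_trans]

/-- The morphism of extended simplices given by a morphism of simplices over `i`. -/
def appendSimplexMap {X Y : CostructuredArrow (forgetful I) i} (f : X ⟶ Y) :
    appendSimplex X ⟶ appendSimplex Y :=
  mkHom (SimplexCategory.Hom.mk (succHom (under f.left).toOrderHom))
    (append_comp (under f.left).toOrderHom (chain Y.left) Y.hom (chain X.left) X.hom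
      (monotone_comp_chain f.left)
      ((CostructuredArrow.w f).symm.trans (Category.assoc _ _ _)))

lemma nerveComma_hom_ext {X Y : CostructuredArrow (forgetful I) i} {f g : X ⟶ Y}
    (h : ∀ j, (under f.left).toOrderHom j = (under g.left).toOrderHom j) : f = g :=
  CostructuredArrow.hom_ext _ _ (hom_ext (SimplexCategory.Hom.ext _ _ (OrderHom.ext _ _ (funext h))))

/-- The morphism of extended simplices over `i`. -/
def appendMap {X Y : CostructuredArrow (forgetful I) i} (f : X ⟶ Y) : appendObj X ⟶ appendObj Y :=
  CostructuredArrow.homMk (appendSimplexMap f)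
    (forgetful_map_comp_eqToHom (appendSimplexMap f) (succHom_last (under f.left).toOrderHom)
      (forgetful_appendSimplex Y) (forgetful_appendSimplex X))

lemma appendMap_castSucc {X Y : CostructuredArrow (forgetful I) i} (f : X ⟶ Y)
    (j : Fin (X.left.len + 1)) : (under (appendMap f).left).toOrderHom j.castSucc =
      ((under f.left).toOrderHom j).castSucc :=
  succHom_castSucc _ j

lemma appendMap_last {X Y : CostructuredArrow (forgetful I) i} (f : X ⟶ Y) :
    (under (appendMap f).left).toOrderHom (Fin.last (X.left.len + 1)) =
      Fin.last (Y.left.len + 1) :=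
  succHom_last _

/-- The functor that extends simplices over `i`. -/
def appendFunctor (i : I) :
    CostructuredArrow (forgetful I) i ⥤ CostructuredArrow (forgetful I) i where
  obj := appendObj
  map := appendMap
  map_id X := nerveComma_hom_ext (Fin.lastCases (appendMap_last (𝟙 X))
    (appendMap_castSucc (𝟙 X)))
  map_comp f g := nerveComma_hom_ext (Fin.lastCases
    ((appendMap_last (f ≫ g)).trans ((congrArg (under (appendMap g).left).toOrderHom
      (appendMap_last f)).trans (appendMap_last g)).symm)
    fun j ↦ (appendMap_castSucc (f ≫ g) j).trans
      ((congrArg (under (appendMap g).left).toOrderHom (appendMap_castSucc f j)).trans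
        (appendMap_castSucc g _)).symm)

/-- The inclusion of a simplex over `i` in the extended simplex. -/
def appendUnitApp (X : CostructuredArrow (forgetful I) i) : X ⟶ appendObj X :=
  CostructuredArrow.homMk
    (mkHom (τ := appendSimplex X) (SimplexCategory.Hom.mk (castSuccHom _))
      (castSuccHom_comp_append (chain X.left) X.hom))
    ((Category.assoc _ _ _).trans (append_map_castSucc (chain X.left) X.hom _ _))

/-- The inclusion of simplices in the extended simplices. -/
def appendUnit (i : I) : 𝟭 _ ⟶ appendFunctor i where
  app X := appendUnitApp X
  naturality _ _ f := nerveComma_hom_ext fun j ↦ (appendMap_castSucc f j).symm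

/-- The object `i` as an object over `i`. -/
def nerveBase (i : I) : CostructuredArrow (forgetful I) i :=
  .mk (Y := SimplexCat.mk (n := 0) (K := nerve I) (ComposableArrows.mk₀ i)) (𝟙 i)

/-- The inclusion of the last object in the extended simplex. -/
def nerveBaseMapApp (X : CostructuredArrow (forgetful I) i) : nerveBase i ⟶ appendObj X :=
  CostructuredArrow.homMk
    (mkHom (σ := (nerveBase i).left) (τ := appendSimplex X)
      (SimplexCategory.Hom.mk (OrderHom.const _ (Fin.last _)))
      (ComposableArrows.ext₀ (append_obj_last (chain X.left) X.hom)))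
    (forgetful_map_comp_eqToHom (mkHom (σ := (nerveBase i).left) (τ := appendSimplex X)
      (SimplexCategory.Hom.mk (OrderHom.const _ (Fin.last _))) _) rfl (forgetful_appendSimplex X) rfl)

/-- The inclusions of the last objects in the extended simplices. -/
def nerveBaseMap (i : I) : (Functor.const _).obj (nerveBase i) ⟶ appendFunctor i where
  app X := nerveBaseMapApp X
  naturality _ _ f := nerveComma_hom_ext fun _ ↦ (appendMap_last f).symm

lemma succHom_surjective {m n : ℕ} (θ : Fin (m + 1) →o Fin (n + 1))
    (h : Function.Surjective θ) : Function.Surjective (succHom θ) := by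
  intro j
  refine Fin.lastCases ⟨_, succHom_last θ⟩ (fun j ↦ ?_) j
  obtain ⟨k, rfl⟩ := h j
  exact ⟨_, succHom_castSucc θ k⟩

/-- The comma categories of the forgetful functor from the simplex category of the nerve are
contractible. -/
def nerveContraction (i : I) : CommaContraction (degeneracyData (nerve I)) (forgetful I) i where
  -- The zigzag σ ⟶ σ * i ⟵ (i). The extended chains end at `i` itself, so their structure maps are
  -- invertible.
  functor := appendFunctor i
  map_degeneracy e he :=
    SimplexCategory.epi_iff_surjective.2 (succHom_surjective (under e.left).toOrderHom
      (SimplexCategory.epi_iff_surjective.1 he))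
  base := nerveBase i
  unit := appendUnit i
  baseMap := nerveBaseMap i
  isIso_hom X := inferInstanceAs (IsIso (eqToHom (forgetful_appendSimplex X)))
  isIso_base := inferInstanceAs (IsIso (𝟙 _))

end NerveContraction

/-! ## The Bousfield-Kan approximation -/

section

variable {M : Type uM} [Category.{vM} M] [ModelCategory M] {D : Type uD} [Category.{vD} D]
  {E : Type uE} [Category.{vE} E] {W : MorphismProperty D} {l : M ⥤ D} {r : D ⥤ M} {adj : l ⊣ r}

namespace IsLeftModelApproximation

variable (hadj : IsLeftModelApproximation W adj)

include hadj

lemma respectsIso : W.RespectsIso :=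
  have := hadj.twoOutOfThree
  MorphismProperty.respectsIso_of_isStableUnderComposition hadj.isomorphisms_le

/-- Total left derived functors are computed by cofibrant replacements in a good left model
approximation. -/
lemma exists_isLeftDerived {F : D ⥤ E} {V : MorphismProperty E} (hF : IsGoodFor adj F V)
    {H : Type uH} [Category.{vH} H] (L : E ⥤ H) [L.IsLocalization V] :
    (∃ (LF : D ⥤ H) (α : LF ⟶ F ⋙ L), IsLeftDerived W α) ∧
      ∀ Q : CofibrantReplacement M, ∃ hQ : Q.IsFunctorial l r (F ⋙ L),
        IsLeftDerived W (Q.natTrans adj hQ) := by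
  have hΦ ⦃X Y : M⦄ (f : X ⟶ Y) (hX : IsCofibrant X) (hY : IsCofibrant Y)
      (hf : WeakEquivalence f) : IsIso ((F ⋙ L).map (l.map f)) :=
    Localization.inverts L V _ (hF f hX hY hf)
  have h (Q : CofibrantReplacement M) : ∃ hQ : Q.IsFunctorial l r (F ⋙ L),
      IsLeftDerived W (Q.natTrans adj hQ) :=
    ⟨Q.isFunctorial r _ hΦ, Q.isLeftDerived hadj hΦ _⟩
  obtain ⟨Q⟩ := CofibrantReplacement.nonempty M
  obtain ⟨hQ, hQ'⟩ := h Q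
  exact ⟨⟨_, _, hQ'⟩, h⟩

end IsLeftModelApproximation

lemma HomotopyMeaningfulOnCofibrant.of_iso {G G' : M ⥤ D} [W.RespectsIso]
    (hG : HomotopyMeaningfulOnCofibrant G W) (e : G ≅ G') : HomotopyMeaningfulOnCofibrant G' W :=
  fun _ _ f hX hY hf ↦ (W.arrow_mk_iso_iff (Arrow.isoMk (e.app _) (e.app _)
    (e.hom.naturality f).symm)).1 (hG f hX hY hf)

end

section BousfieldKanApproximation

variable (I : Type w) [SmallCategory.{w} I] {M : Type uM} [Category.{vM} M] [ModelCategory M]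
  [HasLimitsOfSize.{w, w} M] [HasColimitsOfSize.{w, w} M]
  {C : Type uC} [Category.{vC} C] {W : MorphismProperty C} {l : M ⥤ C} {r : C ⥤ M} {adj : l ⊣ r}

attribute [local instance] objectwiseFibrations objectwiseWeakEquivalences
  projectiveCofibrations' boundedModelCategory

/-! ### Left Quillen functors through ε^k -/

section LeftQuillen

variable {A : (I ⥤ M) ⥤ M} {B : M ⥤ I ⥤ M} (adjA : A ⊣ B)
  (hB : ∀ (R : MorphismProperty M) [∀ J : Type w, R.IsStableUnderProductsOfShape J]
    ⦃X Y : M⦄ (p : X ⟶ Y), R p → R.functorCategory I (B.map p))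

include adjA hB

/-- Stating `hB` for all product-stable classes covers fibrations and trivial fibrations at once. It
applies to evaluations, to `colim`, and to `f.lan` followed by an evaluation. -/
lemma isCofibrant_leftKan_comp {X : BoundedDiagram (nerve I) M} (hX : IsCofibrant X) :
    IsCofibrant ((leftKan I ⋙ A).obj X) :=
  isCofibrant_map_of_adjunction ((leftKanAdjunction I).comp adjA) (fun X Y p hp hp' ↦ by
    have h := hB (trivialFibrations M) p ⟨(fibration_iff p).1 hp, (weakEquivalence_iff p).1 hp'⟩
    exact ⟨(fibration_iff _).2 fun σ ↦ (h ((forgetful I).obj σ)).1,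
      (weakEquivalence_iff _).2 fun σ ↦ (h ((forgetful I).obj σ)).2⟩) hX

lemma weakEquivalence_leftKan_comp ⦃X Y : BoundedDiagram (nerve I) M⦄ (f : X ⟶ Y)
    (hX : IsCofibrant X) (hY : IsCofibrant Y) (hf : WeakEquivalence f) :
    WeakEquivalence ((leftKan I ⋙ A).map f) :=
  weakEquivalence_map_of_adjunction ((leftKanAdjunction I).comp adjA) (fun X Y p hp ↦ by
    have h := hB (fibrations M) p ((fibration_iff p).1 hp)
    exact (fibration_iff _).2 fun σ ↦ h ((forgetful I).obj σ)) f hX hY hf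

lemma homotopyMeaningful_leftKan_comp (hadj : IsLeftModelApproximation W adj) :
    HomotopyMeaningfulOnCofibrant (leftKan I ⋙ A ⋙ l) W :=
  fun _ _ f hX hY hf ↦ hadj.left_map _ (isCofibrant_leftKan_comp I adjA hB hX)
    (isCofibrant_leftKan_comp I adjA hB hY) (weakEquivalence_leftKan_comp I adjA hB f hX hY hf)

end LeftQuillen

omit [ModelCategory M] [HasColimitsOfSize.{w, w} M] in
lemma evaluationRightAdjoint_map_mem {J : Type w} [SmallCategory.{w} J] (j : J)
    (R : MorphismProperty M) [∀ J : Type w, R.IsStableUnderProductsOfShape J]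
    ⦃X Y : M⦄ (p : X ⟶ Y) (hp : R p) :
    R.functorCategory J ((evaluationRightAdjoint M j).map p) :=
  fun _ ↦ piLift_mem R (fun _ ↦ p) fun _ ↦ hp

variable (hadj : IsLeftModelApproximation W adj)

omit [ModelCategory M] [HasLimitsOfSize.{w, w} M] in
-- Identifies the unit with `lanUnit`, for which the pointwise colimit formula is available.
lemma leftKanAdjunction_unit_app (X : BoundedDiagram (nerve I) M) :
    ((leftKanAdjunction I).unit.app X).hom = (forgetful I).lanUnit.app X.obj := by
  have := ((forgetful I).lanAdjunction M).map_restrictFullyFaithful_unit_app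
    (iC := (IsBounded (nerve I) M).ι) (iD := 𝟭 _) (L := leftKan I) (R := pullbackAlong I)
    (IsBounded (nerve I) M).fullyFaithfulι (.id _) (Iso.refl _) (Iso.refl _) X
  refine this.trans ?_
  rw [Functor.lanAdjunction_unit]
  have h : (forgetful I).lanUnit.app X.obj ≫ ((Functor.whiskeringLeft _ _ M).obj (forgetful I)).map
      (𝟙 ((forgetful I).lan.obj X.obj)) ≫ 𝟙 _ = (forgetful I).lanUnit.app X.obj := by
    rw [CategoryTheory.Functor.map_id, Category.comp_id]
    exact Category.comp_id _
  exact h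

/-- The contraction of the comma category applies because the unit followed by the adjoint of `f` is
`f`, an objectwise weak equivalence. -/
lemma weakEquivalence_leftKan_desc {X : BoundedDiagram (nerve I) M} (hX : IsCofibrant X)
    {H : I ⥤ M} (f : X ⟶ (pullbackAlong I).obj H) (hf : WeakEquivalence f) (i : I) :
    WeakEquivalence ((((leftKanAdjunction I).homEquiv X H).symm f).app i) := by
  refine (nerveContraction i).weakEquivalence_app (δ := SimplexCat.degeneracyData (nerve I))
    ((isBounded_iff (forgetful I)).1 (isBounded_forgetful_comp I (𝟭 I))) isBounded_iff X hX
    ((forgetful I).lanUnit.app X.obj)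
    ((forgetful I).isPointwiseLeftKanExtensionLeftKanExtensionUnit X.obj i) _ fun σ ↦ ?_
  have h : (leftKanAdjunction I).unit.app X ≫
      (pullbackAlong I).map (((leftKanAdjunction I).homEquiv X H).symm f) = f :=
    ((leftKanAdjunction I).homEquiv_unit _ _ _).symm.trans (Equiv.apply_symm_apply _ _)
  have h₁ := congrArg (fun g ↦ g.hom.app σ) h
  have h₂ : ((leftKanAdjunction I).unit.app X).hom.app σ ≫
      (((leftKanAdjunction I).homEquiv X H).symm f).app ((forgetful I).obj σ) = f.hom.app σ := h₁
  rw [leftKanAdjunction_unit_app] at h₂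
  have h₃ : WeakEquivalence (f.hom.app σ) :=
    (weakEquivalence_iff _).2 ((weakEquivalence_iff f).1 hf σ)
  rw [← h₂] at h₃
  exact h₃

include hadj

/-- The Bousfield-Kan approximation. -/
lemma isLeftModelApproximation_bousfieldKan :
    IsLeftModelApproximation (W.functorCategory I) (bousfieldKan I adj) where
  isomorphisms_le _ _ f (hf : IsIso f) i := hadj.isomorphisms_le (f.app i) (inferInstanceAs (IsIso _))
  twoOutOfThree :=
    have := hadj.twoOutOfThree
    hasTwoOutOfThreeProperty_functorCategory W I
  right_map _ _ f hf := (weakEquivalence_iff _).2 fun σ ↦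
    (weakEquivalence_iff _).1 (hadj.right_map _ (hf ((forgetful I).obj σ)))
  left_map _ _ f hX hY hf i := homotopyMeaningful_leftKan_comp I (evaluationAdjunctionLeft M i)
    (evaluationRightAdjoint_map_mem i) hadj f hX hY hf
  adjoint_map A X f hX hf i := by
    have h := hadj.adjoint_map (A := A.obj i) _
      (isCofibrant_leftKan_comp I (evaluationAdjunctionLeft M i)
        (evaluationRightAdjoint_map_mem i) hX)
      (weakEquivalence_leftKan_desc I hX (H := A ⋙ r) f hf i)
    -- Adjunction in two stages: first along ε^k, giving a weak equivalence from a cofibrant object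
    -- at `i`, then along `l`, where the hypothesis on `adj` applies.
    have h' : (((bousfieldKan I adj).homEquiv X A).symm f).app i =
      (adj.homEquiv _ _).symm ((((leftKanAdjunction I).homEquiv X (A ⋙ r)).symm f).app i) := by
      rw [bousfieldKan, Adjunction.comp_homEquiv, Adjunction.homEquiv_counit]
      refine (congrArg (fun φ ↦ φ.app i) ((adj.whiskerRight I).homEquiv_counit
        (X := (leftKan I).obj X) (Y := A)
        (g := ((leftKanAdjunction I).homEquiv X (A ⋙ r)).symm f))).trans ?_
      exact congrArg (_ ≫ ·) ((Category.id_comp _).trans (Category.comp_id _))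
    rw [h']
    exact h

/-- `l` commutes with colimits, and `colim` after ε^k is left Quillen because constant diagrams
preserve objectwise classes. -/
lemma isGoodFor_colim [HasColimitsOfSize.{w, w} C] :
    IsGoodFor (bousfieldKan I adj) (colim : (I ⥤ C) ⥤ C) W := by
  have := hadj.respectsIso
  have := adj.leftAdjoint_preservesColimits
  exact (homotopyMeaningful_leftKan_comp I colimConstAdj (fun _ _ _ _ _ hp _ ↦ hp) hadj).of_iso
    (Functor.isoWhiskerLeft (leftKan I) (preservesColimitNatIso l))

/-- Uniqueness of left adjoints gives `e`, which moves `l` past the Kan extension; each evaluation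
of the extension after ε^k is then left Quillen. -/
lemma isGoodFor_lan {J : Type w} [SmallCategory.{w} J] (f : I ⥤ J) [HasColimitsOfSize.{w, w} C] :
    IsGoodFor (bousfieldKan I adj) (f.lan : (I ⥤ C) ⥤ (J ⥤ C)) (W.functorCategory J) := by
  have := hadj.respectsIso
  let e : f.lan ⋙ (Functor.whiskeringRight J M C).obj l ≅
      (Functor.whiskeringRight I M C).obj l ⋙ f.lan :=
    ((f.lanAdjunction M).comp (adj.whiskerRight J)).leftAdjointUniq
      ((adj.whiskerRight I).comp (f.lanAdjunction C))
  have h : HomotopyMeaningfulOnCofibrant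
      (leftKan I ⋙ f.lan ⋙ (Functor.whiskeringRight J M C).obj l) (W.functorCategory J) :=
    fun X Y g hX hY hg j ↦ homotopyMeaningful_leftKan_comp I
      ((f.lanAdjunction M).comp (evaluationAdjunctionLeft M j))
      (fun R _ _ _ p hp i ↦ evaluationRightAdjoint_map_mem j R p hp (f.obj i)) hadj g hX hY hg
  have := (isLeftModelApproximation_bousfieldKan J hadj).respectsIso
  exact h.of_iso (Functor.isoWhiskerLeft (leftKan I) e)

end BousfieldKanApproximation

end ModelApproximation

end

theorem mainTheorem1 {M : Type uM} [Category.{vM} M] [ModelCategory M]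
    [HasLimitsOfSize.{w, w} M] [HasColimitsOfSize.{w, w} M]
    {C : Type uC} [Category.{vC} C] (W : MorphismProperty C)
    {l : M ⥤ C} {r : C ⥤ M} (adj : l ⊣ r) (hadj : IsLeftModelApproximation W adj)
    (I : Type w) [SmallCategory.{w} I] (J : Type w) [SmallCategory.{w} J] (f : I ⥤ J) :
    ∃ _ : ModelCategory (BoundedDiagram (nerve I) M),
      -- the model structure on bounded diagrams
      weakEquivalences (BoundedDiagram (nerve I) M) =
        BoundedDiagram.objectwise (weakEquivalences M) ∧
      fibrations (BoundedDiagram (nerve I) M) = BoundedDiagram.objectwise (fibrations M) ∧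
      cofibrations (BoundedDiagram (nerve I) M) = BoundedDiagram.latchingCofibrations ∧
      HasLimitsOfSize.{w, w} (BoundedDiagram (nerve I) M) ∧
      HasColimitsOfSize.{w, w} (BoundedDiagram (nerve I) M) ∧
      -- the Bousfield-Kan approximation is a left model approximation
      IsLeftModelApproximation (W.functorCategory I) (bousfieldKan I adj) ∧
      ∀ [HasColimitsOfSize.{w, w} C],
        -- it is good for the colimit and for the left Kan extension
        IsGoodFor (bousfieldKan I adj) (colim : (I ⥤ C) ⥤ C) W ∧
        IsGoodFor (bousfieldKan I adj) (f.lan : (I ⥤ C) ⥤ (J ⥤ C)) (W.functorCategory J) ∧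
        -- the homotopy colimit exists, and it is computed by cofibrant replacements
        Nonempty (MorphismProperty.HasLocalization.{vM} W) ∧
        (∀ {H : Type uH} [Category.{vH} H] (L : C ⥤ H) [L.IsLocalization W],
          (∃ (hocolim : (I ⥤ C) ⥤ H) (α : hocolim ⟶ colim ⋙ L),
            IsLeftDerived (W.functorCategory I) α) ∧
          ∀ Q : CofibrantReplacement (BoundedDiagram (nerve I) M),
            ∃ hQ : Q.IsFunctorial (bousfieldKanLeft I l) (bousfieldKanRight I r)
                (colim ⋙ L),
              IsLeftDerived (W.functorCategory I) (Q.natTrans (bousfieldKan I adj) hQ)) ∧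
        -- the same for the homotopy left Kan extension
        Nonempty (MorphismProperty.HasLocalization.{max w vM} (W.functorCategory J)) ∧
        (∀ {H : Type uH} [Category.{vH} H] (L : (J ⥤ C) ⥤ H)
          [L.IsLocalization (W.functorCategory J)],
          (∃ (hoLan : (I ⥤ C) ⥤ H) (α : hoLan ⟶ f.lan ⋙ L),
            IsLeftDerived (W.functorCategory I) α) ∧
          ∀ Q : CofibrantReplacement (BoundedDiagram (nerve I) M),
            ∃ hQ : Q.IsFunctorial (bousfieldKanLeft I l) (bousfieldKanRight I r)
                (f.lan ⋙ L),
              IsLeftDerived (W.functorCategory I) (Q.natTrans (bousfieldKan I adj) hQ)) := by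
  let := boundedModelCategory (nerve I) M
  let := boundedModelCategory (nerve J) M
  have hI := isLeftModelApproximation_bousfieldKan I hadj
  -- The approximation over `J` serves only to bound the morphism sets of Ho(Fun(J, C)).
  have hJ := isLeftModelApproximation_bousfieldKan J hadj
  obtain ⟨h₁, h₂, h₃⟩ := boundedModelCategory_spec (K := nerve I) (M := M)
  refine ⟨boundedModelCategory (nerve I) M, h₁, h₂, h₃,
    (SimplexCat.degeneracyData (nerve I)).hasLimitsOfSize isBounded_iff,
    (SimplexCat.degeneracyData (nerve I)).hasColimitsOfSize isBounded_iff, hI, ?_⟩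
  intro _
  have h₄ := isGoodFor_colim I hadj
  have h₅ := isGoodFor_lan I hadj f
  exact ⟨h₄, h₅, nonempty_hasLocalization hadj, fun L _ ↦ hI.exists_isLeftDerived h₄ L,
    nonempty_hasLocalization hJ, fun L _ ↦ hI.exists_isLeftDerived h₅ L⟩
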